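/- \textbf{Theorem} ($[\mathsf F(X)] = 1+\mathrm{Exp}([X]\,\mathrm{Log}(s_1))$). For a finite group $\Gamma$ let $K(\mathsf V,\Gamma)$ be the abelian group generated by the classes $[X]$ of quasi-projective complex varieties $X$ (reduced, possibly reducible or empty) with an action of $\Gamma$, modulo $[X]=[Y]$ if $X$ and $Y$ are equivariantly isomorphic and $[X]=[X\setminus Y]+[Y]$ if $Y\subset X$ is a closed $\Gamma$-invariant subvariety. Let $K(\mathsf V,\mathbb S)=\prod_{n\ge 0}K(\mathsf V,S_n)$, and let $F_1\subset K(\mathsf V,\mathbb S)$ be the subgroup of elements with zero component in $K(\mathsf V,S_0)=K(\mathsf V)$. A sequence $\mathcal X=(\mathcal X(n))_{n\ge 0}$ of quasi-projective varieties with actions of $S_n$ (an $\mathbb S$-variety) has a class $[\mathcal X]=([\mathcal X(n)])_n$. Set $$(\mathcal X\boxtimes\mathcal Y)(n)=\bigsqcup_{m=0}^n \mathrm{Ind}_{S_m\times S_{n-m}}^{S_n}\bigl(\mathcal X(m)\times\mathcal Y(n-m)\bigr),\qquad (\mathcal X\circ\mathcal Y)(n)=\bigsqcup_{i\ge 0}\bigl(\mathcal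 X(i)\times\mathcal Y^{\boxtimes i}(n)\bigr)/S_i\quad(\mathcal Y(0)=\emptyset).$$ There is a unique biadditive product on $K(\mathsf V,\mathbb S)$ with $[\mathcal X][\mathcal Y]=[\mathcal X\boxtimes\mathcal Y]$, and there is a unique associative operation $\circ\colon K(\mathsf V,\mathbb S)\times F_1\to K(\mathsf V,\mathbb S)$ with $[\mathcal X]\circ[\mathcal Y]=[\mathcal X\circ\mathcal Y]$ whenever $\mathcal Y(0)=\emptyset$, which is additive in the first argument and such that, for all $a$ and $n$, the component of $a\circ b$ in $K(\mathsf V,S_n)$ is a polynomial map of degree at most $n$ in $b$ (its differences of order $n+1$ vanish). Let $s_n\in K(\mathsf V,S_n)\subset K(\mathsf V,\mathbb S)$ be the class of $\mathrm{Spec}(\mathbb C)$ with trivial action, and $1=s_0$. The map $$\mathrm{Exp}\colon F_1\to F_1,\qquad \mathrm{Exp}(a)=\sum_{n=1}^\infty s_n\circ a,$$ has a two-sided inverse $\mathrm{Log}\colon F_1\to F_1$. For a quasi-projective complex variety $X$ and $n\ge 0$ let $\mathsf F(X,n)=\{(z_1,\dots,z_n)\in X^n\mid z_i\ne z_j\text{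 for }i\ne j\}$, a quasi-projective variety on which $S_n$ acts by permuting the points, and let $[\mathsf F(X)]=([\mathsf F(X,n)])_{n\ge 0}\in K(\mathsf V,\mathbb S)$. Then, with $[X]\in K(\mathsf V)\subset K(\mathsf V,\mathbb S)$, the product $[X]\,\mathrm{Log}(s_1)$ lies in $F_1$ and $$[\mathsf F(X)] = 1+\mathrm{Exp}\bigl([X]\,\mathrm{Log}(s_1)\bigr).$$ -/

import Mathlib

noncomputable section

namespace SVar

/-! ## Spaces with regular functions and quasi-projective varieties -/

/-- A set of points with a topology and, at every point `x`, the set `Reg x` of those complex-valued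
functions that are regular at `x` (a condition on the function near `x` only).  A function is
regular on an open set if it is regular at each of its points.  Varieties are singled out among
these objects by `RegSpace.IsQuasiProjective`. -/
structure RegSpace : Type 1 where
  /-- the points -/
  Pt : Type
  /-- the (Zariski) topology -/
  top : TopologicalSpace Pt
  /-- the functions that are regular at a point -/
  Reg : Pt → Set (Pt → ℂ)

instance (X : RegSpace) : TopologicalSpace X.Pt := X.top

namespace RegSpace

/-- Morphisms: continuous maps that pull back regular functions to regular functions. -/
def IsMorphism (X Y : RegSpace) (φ : X.Pt → Y.Pt) : Prop :=
  Continuous φ ∧ ∀ (x : X.Pt) (f : Y.Pt → ℂ), f ∈ Y.Reg (φ x) → f ∘ φ ∈ X.Reg x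

/-- `e` is an isomorphism from `X` to `Y`. -/
def IsIso (X Y : RegSpace) (e : X.Pt ≃ Y.Pt) : Prop :=
  IsMorphism X Y e ∧ IsMorphism Y X e.symm

/-- The functions on `P` that, on the set of all `x` with `p i x ∈ U i` for every `i`, are
polynomials in functions `a ∘ p i` with `a` regular on `U i`. -/
def polyFun {ι : Type} {P : Type} (X : ι → RegSpace) (p : ∀ i, P → (X i).Pt)
    (U : ∀ i, Set (X i).Pt) : Subalgebra ℂ (P → ℂ) :=
  Algebra.adjoin ℂ {g | ∃ (i : ι) (a : (X i).Pt → ℂ), (∀ u ∈ U i, a ∈ (X i).Reg u) ∧ g = a ∘ p i}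

/-- The structure induced on a set `P` by a finite family of maps `p i : P → X i` which together are
injective, as on a (locally closed) subset `P` of the product of the `X i`: open sets are
generated by the non-vanishing loci, and the regular functions are locally the quotients, of
polynomials in regular functions of the single coordinates. -/
def induced {ι : Type} {P : Type} (X : ι → RegSpace) (p : ∀ i, P → (X i).Pt) : RegSpace where
  Pt := P
  top := TopologicalSpace.generateFrom
    {W | ∃ U : ∀ i, Set (X i).Pt, (∀ i, IsOpen (U i)) ∧
      ∃ g ∈ polyFun X p U, W = {x | (∀ i, p i x ∈ U i) ∧ g x ≠ 0}}
  Reg x := {f | ∃ U : ∀ i, Set (X i).Pt, (∀ i, IsOpen (U i) ∧ p i x ∈ U i) ∧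
      ∃ g ∈ polyFun X p U, ∃ h ∈ polyFun X p U, h x ≠ 0 ∧
        ∀ y, (∀ i, p i y ∈ U i) → h y ≠ 0 → f y = g y / h y}

/-- The product of a finite family. -/
def pi {ι : Type} (X : ι → RegSpace) : RegSpace :=
  induced (P := ∀ i, (X i).Pt) X fun i x => x i

/-- The product of two spaces. -/
def prod (X Y : RegSpace) : RegSpace :=
  induced (P := X.Pt × Y.Pt) (fun b : Bool => cond b X Y)
    fun b => match b with
      | true => Prod.fst
      | false => Prod.snd

/-- The disjoint union of a family. -/
def sigma {ι : Type} (X : ι → RegSpace) : RegSpace where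
  Pt := Σ i, (X i).Pt
  top := inferInstance
  Reg x := {f | (fun y => f ⟨x.1, y⟩) ∈ (X x.1).Reg x.2}

/-- A subset with the subspace topology and the functions that are locally restrictions of regular
functions; for a locally closed subset of a variety this is its (reduced) subvariety structure. -/
def restrict (X : RegSpace) (Z : Set X.Pt) : RegSpace where
  Pt := Z
  top := inferInstance
  Reg x := {f | ∃ g ∈ X.Reg x, ∃ U : Set X.Pt, IsOpen U ∧ (x : X.Pt) ∈ U ∧
      ∀ y : Z, (y : X.Pt) ∈ U → f y = g y}

/-- The variety `Spec ℂ`. -/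
def point : RegSpace where
  Pt := Unit
  top := ⊤
  Reg _ := Set.univ

/-- The Zariski topology on the complex projective space of dimension `N`: the open sets are
generated by the non-vanishing loci of homogeneous polynomials in the `N + 1` coordinates. -/
abbrev zariski (N : ℕ) : TopologicalSpace (Projectivization ℂ (Fin (N + 1) → ℂ)) :=
  TopologicalSpace.generateFrom
    {W | ∃ (d : ℕ) (F : MvPolynomial (Fin (N + 1)) ℂ), F.IsHomogeneous d ∧
      W = {p | F.eval p.rep ≠ 0}}

/-- A subset of projective space, with the Zariski topology and with the functions that are, near
the given point, quotients of two homogeneous polynomials of the same degree. -/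
def ofProjective (N : ℕ) (V : Set (Projectivization ℂ (Fin (N + 1) → ℂ))) : RegSpace where
  Pt := V
  top := (zariski N).induced Subtype.val
  Reg x := {f | ∃ U : Set (Projectivization ℂ (Fin (N + 1) → ℂ)), @IsOpen _ (zariski N) U ∧ x.1 ∈ U ∧
      ∃ (d : ℕ) (F G : MvPolynomial (Fin (N + 1)) ℂ), F.IsHomogeneous d ∧ G.IsHomogeneous d ∧
        ∀ y : V, y.1 ∈ U → G.eval y.1.rep ≠ 0 ∧ f y = F.eval y.1.rep / G.eval y.1.rep}

/-- Quasi-projective varieties over `ℂ` (reduced, but possibly reducible or empty): the spaces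
isomorphic to a locally closed subset of a projective space. -/
def IsQuasiProjective (X : RegSpace) : Prop :=
  ∃ (N : ℕ) (V : Set (Projectivization ℂ (Fin (N + 1) → ℂ))),
    @IsLocallyClosed _ (zariski N) V ∧ ∃ e : X.Pt ≃ (ofProjective N V).Pt, IsIso X _ e

end RegSpace

/-! ## Varieties with a group action and their Grothendieck group -/

/-- A space with an action of the group `Γ` on its points. -/
structure GSpace (Γ : Type) [Group Γ] : Type 1 where
  /-- the underlying space -/
  space : RegSpace
  /-- the action -/
  act : Γ →* Equiv.Perm space.Pt

namespace GSpace

variable {Γ : Type} [Group Γ]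

/-- Quasi-projective varieties with an action of `Γ` by morphisms (hence by automorphisms). -/
def IsVariety (X : GSpace Γ) : Prop :=
  X.space.IsQuasiProjective ∧ ∀ γ : Γ, RegSpace.IsMorphism X.space X.space (X.act γ)

/-- The space `X` with trivial action. -/
def trivial (Γ : Type) [Group Γ] (X : RegSpace) : GSpace Γ := ⟨X, 1⟩

/-- `j` is a `Γ`-equivariant isomorphism from `Y` onto the subspace `Z` of `X`. -/
def IsIsoOnto (Y X : GSpace Γ) (Z : Set X.space.Pt) (j : Y.space.Pt ≃ Z) : Prop :=
  RegSpace.IsIso Y.space (X.space.restrict Z) j ∧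
    ∀ (γ : Γ) (y : Y.space.Pt), ((j (Y.act γ y) : Z) : X.space.Pt) = X.act γ (j y)

end GSpace

/-- Quasi-projective varieties with an action of `Γ`. -/
def GVar (Γ : Type) [Group Γ] : Type 1 := {X : GSpace Γ // X.IsVariety}

/-- The relations `[X] = [Y]` for equivariantly isomorphic `X` and `Y`, and `[X] = [Y] + [U]` where
`Y` is (isomorphic to) a closed `Γ`-invariant subvariety of `X` and `U` to its complement. -/
inductive KRel (Γ : Type) [Group Γ] : FreeAbelianGroup (GVar Γ) → Prop
  | iso (X Y : GVar Γ) (e : Y.1.space.Pt ≃ X.1.space.Pt)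
      (he : RegSpace.IsIso Y.1.space X.1.space e)
      (hact : ∀ (γ : Γ) (y : Y.1.space.Pt), e (Y.1.act γ y) = X.1.act γ (e y)) :
      KRel Γ (FreeAbelianGroup.of X - FreeAbelianGroup.of Y)
  | cut (X Y U : GVar Γ) (Z : Set X.1.space.Pt) (hclosed : IsClosed Z)
      (hinv : ∀ (γ : Γ), ∀ z ∈ Z, X.1.act γ z ∈ Z)
      (i : Y.1.space.Pt ≃ Z) (hi : GSpace.IsIsoOnto Y.1 X.1 Z i)
      (j : U.1.space.Pt ≃ (Zᶜ : Set X.1.space.Pt)) (hj : GSpace.IsIsoOnto U.1 X.1 Zᶜ j) :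
      KRel Γ (FreeAbelianGroup.of X - (FreeAbelianGroup.of U + FreeAbelianGroup.of Y))

/-- The Grothendieck group `K(V, Γ)` of quasi-projective varieties over `ℂ` with `Γ`-action. -/
abbrev K (Γ : Type) [Group Γ] : Type 1 :=
  FreeAbelianGroup (GVar Γ) ⧸ AddSubgroup.closure {r | KRel Γ r}

open Classical in
/-- The class in `K(V, Γ)` of a variety with `Γ`-action (and `0` for a space that is not one). -/
def classOf {Γ : Type} [Group Γ] (X : GSpace Γ) : K Γ :=
  if h : X.IsVariety then QuotientAddGroup.mk (FreeAbelianGroup.of (⟨X, h⟩ : GVar Γ)) else 0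

/-! ## Spaces with symmetric group actions -/

/-- An `𝕊`-space: a functor `A ↦ X(A)` from finite sets and bijections to spaces.  Up to isomorphism
this is the same as a sequence of spaces `X(n)`, `n ≥ 0`, with actions of the symmetric
groups `S_n`, where `X(n)` is the value at `{0, …, n - 1}`. -/
structure SSpace : Type 1 where
  /-- the space `X(A)` -/
  obj (A : Type) [Finite A] : RegSpace
  /-- the action of bijections -/
  map {A B : Type} [Finite A] [Finite B] (e : A ≃ B) : (obj A).Pt → (obj B).Pt
  map_refl (A : Type) [Finite A] (x : (obj A).Pt) : map (Equiv.refl A) x = x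
  map_trans {A B C : Type} [Finite A] [Finite B] [Finite C] (e : A ≃ B) (f : B ≃ C)
    (x : (obj A).Pt) : map (e.trans f) x = map f (map e x)

namespace SSpace

/-- An `𝕊`-space of quasi-projective varieties and morphisms. -/
def IsVariety (X : SSpace) : Prop :=
  (∀ (A : Type) [Finite A], (X.obj A).IsQuasiProjective) ∧
    ∀ (A B : Type) [Finite A] [Finite B] (e : A ≃ B),
      RegSpace.IsMorphism (X.obj A) (X.obj B) (X.map e)

/-- The space `X(n)` with its action of the symmetric group `S_n`. -/
def level (X : SSpace) (n : ℕ) : GSpace (Equiv.Perm (Fin n)) where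
  space := X.obj (Fin n)
  act :=
    { toFun := fun σ =>
        { toFun := X.map σ
          invFun := X.map σ.symm
          left_inv := fun x => by rw [← X.map_trans, Equiv.self_trans_symm, X.map_refl]
          right_inv := fun x => by rw [← X.map_trans, Equiv.symm_trans_self, X.map_refl] }
      map_one' := Equiv.ext fun x => X.map_refl _ x
      map_mul' := fun σ τ => Equiv.ext fun x => X.map_trans τ σ x }

/-- The product `X ⊠ Y`, whose value at `A` is the disjoint union of `X(B) × Y(A \ B)` over all
subsets `B` of `A`, that is, of `Ind (X(m) × Y(n - m))` from `S_m × S_{n - m}` to `S_n` over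
`0 ≤ m ≤ n` if `A` has `n` elements.  The subset `B` is given by its indicator function. -/
def box (X Y : SSpace) : SSpace where
  obj A _ := RegSpace.sigma fun c : A → Bool =>
    RegSpace.prod (X.obj {a // c a = true}) (Y.obj {a // c a = false})
  map {A B} _ _ e z := ⟨z.1 ∘ e.symm,
    (X.map (e.subtypeEquiv fun a => by simp) z.2.1, Y.map (e.subtypeEquiv fun a => by simp) z.2.2)⟩
  map_refl A _ z := by
    obtain ⟨c, x, y⟩ := z
    exact Sigma.ext rfl (heq_of_eq (Prod.ext (X.map_refl _ x) (Y.map_refl _ y)))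
  map_trans e f z := by
    obtain ⟨c, x, y⟩ := z
    refine Sigma.ext rfl (heq_of_eq (Prod.ext ?_ ?_))
    · exact X.map_trans (e.subtypeEquiv (p := fun a => c a = true)
        (q := fun b => (c ∘ e.symm) b = true) fun a => by simp) (f.subtypeEquiv fun a => by simp) x
    · exact Y.map_trans (e.subtypeEquiv (p := fun a => c a = false)
        (q := fun b => (c ∘ e.symm) b = false) fun a => by simp) (f.subtypeEquiv fun a => by simp) y

/-- The block `q` of a partition of `A`, given as an equivalence relation. -/
abbrev Block {A : Type} (s : Setoid A) (q : Quotient s) : Type := {a : A // Quotient.mk s a = q}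

/-- The partition of `B` that corresponds to the partition `s` of `A` under a bijection. -/
abbrev moveSetoid {A B : Type} (e : A ≃ B) (s : Setoid A) : Setoid B := s.comap e.symm

/-- The induced bijection of the sets of blocks. -/
def moveQuot {A B : Type} (e : A ≃ B) (s : Setoid A) : Quotient s ≃ Quotient (moveSetoid e s) where
  toFun := Quotient.map' e fun a b h => by
    change s (e.symm (e a)) (e.symm (e b)); simpa using h
  invFun := Quotient.map' e.symm fun _ _ h => h
  left_inv := by rintro ⟨a⟩; exact congrArg (Quotient.mk s) (e.symm_apply_apply a)
  right_inv := by rintro ⟨a⟩; exact congrArg (Quotient.mk (moveSetoid e s)) (e.apply_symm_apply a)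

/-- The induced bijection of the single blocks. -/
def moveBlock {A B : Type} (e : A ≃ B) (s : Setoid A) (q : Quotient (moveSetoid e s)) :
    Block s ((moveQuot e s).symm q) ≃ Block (moveSetoid e s) q :=
  e.subtypeEquiv fun a => by rw [Equiv.eq_symm_apply]; rfl

/-- The composition `X ∘ Y` of `𝕊`-spaces with `Y(0)` empty.  Its value at `A` is the disjoint union
over all partitions of `A` into (non-empty) blocks of
`X(the set of blocks) × ∏ Y(B)`, the product being over the blocks `B`.  For `Y(0)` empty
this is the disjoint union over `i` of the quotients `(X(i) × Y^{⊠ i}(A)) / S_i`: the components of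
`Y^{⊠ i}(A)` are indexed by the ordered partitions of `A` into `i` non-empty blocks,
which `S_i` permutes freely. -/
def comp (X Y : SSpace) : SSpace where
  obj A _ := RegSpace.sigma fun s : Setoid A =>
    RegSpace.prod (X.obj (Quotient s)) (RegSpace.pi fun q : Quotient s => Y.obj (Block s q))
  map {A B} _ _ e z := ⟨moveSetoid e z.1,
    (X.map (moveQuot e z.1) z.2.1,
      fun q => Y.map (moveBlock e z.1 q) (z.2.2 ((moveQuot e z.1).symm q)))⟩
  map_refl A _ z := by
    obtain ⟨s, x, y⟩ := z
    refine Sigma.ext rfl (heq_of_eq (Prod.ext ?_ (funext ?_)))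
    · have : moveQuot (Equiv.refl A) s = Equiv.refl _ := Equiv.ext (by rintro ⟨a⟩; rfl)
      change X.map (moveQuot (Equiv.refl A) s) x = x
      rw [this]; exact X.map_refl _ x
    · rintro ⟨a⟩
      exact Y.map_refl _ _
  map_trans e f z := by
    obtain ⟨s, x, y⟩ := z
    refine Sigma.ext rfl (heq_of_eq (Prod.ext ?_ (funext ?_)))
    · have : moveQuot (e.trans f) s = (moveQuot e s).trans (moveQuot f (moveSetoid e s)) :=
        Equiv.ext (by rintro ⟨a⟩; rfl)
      exact (congrArg (fun E => X.map E x) this).trans (X.map_trans _ _ x)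
    · rintro ⟨a⟩
      exact Y.map_trans (moveBlock e s (Quotient.mk (moveSetoid e s) (f.symm a)))
        (moveBlock f (moveSetoid e s) (Quotient.mk (moveSetoid f (moveSetoid e s)) a))
        (y (Quotient.mk s (e.symm (f.symm a))))

/-- The `𝕊`-space `F(X)` of configurations: `F(X)(A)` is the space of injective maps from `A` to `X`,
as a subspace of the power `X^A`; thus `F(X)(n) = F(X, n)`, on which `S_n` permutes the points. -/
def config (X : RegSpace) : SSpace where
  obj A _ := (RegSpace.pi fun _ : A => X).restrict {z : A → X.Pt | Function.Injective z}
  map e z := ⟨z.1 ∘ e.symm, z.2.comp e.symm.injective⟩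
  map_refl _ _ _ := rfl
  map_trans _ _ _ := rfl

end SSpace

/-! ## The Grothendieck group of 𝕊-varieties -/

/-- The Grothendieck group `K(V, 𝕊)`, the product of the groups `K(V, S_n)`, `n ≥ 0`. -/
abbrev KS : Type 1 := ∀ n : ℕ, K (Equiv.Perm (Fin n))

/-- The first step `F_1` of the filtration of `K(V, 𝕊)`: the elements with vanishing component in
`K(V, S_0)`. -/
def F1 : AddSubgroup KS where
  carrier := {a | a 0 = 0}
  zero_mem' := rfl
  add_mem' {a b} ha hb := by
    change a 0 + b 0 = 0
    rw [show a 0 = 0 from ha, show b 0 = 0 from hb, add_zero]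
  neg_mem' {a} ha := by
    change -(a 0) = 0
    rw [show a 0 = 0 from ha, neg_zero]

/-- The class `[X]` of an `𝕊`-variety. -/
def cls (X : SSpace) : KS := fun n => classOf (X.level n)

/-- The class `[X]` of a variety in `K(V) = K(V, S_0)`, as an element of `K(V, 𝕊)`. -/
def cls₀ (X : RegSpace) : KS := Pi.single 0 (classOf (GSpace.trivial _ X))

/-- The class `s_n` in `K(V, S_n)`, as an element of `K(V, 𝕊)`, of `Spec ℂ` with the trivial action. -/
def s (n : ℕ) : KS := Pi.single n (classOf (GSpace.trivial _ RegSpace.point))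

/-- The class `s_1` as an element of `F_1`. -/
def s₁ : F1 := ⟨s 1, Pi.single_eq_of_ne (by decide) _⟩

/-- `mul` is the product of `K(V, 𝕊)`: it is biadditive and, for `𝕊`-varieties `X` and `Y`, `X ⊠ Y` is
an `𝕊`-variety with `[X] [Y] = [X ⊠ Y]`. -/
def IsProduct (mul : KS →+ KS →+ KS) : Prop :=
  ∀ X Y : SSpace, X.IsVariety → Y.IsVariety →
    (X.box Y).IsVariety ∧ mul (cls X) (cls Y) = cls (X.box Y)

/-- `φ` is a polynomial map of degree at most `n` between abelian groups: its differences of order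
`n + 1` vanish. -/
def IsPolynomialOfDegreeLE {G H : Type*} [AddCommGroup G] [AddCommGroup H] (n : ℕ) (φ : G → H) :
    Prop :=
  ∀ (b : G) (h : Fin (n + 1) → G),
    ∑ T : Finset (Fin (n + 1)), (-1 : ℤ) ^ T.card • φ (b + ∑ i ∈ T, h i) = 0

/-- `op` is the composition operation `K(V, 𝕊) × F_1 → K(V, 𝕊)`.  It is additive in the first argument,
and for `𝕊`-varieties `X` and `Y` with `Y(0)` empty, `X ∘ Y` is an `𝕊`-variety with
`[X] ∘ [Y] = [X ∘ Y]`.  It is extended from the classes `[Y]` to their differences so that the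
component of `a ∘ b` in `K(V, S_n)` is a polynomial map of degree at most `n` in `b`.  It is
associative, which includes that `F_1` is closed under it. -/
structure IsComposition (op : KS →+ (F1 → KS)) : Prop where
  cls_comp (X Y : SSpace) (hX : X.IsVariety) (hY : Y.IsVariety)
    (hempty : IsEmpty (Y.obj (Fin 0)).Pt) (b : F1) (hb : (b : KS) = cls Y) :
    (X.comp Y).IsVariety ∧ op (cls X) b = cls (X.comp Y)
  polynomial (a : KS) (n : ℕ) : IsPolynomialOfDegreeLE n fun b : F1 => op a b n
  assoc (a : KS) (b c : F1) : ∃ d : F1, (d : KS) = op b c ∧ op (op a b) c = op a d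

/-- The exponential `Exp(b) = ∑_{n ≥ 1} s_n ∘ b` on `F_1`, for the composition operation `op`.  As
`s_n ∘ b` has no components of degree less than `n`, the sum is finite in each degree `m`. -/
def Exp (op : KS →+ (F1 → KS)) (b : F1) : F1 :=
  ⟨fun m => ∑ n ∈ Finset.Icc 1 m, op (s n) b m, rfl⟩

end SVar

end

open SVar

/-!
All classes are computed with spaces of points and their regular functions. An immersion is a map
with the universal property of a subspace (`RegSpace.IsImm`). Products and disjoint unions of
quasi-projective varieties are quasi-projective by the Segre embedding and by placing projective
spaces as disjoint linear subspaces of a larger one (`prod_qp`, `sigma_qp`). A class does not change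
under an equivariant bijective morphism that is an isomorphism on each stratum of an upper
semicontinuous function (`GSpace.classOf_eq_of_strata`).

*The product.* `X ⊠ Y` is additive in each factor for closed subvarieties, so it extends to a
biadditive map, which is unique because classes generate (`existsUnique_isProduct`).

*The composition.* `X ∘ Y` is additive in `X`. In `Y` it is polynomial: a component of degree `n` of
`W ∘ (Y₁ ⊔ Y₂ ⊔ …)` involves at most `n` of the parts, since there are at most `n` blocks
(`sum_neg_one_pow_cls_comp`), and cutting `Y` into a closed part and its complement does not change
the class (`IsCut.cls_comp`). Such a function extends to a polynomial map on the whole group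
(`IsPoly.exists_extension`): it is linearized as `V ∘ t`, where `V` is additive and `t` takes
disjoint unions to products in a commutative ring in which products of `n + 1` differences `1 -
t(Y)` vanish. Hence all `t(Y)` are units, `t` extends to differences of classes, and so does `V ∘
t`. A polynomial map is determined by its values on effective elements (`effective_ext`), which
gives uniqueness. Associativity holds for spaces (`cls_comp_assoc`). It extends to all elements
because an iterated composition is polynomial along each line `k ↦ b + k c`
(`IsPreComposition.assoc`).

*The exponential.* `Exp b` is `h ∘ b`, where `h = ∑ s_n` over `n ≥ 1` is the class of the space
`points`. As `s_1 ∘ b = b`, and as the part of degree `m` of `s_n ∘ b` for `n ≥ 2` involves only the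
parts of `b` of degrees below `m`, the equation `Exp b = c` is solved degree by degree
(`IsPreComposition.bijective_Exp`).

*Configurations.* A map from `A` to `X` is a partition of `A` together with distinct points of `X`
for its blocks. This bijection between `(F(X) ∘ h)(A)` and `X^A` is an isomorphism on the strata of
maps with a given number of coincidences, so `[F(X)] ∘ h` is the class of the powers of `X`
(`cls_config_comp`). The latter is also `(1 + h) ∘ p`, where `p` is the class of `X` with
trivial action of `S_1`. Composing with `L = Log(s_1)`, for which `h ∘ L = s_1`, gives
`[F(X)] = (1 + h) ∘ (p ∘ L) = 1 + Exp(p ∘ L)`, and `p ∘ L = [X] L` because both are the class of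
`X × Y` if `L` is the class of `Y` (`IsPreComposition.mul_cls₀`).
-/

noncomputable section

namespace SVar

open Topology Filter

namespace RegSpace

/-! ### Well-behaved spaces with regular functions -/

/-- The sheaf-like properties that the regular functions of a variety have: the condition at `x` is
local, it defines a `ℂ`-algebra in which functions not vanishing at `x` are invertible, it is an
open condition on `x`, and regular functions have open non-vanishing loci. -/
class Nice (X : RegSpace) : Prop where
  congr {x : X.Pt} {f g : X.Pt → ℂ} : f ∈ X.Reg x → (∀ᶠ y in 𝓝 x, g y = f y) → g ∈ X.Reg x
  const (x : X.Pt) (c : ℂ) : (fun _ => c) ∈ X.Reg x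
  add {x : X.Pt} {f g : X.Pt → ℂ} : f ∈ X.Reg x → g ∈ X.Reg x → (fun y => f y + g y) ∈ X.Reg x
  mul {x : X.Pt} {f g : X.Pt → ℂ} : f ∈ X.Reg x → g ∈ X.Reg x → (fun y => f y * g y) ∈ X.Reg x
  inv {x : X.Pt} {f : X.Pt → ℂ} : f ∈ X.Reg x → f x ≠ 0 → (fun y => (f y)⁻¹) ∈ X.Reg x
  eventually_reg {x : X.Pt} {f : X.Pt → ℂ} : f ∈ X.Reg x → ∀ᶠ y in 𝓝 x, f ∈ X.Reg y
  eventually_ne {x : X.Pt} {f : X.Pt → ℂ} : f ∈ X.Reg x → f x ≠ 0 → ∀ᶠ y in 𝓝 x, f y ≠ 0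

theorem Nice.div {X : RegSpace} [X.Nice] {x : X.Pt} {f g : X.Pt → ℂ} (hf : f ∈ X.Reg x)
    (hg : g ∈ X.Reg x) (h : g x ≠ 0) : (fun y => f y / g y) ∈ X.Reg x := by
  simpa only [div_eq_mul_inv] using Nice.mul hf (Nice.inv hg h)

theorem Nice.sub {X : RegSpace} [X.Nice] {x : X.Pt} {f g : X.Pt → ℂ} (hf : f ∈ X.Reg x)
    (hg : g ∈ X.Reg x) : (fun y => f y - g y) ∈ X.Reg x := by
  have := Nice.add hf (Nice.mul (Nice.const x (-1)) hg)
  refine Nice.congr this (Eventually.of_forall fun y => ?_)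
  ring

/-! ### Morphisms -/

theorem IsMorphism.id (X : RegSpace) : IsMorphism X X id :=
  ⟨continuous_id, fun _ _ hf => hf⟩

theorem IsMorphism.comp {X Y Z : RegSpace} {g : Y.Pt → Z.Pt} {f : X.Pt → Y.Pt}
    (hg : IsMorphism Y Z g) (hf : IsMorphism X Y f) : IsMorphism X Z (g ∘ f) :=
  ⟨hg.1.comp hf.1, fun x a ha => hf.2 x _ (hg.2 (f x) a ha)⟩

theorem IsMorphism.congr {X Y : RegSpace} {f g : X.Pt → Y.Pt} (hf : IsMorphism X Y f)
    (h : ∀ x, g x = f x) : IsMorphism X Y g := by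
  rwa [show g = f from funext h]

theorem isMorphism_const {X Y : RegSpace} [X.Nice] (y : Y.Pt) : IsMorphism X Y fun _ => y :=
  ⟨continuous_const, fun x f _ => Nice.const x (f y)⟩

theorem isMorphism_of_subsingleton {X Y : RegSpace} [X.Nice] [Subsingleton Y.Pt]
    (φ : X.Pt → Y.Pt) : IsMorphism X Y φ := by
  rcases isEmpty_or_nonempty X.Pt with h | ⟨⟨x⟩⟩
  · exact ⟨continuous_of_const fun x => h.elim x, fun x => h.elim x⟩
  · rw [show φ = fun _ => φ x from funext fun _ => Subsingleton.elim _ _]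
    exact isMorphism_const _

/-! ### Induced structures -/

section Induced

variable {ι P : Type} {X : ι → RegSpace} {p : ∀ i, P → (X i).Pt}

theorem polyFun_mono {U V : ∀ i, Set (X i).Pt} (h : ∀ i, V i ⊆ U i) :
    polyFun X p U ≤ polyFun X p V :=
  Algebra.adjoin_mono fun _ ⟨i, a, ha, hg⟩ => ⟨i, a, fun u hu => ha u (h i hu), hg⟩

theorem polyFun_inter_left {U V : ∀ i, Set (X i).Pt} :
    polyFun X p U ≤ polyFun X p fun i => U i ∩ V i :=
  polyFun_mono fun _ => Set.inter_subset_left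

theorem polyFun_inter_right {U V : ∀ i, Set (X i).Pt} :
    polyFun X p V ≤ polyFun X p fun i => U i ∩ V i :=
  polyFun_mono fun _ => Set.inter_subset_right

theorem isOpen_induced_basic {U : ∀ i, Set (X i).Pt} (hU : ∀ i, IsOpen (U i)) {g : P → ℂ}
    (hg : g ∈ polyFun X p U) :
    @IsOpen P (induced X p).top {x : P | (∀ i, p i x ∈ U i) ∧ g x ≠ 0} :=
  TopologicalSpace.isOpen_generateFrom_of_mem ⟨U, hU, g, hg, rfl⟩

/-- The generating open sets form a basis of the induced topology. -/
theorem exists_induced_basic {O : Set (induced X p).Pt} (hO : IsOpen O) {x : P} (hx : x ∈ O) :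
    ∃ U : ∀ i, Set (X i).Pt, (∀ i, IsOpen (U i) ∧ p i x ∈ U i) ∧
      ∃ g ∈ polyFun X p U, g x ≠ 0 ∧ ∀ y : P, (∀ i, p i y ∈ U i) → g y ≠ 0 → y ∈ O := by
  induction hO with
  | basic W hW =>
    obtain ⟨U, hU, g, hg, rfl⟩ := hW
    exact ⟨U, fun i => ⟨hU i, hx.1 i⟩, g, hg, hx.2, fun y h1 h2 => ⟨h1, h2⟩⟩
  | univ =>
    exact ⟨fun _ => Set.univ, fun i => ⟨isOpen_univ, trivial⟩, 1, one_mem _, one_ne_zero,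
      fun _ _ _ => trivial⟩
  | inter S T _ _ hS hT =>
    obtain ⟨U, hU, g, hg, h1, h2⟩ := hS hx.1
    obtain ⟨V, hV, g', hg', h1', h2'⟩ := hT hx.2
    exact ⟨fun i => U i ∩ V i, fun i => ⟨(hU i).1.inter (hV i).1, (hU i).2, (hV i).2⟩, g * g',
      mul_mem (polyFun_inter_left hg) (polyFun_inter_right hg'), mul_ne_zero h1 h1',
      fun y hy hy' => ⟨h2 y (fun i => (hy i).1) (left_ne_zero_of_mul hy'),
        h2' y (fun i => (hy i).2) (right_ne_zero_of_mul hy')⟩⟩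
  | sUnion S _ ih =>
    obtain ⟨T, hT, hxT⟩ := hx
    obtain ⟨U, hU, g, hg, h1, h2⟩ := ih T hT hxT
    exact ⟨U, hU, g, hg, h1, fun y hy hy' => ⟨T, hT, h2 y hy hy'⟩⟩

theorem eventually_induced {U : ∀ i, Set (X i).Pt} {x : P} (hU : ∀ i, IsOpen (U i) ∧ p i x ∈ U i)
    {g : P → ℂ} (hg : g ∈ polyFun X p U) (hx : g x ≠ 0) :
    ∀ᶠ y in @nhds P (induced X p).top x, (∀ i, p i y ∈ U i) ∧ g y ≠ 0 :=
  @IsOpen.mem_nhds P (induced X p).top _ _ (isOpen_induced_basic (fun i => (hU i).1) hg)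
    ⟨fun i => (hU i).2, hx⟩

instance induced_nice : (induced X p).Nice where
  congr {x f f'} := by
    rintro ⟨U, hU, g, hg, h, hh, hx, hf⟩ hff'
    obtain ⟨O, hO, hOo, hxO⟩ := eventually_nhds_iff.1 hff'
    obtain ⟨V, hV, k, hk, hkx, hkO⟩ := exists_induced_basic hOo hxO
    refine ⟨fun i => U i ∩ V i, fun i => ⟨(hU i).1.inter (hV i).1, (hU i).2, (hV i).2⟩, g * k,
      mul_mem (polyFun_inter_left hg) (polyFun_inter_right hk), h * k,
      mul_mem (polyFun_inter_left hh) (polyFun_inter_right hk), mul_ne_zero hx hkx,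
      fun y hy hy' => ?_⟩
    have h1 := left_ne_zero_of_mul hy'
    have h2 := right_ne_zero_of_mul hy'
    rw [hO y (hkO y (fun i => (hy i).2) h2), hf y (fun i => (hy i).1) h1]
    exact (mul_div_mul_right _ _ h2).symm
  const x c := ⟨fun _ => Set.univ, fun i => ⟨isOpen_univ, trivial⟩, algebraMap ℂ (P → ℂ) c,
    Subalgebra.algebraMap_mem _ c, 1, one_mem _, one_ne_zero, fun y _ _ => (div_one c).symm⟩
  add {x f f'} := by
    rintro ⟨U, hU, g, hg, h, hh, hx, hf⟩ ⟨V, hV, g', hg', h', hh', hx', hf'⟩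
    refine ⟨fun i => U i ∩ V i, fun i => ⟨(hU i).1.inter (hV i).1, (hU i).2, (hV i).2⟩,
      g * h' + h * g', add_mem (mul_mem (polyFun_inter_left hg) (polyFun_inter_right hh'))
        (mul_mem (polyFun_inter_left hh) (polyFun_inter_right hg')), h * h',
      mul_mem (polyFun_inter_left hh) (polyFun_inter_right hh'), mul_ne_zero hx hx',
      fun y hy hy' => ?_⟩
    have h1 := left_ne_zero_of_mul hy'
    have h2 := right_ne_zero_of_mul hy'
    exact (congrArg₂ (· + ·) (hf y (fun i => (hy i).1) h1) (hf' y (fun i => (hy i).2) h2)).trans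
      (div_add_div _ _ h1 h2)
  mul {x f f'} := by
    rintro ⟨U, hU, g, hg, h, hh, hx, hf⟩ ⟨V, hV, g', hg', h', hh', hx', hf'⟩
    refine ⟨fun i => U i ∩ V i, fun i => ⟨(hU i).1.inter (hV i).1, (hU i).2, (hV i).2⟩,
      g * g', mul_mem (polyFun_inter_left hg) (polyFun_inter_right hg'), h * h',
      mul_mem (polyFun_inter_left hh) (polyFun_inter_right hh'), mul_ne_zero hx hx',
      fun y hy hy' => ?_⟩
    exact (congrArg₂ (· * ·) (hf y (fun i => (hy i).1) (left_ne_zero_of_mul hy'))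
      (hf' y (fun i => (hy i).2) (right_ne_zero_of_mul hy'))).trans (div_mul_div_comm _ _ _ _)
  inv {x f} := by
    rintro ⟨U, hU, g, hg, h, hh, hx, hf⟩ hfx
    rw [hf x (fun i => (hU i).2) hx] at hfx
    have hgx : g x ≠ 0 := fun h0 => hfx (by rw [h0, zero_div])
    refine ⟨U, hU, h * h, mul_mem hh hh, g * h, mul_mem hg hh, mul_ne_zero hgx hx,
      fun y hy hy' => ?_⟩
    have h1 := right_ne_zero_of_mul hy'
    exact (congrArg (·⁻¹) (hf y hy h1)).trans
      ((inv_div _ _).trans (mul_div_mul_right _ _ h1).symm)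
  eventually_reg {x f} := by
    rintro ⟨U, hU, g, hg, h, hh, hx, hf⟩
    filter_upwards [eventually_induced hU hh hx] with y hy
    exact ⟨U, fun i => ⟨(hU i).1, hy.1 i⟩, g, hg, h, hh, hy.2, hf⟩
  eventually_ne {x f} := by
    rintro ⟨U, hU, g, hg, h, hh, hx, hf⟩ hfx
    rw [hf x (fun i => (hU i).2) hx] at hfx
    have hgx : g x ≠ 0 := fun h0 => hfx (by rw [h0, zero_div])
    filter_upwards [eventually_induced hU (mul_mem hg hh) (mul_ne_zero hgx hx)] with y hy
    have h1 := right_ne_zero_of_mul hy.2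
    rw [hf y hy.1 h1]
    exact div_ne_zero (left_ne_zero_of_mul hy.2) h1

open Classical in
theorem isMorphism_induced_proj [∀ i, (X i).Nice] (i : ι) :
    IsMorphism (induced X p) (X i) (p i) := by
  have key : ∀ U : Set (X i).Pt, ∀ j (y : P),
      p j y ∈ Function.update (fun _ => Set.univ : ∀ j, Set (X j).Pt) i U j ↔
        (j = i → p i y ∈ U) := by
    intro U j y
    by_cases h : j = i
    · subst h; simp
    · simp [h]
  have hopen : ∀ U : Set (X i).Pt, IsOpen U → ∀ j,
      IsOpen (Function.update (fun _ => Set.univ : ∀ j, Set (X j).Pt) i U j) := by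
    intro U hU j
    by_cases h : j = i
    · subst h; simpa
    · simp [h]
  refine ⟨continuous_def.2 fun U hU => ?_, fun x f hf => ?_⟩
  · refine (congrArg (@IsOpen P (induced X p).top) (Set.ext fun y => ?_)).mpr
      (isOpen_induced_basic (hopen U hU) (one_mem (polyFun X p _)))
    exact ⟨fun h => ⟨fun j => (key U j y).2 fun _ => h, one_ne_zero⟩,
      fun h => (key U i y).1 (h.1 i) rfl⟩
  · obtain ⟨U, hU, hUo, hxU⟩ := eventually_nhds_iff.1 (Nice.eventually_reg hf)
    refine ⟨Function.update (fun _ => Set.univ) i U, fun j => ⟨hopen U hUo j, ?_⟩, f ∘ p i,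
      Algebra.subset_adjoin ⟨i, f, fun u hu => hU u (by simpa using hu), rfl⟩, 1, one_mem _,
      one_ne_zero, fun y _ _ => (div_one _).symm⟩
    exact (key U j x).2 fun _ => hxU

theorem isMorphism_induced_lift [Finite ι] {Z : RegSpace} [Z.Nice] {φ : Z.Pt → P}
    (h : ∀ i, IsMorphism Z (X i) (p i ∘ φ)) : IsMorphism Z (induced X p) φ := by
  have hpoly : ∀ (U : ∀ i, Set (X i).Pt) (g : P → ℂ), g ∈ polyFun X p U → ∀ z : Z.Pt,
      (∀ i, p i (φ z) ∈ U i) → g ∘ φ ∈ Z.Reg z := by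
    intro U g hg z hz
    induction hg using Algebra.adjoin_induction with
    | mem g hg =>
      obtain ⟨i, a, ha, rfl⟩ := hg
      exact (h i).2 z a (ha _ (hz i))
    | algebraMap r => exact Nice.const z r
    | add f g _ _ hf hg => exact Nice.add hf hg
    | mul f g _ _ hf hg => exact Nice.mul hf hg
  have hev : ∀ (U : ∀ i, Set (X i).Pt), (∀ i, IsOpen (U i)) → ∀ g ∈ polyFun X p U, ∀ z : Z.Pt,
      (∀ i, p i (φ z) ∈ U i) → g (φ z) ≠ 0 → ∀ᶠ y in 𝓝 z, (∀ i, p i (φ y) ∈ U i) ∧ g (φ y) ≠ 0 := by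
    intro U hU g hg z hz hgz
    refine Filter.Eventually.and (eventually_all.2 fun i => ?_)
      (Nice.eventually_ne (hpoly U g hg z hz) hgz)
    exact (h i).1.continuousAt.eventually_mem ((hU i).mem_nhds (hz i))
  refine ⟨continuous_generateFrom_iff.2 ?_, fun z f hf => ?_⟩
  · rintro W ⟨U, hU, g, hg, rfl⟩
    refine isOpen_iff_mem_nhds.2 fun z hz => ?_
    exact hev U hU g hg z hz.1 hz.2
  · obtain ⟨U, hU, g, hg, k, hk, hkx, hf⟩ := hf
    refine Nice.congr (Nice.div (hpoly U g hg z fun i => (hU i).2)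
      (hpoly U k hk z fun i => (hU i).2) hkx) ?_
    filter_upwards [hev U (fun i => (hU i).1) k hk z (fun i => (hU i).2) hkx] with y hy
    exact hf _ hy.1 hy.2

end Induced

/-! ### Products -/

section Products

variable {ι : Type} {X : ι → RegSpace}

instance pi_nice : (pi X).Nice := induced_nice

instance prod_nice {X Y : RegSpace} : (prod X Y).Nice := induced_nice

theorem isMorphism_apply [∀ i, (X i).Nice] (i : ι) :
    IsMorphism (pi X) (X i) fun x : ∀ i, (X i).Pt => x i :=
  isMorphism_induced_proj (p := fun i (x : ∀ i, (X i).Pt) => x i) i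

theorem isMorphism_pi [Finite ι] {Z : RegSpace} [Z.Nice] {φ : Z.Pt → ∀ i, (X i).Pt}
    (h : ∀ i, IsMorphism Z (X i) fun z => φ z i) : IsMorphism Z (pi X) φ :=
  isMorphism_induced_lift h

instance {X Y : RegSpace} [hX : X.Nice] [hY : Y.Nice] : ∀ b : Bool, (cond b X Y).Nice
  | true => hX
  | false => hY

theorem isMorphism_fst (X Y : RegSpace) [X.Nice] [Y.Nice] :
    IsMorphism (prod X Y) X (Prod.fst : X.Pt × Y.Pt → X.Pt) :=
  isMorphism_induced_proj (X := fun b : Bool => cond b X Y) (p := fun b => match b with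
      | true => Prod.fst
      | false => Prod.snd) true

theorem isMorphism_snd (X Y : RegSpace) [X.Nice] [Y.Nice] :
    IsMorphism (prod X Y) Y (Prod.snd : X.Pt × Y.Pt → Y.Pt) :=
  isMorphism_induced_proj (X := fun b : Bool => cond b X Y) (p := fun b => match b with
      | true => Prod.fst
      | false => Prod.snd) false

theorem isMorphism_prod {X Y Z : RegSpace} [Z.Nice] {φ : Z.Pt → X.Pt × Y.Pt}
    (h₁ : IsMorphism Z X fun z => (φ z).1) (h₂ : IsMorphism Z Y fun z => (φ z).2) :
    IsMorphism Z (prod X Y) φ :=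
  isMorphism_induced_lift (by rintro (_ | _); exacts [h₂, h₁])

end Products

/-! ### Subspaces -/

section Restrict

variable {X : RegSpace} {S : Set X.Pt}

theorem isMorphism_val : IsMorphism (X.restrict S) X (Subtype.val : S → X.Pt) :=
  ⟨continuous_subtype_val, fun _ f hf => ⟨f, hf, Set.univ, isOpen_univ, trivial, fun _ _ => rfl⟩⟩

theorem isMorphism_restrict {Z : RegSpace} [Z.Nice] {φ : Z.Pt → S}
    (h : IsMorphism Z X fun z => φ z) : IsMorphism Z (X.restrict S) φ := by
  refine ⟨h.1.subtype_mk _, ?_⟩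
  rintro z f ⟨g, hg, U, hU, hzU, hf⟩
  refine Nice.congr (h.2 z g hg) ?_
  filter_upwards [h.1.continuousAt.eventually_mem (hU.mem_nhds hzU)] with y hy
  exact hf _ hy

instance restrict_nice [X.Nice] : (X.restrict S).Nice where
  congr {x f f'} := by
    rintro ⟨g, hg, U, hU, hxU, hf⟩ hff'
    obtain ⟨W, hW, ⟨V, hVo, rfl⟩, hxV⟩ := eventually_nhds_iff.1 hff'
    exact ⟨g, hg, U ∩ V, hU.inter hVo, ⟨hxU, hxV⟩, fun y hy => (hW y hy.2).trans (hf y hy.1)⟩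
  const x c := ⟨fun _ => c, Nice.const _ c, Set.univ, isOpen_univ, trivial, fun _ _ => rfl⟩
  add {x f f'} := by
    rintro ⟨g, hg, U, hU, hxU, hf⟩ ⟨g', hg', U', hU', hxU', hf'⟩
    exact ⟨_, Nice.add hg hg', U ∩ U', hU.inter hU', ⟨hxU, hxU'⟩, fun y hy =>
      congrArg₂ (· + ·) (hf y hy.1) (hf' y hy.2)⟩
  mul {x f f'} := by
    rintro ⟨g, hg, U, hU, hxU, hf⟩ ⟨g', hg', U', hU', hxU', hf'⟩
    exact ⟨_, Nice.mul hg hg', U ∩ U', hU.inter hU', ⟨hxU, hxU'⟩, fun y hy =>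
      congrArg₂ (· * ·) (hf y hy.1) (hf' y hy.2)⟩
  inv {x f} := by
    rintro ⟨g, hg, U, hU, hxU, hf⟩ hx
    rw [hf x hxU] at hx
    exact ⟨_, Nice.inv hg hx, U, hU, hxU, fun y hy => congrArg (·⁻¹) (hf y hy)⟩
  eventually_reg {x f} := by
    rintro ⟨g, hg, U, hU, hxU, hf⟩
    have h1 := continuous_subtype_val.continuousAt (x := (x : S)) |>.eventually
      ((Nice.eventually_reg hg).and (hU.mem_nhds hxU))
    filter_upwards [h1] with y hy
    exact ⟨g, hy.1, U, hU, hy.2, hf⟩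
  eventually_ne {x f} := by
    rintro ⟨g, hg, U, hU, hxU, hf⟩ hx
    rw [hf x hxU] at hx
    have h1 := continuous_subtype_val.continuousAt (x := (x : S)) |>.eventually
      ((Nice.eventually_ne hg hx).and (hU.mem_nhds hxU))
    filter_upwards [h1] with y hy
    rw [hf y hy.2]
    exact hy.1

/-- A map is a morphism if it is one on an open neighbourhood of each point. -/
theorem isMorphism_of_local {Z Y : RegSpace} [Z.Nice] {φ : Z.Pt → Y.Pt}
    (h : ∀ z, ∃ O : Set Z.Pt, IsOpen O ∧ z ∈ O ∧ IsMorphism (Z.restrict O) Y fun y : O => φ y) :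
    IsMorphism Z Y φ := by
  refine ⟨continuous_iff_continuousAt.2 fun z => ?_, fun z f hf => ?_⟩
  · obtain ⟨O, hO, hz, hφ⟩ := h z
    exact (continuousOn_iff_continuous_domRestrict.2 hφ.1).continuousAt (hO.mem_nhds hz)
  · obtain ⟨O, hO, hz, hφ⟩ := h z
    obtain ⟨g, hg, U, hU, hzU, hgf⟩ := hφ.2 ⟨z, hz⟩ f hf
    refine Nice.congr hg ?_
    filter_upwards [hO.mem_nhds hz, hU.mem_nhds hzU] with y hy hy'
    exact hgf ⟨y, hy⟩ hy'

end Restrict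

/-! ### Disjoint unions and the point -/

section Sigma

variable {ι : Type} {X : ι → RegSpace}

theorem isMorphism_mk (i : ι) : IsMorphism (X i) (sigma X) (Sigma.mk (β := fun i => (X i).Pt) i) :=
  ⟨continuous_sigmaMk, fun _ _ hf => hf⟩

theorem isMorphism_sigma {Y : RegSpace} {φ : (Σ i, (X i).Pt) → Y.Pt}
    (h : ∀ i, IsMorphism (X i) Y fun x => φ ⟨i, x⟩) : IsMorphism (sigma X) Y φ :=
  ⟨continuous_sigma fun i => (h i).1, fun x f hf => (h x.1).2 x.2 f hf⟩

/-- Neighbourhoods in a disjoint union are neighbourhoods in the component. -/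
theorem eventually_sigma {i : ι} {x : (X i).Pt} {q : (Σ i, (X i).Pt) → Prop} :
    (∀ᶠ y in @nhds _ (sigma X).top ⟨i, x⟩, q y) ↔ ∀ᶠ y in 𝓝 x, q ⟨i, y⟩ := by
  have : @nhds _ (sigma X).top ⟨i, x⟩ = Filter.map (Sigma.mk (β := fun i => (X i).Pt) i) (𝓝 x) :=
    Sigma.nhds_mk (σ := fun i => (X i).Pt) i x
  exact iff_of_eq (congrArg (fun F : Filter _ => ∀ᶠ y in F, q y) this)

instance sigma_nice [∀ i, (X i).Nice] : (sigma X).Nice where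
  congr {x f f'} hf h := by
    obtain ⟨i, x⟩ := x
    exact Nice.congr (X := X i) hf (eventually_sigma.1 h)
  const x c := Nice.const x.2 c
  add {x _ _} hf hg := Nice.add (x := x.2) hf hg
  mul {x _ _} hf hg := Nice.mul (x := x.2) hf hg
  inv {x _} hf h := Nice.inv (x := x.2) hf h
  eventually_reg {x f} hf := by
    obtain ⟨i, x⟩ := x
    exact eventually_sigma.2 (Nice.eventually_reg (X := X i) hf)
  eventually_ne {x f} hf h := by
    obtain ⟨i, x⟩ := x
    exact eventually_sigma.2 (Nice.eventually_ne (X := X i) hf h)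

instance point_nice : point.Nice where
  congr _ _ := trivial
  const _ _ := trivial
  add _ _ := trivial
  mul _ _ := trivial
  inv _ _ := trivial
  eventually_reg _ := Eventually.of_forall fun _ => trivial
  eventually_ne {x _} _ h := Eventually.of_forall fun y => by
    rwa [show y = x from Subsingleton.elim (α := Unit) y x]

instance : Subsingleton point.Pt := inferInstanceAs (Subsingleton Unit)

end Sigma

/-! ### Immersions -/

/-- `φ` is an isomorphism onto a subspace of `Y`.  This is expressed by the universal property of
subspaces, which makes the behaviour under compositions and products immediate. -/
structure IsImm (X Y : RegSpace) (φ : X.Pt → Y.Pt) : Prop where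
  inj : Function.Injective φ
  morph : IsMorphism X Y φ
  lift : ∀ (Z : RegSpace) [Z.Nice] (χ : Z.Pt → X.Pt), IsMorphism Z Y (φ ∘ χ) → IsMorphism Z X χ

namespace IsImm

theorem comp {X Y Z : RegSpace} {ψ : Y.Pt → Z.Pt} {φ : X.Pt → Y.Pt} (hψ : IsImm Y Z ψ)
    (hφ : IsImm X Y φ) : IsImm X Z (ψ ∘ φ) :=
  ⟨hψ.inj.comp hφ.inj, hψ.morph.comp hφ.morph, fun W _ χ h => hφ.lift W χ (hψ.lift W _ h)⟩

theorem of_comp {X Y Z : RegSpace} {ψ : Y.Pt → Z.Pt} {φ : X.Pt → Y.Pt} (hψ : IsMorphism Y Z ψ)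
    (hφ : IsMorphism X Y φ) (h : IsImm X Z (ψ ∘ φ)) : IsImm X Y φ :=
  ⟨h.inj.of_comp, hφ, fun W _ χ hχ => h.lift W χ (hψ.comp hχ)⟩

theorem id (X : RegSpace) : IsImm X X id :=
  ⟨Function.injective_id, IsMorphism.id X, fun _ _ _ h => h⟩

theorem val {X : RegSpace} (S : Set X.Pt) : IsImm (X.restrict S) X (Subtype.val : S → X.Pt) :=
  ⟨Subtype.val_injective, isMorphism_val, fun _ _ _ h => isMorphism_restrict h⟩

theorem of_isEmpty {X Y : RegSpace} [IsEmpty X.Pt] (φ : X.Pt → Y.Pt) : IsImm X Y φ :=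
  ⟨fun x => isEmptyElim x, ⟨continuous_of_const fun x => isEmptyElim x, fun x => isEmptyElim x⟩,
    fun _ _ χ _ => ⟨continuous_of_const fun z => isEmptyElim (χ z), fun z => isEmptyElim (χ z)⟩⟩

/-- A map with a retraction is an immersion. -/
theorem of_leftInverse {X Y : RegSpace} {φ : X.Pt → Y.Pt} {ψ : Y.Pt → X.Pt}
    (hφ : IsMorphism X Y φ) (hψ : IsMorphism Y X ψ) (h : ∀ x, ψ (φ x) = x) : IsImm X Y φ :=
  ⟨Function.LeftInverse.injective h, hφ, fun _ _ χ hχ => by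
    rw [show χ = ψ ∘ (φ ∘ χ) from funext fun z => (h _).symm]
    exact hψ.comp hχ⟩

theorem prod {X X' Y Y' : RegSpace} [X.Nice] [Y.Nice] [X'.Nice] [Y'.Nice] {φ : X.Pt → X'.Pt}
    {ψ : Y.Pt → Y'.Pt} (hφ : IsImm X X' φ) (hψ : IsImm Y Y' ψ) :
    IsImm (prod X Y) (prod X' Y') (Prod.map φ ψ) where
  inj := hφ.inj.prodMap hψ.inj
  morph := isMorphism_prod (hφ.morph.comp (isMorphism_fst X Y)) (hψ.morph.comp (isMorphism_snd X Y))
  lift Z _ _ h := isMorphism_prod (hφ.lift Z _ ((isMorphism_fst X' Y').comp h))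
    (hψ.lift Z _ ((isMorphism_snd X' Y').comp h))

theorem pi {ι : Type} [Finite ι] {X Y : ι → RegSpace} [∀ i, (X i).Nice] [∀ i, (Y i).Nice]
    {φ : ∀ i, (X i).Pt → (Y i).Pt} (h : ∀ i, IsImm (X i) (Y i) (φ i)) :
    IsImm (pi X) (pi Y) fun (x : ∀ i, (X i).Pt) i => φ i (x i) where
  inj _ _ hxy := funext fun i => (h i).inj (congrFun hxy i)
  morph := isMorphism_pi fun i => (h i).morph.comp (isMorphism_apply i)
  lift Z _ _ hχ := isMorphism_pi fun i => (h i).lift Z _ ((isMorphism_apply i).comp hχ)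

theorem sigmaMk {ι : Type} {X : ι → RegSpace} (i : ι) :
    IsImm (X i) (sigma X) (Sigma.mk (β := fun i => (X i).Pt) i) := by
  refine ⟨sigma_mk_injective, isMorphism_mk i, fun Z _ χ h => ?_⟩
  refine ⟨(Topology.IsEmbedding.sigmaMk (σ := fun i => (X i).Pt)).continuous_iff.2 h.1,
    fun z f hf => ?_⟩
  classical
  -- a function on one component extends by zero to the disjoint union
  obtain ⟨F, hF⟩ : ∃ F : (Σ i, (X i).Pt) → ℂ, ∀ y, F ⟨i, y⟩ = f y :=
    ⟨fun y => if hy : y.1 = i then f (hy ▸ y.2) else 0, fun y => by simp⟩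
  have hr : (fun y => F ⟨i, y⟩) ∈ (X i).Reg (χ z) := by rwa [funext hF]
  have := h.2 z F hr
  exact Nice.congr this (Eventually.of_forall fun y => (hF (χ y)).symm)

theorem isInducing {X Y : RegSpace} [Y.Nice] {φ : X.Pt → Y.Pt} (h : IsImm X Y φ) :
    IsInducing φ := by
  -- the inverse of `φ` on its range is continuous
  have hψ : IsMorphism (Y.restrict (Set.range φ)) X (Equiv.ofInjective φ h.inj).symm := by
    refine h.lift _ _ ?_
    exact isMorphism_val.congr fun y => Equiv.apply_ofInjective_symm h.inj y
  refine isInducing_iff_nhds.2 fun x => le_antisymm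
    (h.morph.1.continuousAt.tendsto.le_comap) fun U hU => ?_
  have hc := hψ.1.continuousAt (x := (⟨φ x, x, rfl⟩ : Set.range φ))
  have hx : (Equiv.ofInjective φ h.inj).symm ⟨φ x, x, rfl⟩ = x :=
    Equiv.ofInjective_symm_apply h.inj x
  have h1 := hc (hx.symm ▸ hU)
  obtain ⟨V, hV, hVU⟩ := (mem_nhds_induced (Subtype.val : Set.range φ → Y.Pt) _ _).1 h1
  refine ⟨V, hV, fun y hy => ?_⟩
  have := hVU (show (⟨φ y, y, rfl⟩ : Set.range φ) ∈ Subtype.val ⁻¹' V from hy)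
  change (Equiv.ofInjective φ h.inj).symm ⟨φ y, y, rfl⟩ ∈ U at this
  rwa [show (Equiv.ofInjective φ h.inj).symm ⟨φ y, y, rfl⟩ = y from
    Equiv.ofInjective_symm_apply h.inj y] at this

/-- A surjective immersion is an isomorphism. -/
theorem isIso {X Y : RegSpace} [Y.Nice] {e : X.Pt ≃ Y.Pt} (h : IsImm X Y e) : IsIso X Y e :=
  ⟨h.morph, h.lift Y _ (by
    rw [show (e : X.Pt → Y.Pt) ∘ e.symm = _root_.id from e.self_comp_symm]; exact IsMorphism.id Y)⟩

end IsImm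

theorem IsIso.isImm {X Y : RegSpace} {e : X.Pt ≃ Y.Pt} (h : IsIso X Y e) : IsImm X Y e :=
  .of_leftInverse h.1 h.2 e.symm_apply_apply

theorem IsIso.symm {X Y : RegSpace} {e : X.Pt ≃ Y.Pt} (h : IsIso X Y e) : IsIso Y X e.symm :=
  ⟨h.2, h.1⟩

theorem IsIso.trans {X Y Z : RegSpace} {e : X.Pt ≃ Y.Pt} {f : Y.Pt ≃ Z.Pt} (h : IsIso X Y e)
    (h' : IsIso Y Z f) : IsIso X Z (e.trans f) :=
  ⟨h'.1.comp h.1, h.2.comp h'.2⟩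

theorem IsMorphism.nice_of_isIso {X Y : RegSpace} [Y.Nice] {e : X.Pt ≃ Y.Pt} (h : IsIso X Y e) :
    X.Nice := by
  have reg : ∀ {x : X.Pt} {f : X.Pt → ℂ}, f ∈ X.Reg x ↔ f ∘ e.symm ∈ Y.Reg (e x) := by
    intro x f
    refine ⟨fun hf => h.2.2 (e x) f (by rwa [e.symm_apply_apply]), fun hf => ?_⟩
    simpa [Function.comp_assoc] using h.1.2 x _ hf
  have ev : ∀ {x : X.Pt} {q : X.Pt → Prop},
      (∀ᶠ y in 𝓝 x, q y) ↔ ∀ᶠ y in 𝓝 (e x), q (e.symm y) := by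
    intro x q
    have hc : Tendsto e.symm (𝓝 (e x)) (𝓝 x) := by
      simpa [ContinuousAt] using h.2.1.continuousAt (x := e x)
    exact ⟨fun hq => hc.eventually hq,
      fun hq => by simpa using (h.1.1.continuousAt (x := x)).eventually hq⟩
  exact
    { congr := fun hf hg => reg.2 (Nice.congr (reg.1 hf) (ev.1 hg))
      const := fun x c => reg.2 (Nice.const _ c)
      add := fun hf hg => reg.2 (Nice.add (reg.1 hf) (reg.1 hg))
      mul := fun hf hg => reg.2 (Nice.mul (reg.1 hf) (reg.1 hg))
      inv := fun hf hx => reg.2 (Nice.inv (reg.1 hf) (by simpa using hx))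
      eventually_reg := fun hf => ev.2 ((Nice.eventually_reg (reg.1 hf)).mono fun y hy =>
        reg.2 (by simpa using hy))
      eventually_ne := fun hf hx => ev.2 (Nice.eventually_ne (reg.1 hf) (by simpa using hx)) }

/-- Families of immersions induce an immersion of disjoint unions. -/
theorem IsImm.sigma {ι : Type} {X Y : ι → RegSpace} {φ : ∀ i, (X i).Pt → (Y i).Pt}
    (h : ∀ i, IsImm (X i) (Y i) (φ i)) :
    IsImm (sigma X) (sigma Y) (Sigma.map (β₂ := fun i => (Y i).Pt) _root_.id φ) := by
  refine ⟨Function.injective_id.sigma_map fun i => (h i).inj,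
    isMorphism_sigma fun i => (isMorphism_mk i).comp (h i).morph, fun Z _ χ hχ => ?_⟩
  refine isMorphism_of_local fun z => ?_
  obtain ⟨i, x, hz⟩ : ∃ i x, χ z = ⟨i, x⟩ := ⟨_, _, rfl⟩
  refine ⟨{z | (χ z).1 = i}, ?_, congrArg Sigma.fst hz, ?_⟩
  · exact (isOpen_sigma_fst_preimage (σ := fun i => (Y i).Pt) {i}).preimage hχ.1
  · have : ∀ y : {z | (χ z).1 = i}, ∃ x : (X i).Pt, χ y = ⟨i, x⟩ := fun y =>
      ⟨y.2 ▸ (χ y.1).2, by obtain ⟨y, rfl⟩ := y; rfl⟩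
    choose χ' hχ' using this
    have key : IsMorphism (Z.restrict {z | (χ z).1 = i}) (X i) χ' := by
      refine (h i).lift _ _ ((IsImm.sigmaMk i).lift _ _ ?_)
      refine (hχ.comp (isMorphism_val (X := Z) (S := {z | (χ z).1 = i}))).congr fun y => ?_
      exact congrArg (Sigma.map (β₂ := fun i => (Y i).Pt) _root_.id φ) (hχ' y).symm
    exact ((isMorphism_mk (X := X) i).comp key).congr hχ'

/-- A map is a morphism if it is one on each member of a covering family of immersions with open
image. -/
theorem isMorphism_of_charts {κ : Type} {X Y : RegSpace} [X.Nice] {D : κ → RegSpace}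
    (j : ∀ k, (D k).Pt → X.Pt) (hj : ∀ k, IsImm (D k) X (j k))
    (ho : ∀ k, IsOpen (Set.range (j k))) (hc : ∀ x, ∃ k, x ∈ Set.range (j k)) {F : X.Pt → Y.Pt}
    (hF : ∀ k, IsMorphism (D k) Y (F ∘ j k)) : IsMorphism X Y F := by
  refine isMorphism_of_local fun x => ?_
  obtain ⟨k, hk⟩ := hc x
  refine ⟨_, ho k, hk, ?_⟩
  choose χ hχ using fun y : Set.range (j k) => y.2
  have : IsMorphism (X.restrict (Set.range (j k))) (D k) χ := by
    exact (hj k).lift _ _ (isMorphism_val.congr hχ)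
  exact ((hF k).comp this).congr fun y => congrArg F (hχ y).symm

/-- A bijection is an isomorphism if it restricts to isomorphisms between the members of open
coverings. -/
theorem isIso_of_charts {κ : Type} {X Y : RegSpace} [X.Nice] [Y.Nice] (e : X.Pt ≃ Y.Pt)
    {D : κ → RegSpace} (j : ∀ k, (D k).Pt → X.Pt) (hj : ∀ k, IsImm (D k) X (j k))
    (ho : ∀ k, IsOpen (Set.range (j k))) (hc : ∀ x, ∃ k, x ∈ Set.range (j k))
    (hj' : ∀ k, IsImm (D k) Y (e ∘ j k)) (ho' : ∀ k, IsOpen (Set.range (e ∘ j k))) :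
    IsIso X Y e := by
  refine ⟨isMorphism_of_charts j hj ho hc fun k => (hj' k).morph,
    isMorphism_of_charts (fun k => e ∘ j k) hj' ho' (fun y => ?_) fun k => ?_⟩
  · obtain ⟨k, x, hx⟩ := hc (e.symm y)
    exact ⟨k, x, by simp [hx]⟩
  · rw [← Function.comp_assoc, e.symm_comp_self]
    exact (hj k).morph

/-- A map is an immersion if it is an immersion on each member of an open covering, the images of
which are open in the image of the map. -/
theorem isImm_of_charts {κ : Type} {X Y : RegSpace} [X.Nice] [Y.Nice] {F : X.Pt → Y.Pt}
    (hinj : Function.Injective F) {D : κ → RegSpace} (j : ∀ k, (D k).Pt → X.Pt)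
    (hj : ∀ k, IsImm (D k) X (j k)) (ho : ∀ k, IsOpen (Set.range (j k)))
    (hc : ∀ x, ∃ k, x ∈ Set.range (j k)) (hj' : ∀ k, IsImm (D k) Y (F ∘ j k))
    (ho' : ∀ k, ∃ O : Set Y.Pt, IsOpen O ∧ O ∩ Set.range F = Set.range (F ∘ j k)) :
    IsImm X Y F := by
  have hF : IsMorphism X Y F := isMorphism_of_charts j hj ho hc fun k => (hj' k).morph
  have hm : IsMorphism X (Y.restrict (Set.range F)) (Equiv.ofInjective F hinj) :=
    isMorphism_restrict hF
  have h := isIso_of_charts (Y := Y.restrict (Set.range F)) (Equiv.ofInjective F hinj) j hj ho hc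
    (fun k => IsImm.of_comp isMorphism_val (hm.comp (hj k).morph) (hj' k)) fun k => by
      obtain ⟨O, hO, hOk⟩ := ho' k
      refine ⟨O, hO, ?_⟩
      ext ⟨y, x, rfl⟩
      constructor
      · intro hy
        have hy' : F x ∈ O ∩ Set.range F := ⟨hy, x, rfl⟩
        rw [hOk] at hy'
        obtain ⟨d, hd⟩ := hy'
        exact ⟨d, Subtype.ext hd⟩
      · rintro ⟨d, hd⟩
        have : F x ∈ O ∩ Set.range F := hOk ▸ ⟨d, congrArg Subtype.val hd⟩
        exact this.1
  exact (IsImm.val _).comp h.isImm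

end RegSpace

open scoped LinearAlgebra.Projectivization

namespace RegSpace

/-! ### Projective spaces -/

/-- The Zariski topology of projective space. -/
instance zariskiTopology (ι : Type) : TopologicalSpace (ℙ ℂ (ι → ℂ)) :=
  TopologicalSpace.generateFrom
    {W | ∃ (d : ℕ) (F : MvPolynomial ι ℂ), F.IsHomogeneous d ∧ W = {p | F.eval p.rep ≠ 0}}

/-- Projective space with homogeneous coordinates indexed by an arbitrary finite type. -/
def proj (ι : Type) : RegSpace where
  Pt := ℙ ℂ (ι → ℂ)
  top := zariskiTopology ι
  Reg x := {f | ∃ U : Set (ℙ ℂ (ι → ℂ)), IsOpen U ∧ x ∈ U ∧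
      ∃ (d : ℕ) (F G : MvPolynomial ι ℂ), F.IsHomogeneous d ∧ G.IsHomogeneous d ∧
        ∀ y ∈ U, G.eval y.rep ≠ 0 ∧ f y = F.eval y.rep / G.eval y.rep}

theorem isOpen_proj {ι : Type} {d : ℕ} {F : MvPolynomial ι ℂ} (hF : F.IsHomogeneous d) :
    IsOpen {p : ℙ ℂ (ι → ℂ) | F.eval p.rep ≠ 0} :=
  TopologicalSpace.isOpen_generateFrom_of_mem ⟨d, F, hF, rfl⟩

instance proj_nice (ι : Type) : (proj ι).Nice where
  congr {x f f'} := by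
    rintro ⟨U, hU, hxU, d, F, G, hF, hG, h⟩ hf
    obtain ⟨V, hV, hVo, hxV⟩ := eventually_nhds_iff.1 hf
    exact ⟨U ∩ V, hU.inter hVo, ⟨hxU, hxV⟩, d, F, G, hF, hG,
      fun y hy => ⟨(h y hy.1).1, (hV y hy.2).trans (h y hy.1).2⟩⟩
  const x c := ⟨Set.univ, isOpen_univ, trivial, 0, MvPolynomial.C c, 1,
    MvPolynomial.isHomogeneous_C _ _, MvPolynomial.isHomogeneous_one _ _,
    fun y _ => by simp⟩
  add {x f f'} := by
    rintro ⟨U, hU, hxU, d, F, G, hF, hG, h⟩ ⟨U', hU', hxU', d', F', G', hF', hG', h'⟩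
    refine ⟨U ∩ U', hU.inter hU', ⟨hxU, hxU'⟩, d + d', F * G' + G * F', G * G',
      (hF.mul hG').add (hG.mul hF'), hG.mul hG', fun y hy => ?_⟩
    obtain ⟨h1, h2⟩ := h y hy.1
    obtain ⟨h1', h2'⟩ := h' y hy.2
    rw [map_add, map_mul, map_mul, map_mul]
    exact ⟨mul_ne_zero h1 h1', (congrArg₂ (· + ·) h2 h2').trans (div_add_div _ _ h1 h1')⟩
  mul {x f f'} := by
    rintro ⟨U, hU, hxU, d, F, G, hF, hG, h⟩ ⟨U', hU', hxU', d', F', G', hF', hG', h'⟩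
    refine ⟨U ∩ U', hU.inter hU', ⟨hxU, hxU'⟩, d + d', F * F', G * G',
      hF.mul hF', hG.mul hG', fun y hy => ?_⟩
    obtain ⟨h1, h2⟩ := h y hy.1
    obtain ⟨h1', h2'⟩ := h' y hy.2
    rw [map_mul, map_mul]
    exact ⟨mul_ne_zero h1 h1', (congrArg₂ (· * ·) h2 h2').trans (div_mul_div_comm _ _ _ _)⟩
  inv {x f} := by
    rintro ⟨U, hU, hxU, d, F, G, hF, hG, h⟩ hx
    have hFx : F.eval x.rep ≠ 0 := fun h0 => hx (by rw [(h x hxU).2, h0, zero_div])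
    refine ⟨U ∩ _, hU.inter (isOpen_proj hF), ⟨hxU, hFx⟩, d, G, F, hG, hF,
      fun y hy => ⟨hy.2, (congrArg (·⁻¹) (h y hy.1).2).trans (inv_div _ _)⟩⟩
  eventually_reg {x f} := by
    rintro ⟨U, hU, hxU, d, F, G, hF, hG, h⟩
    exact eventually_nhds_iff.2 ⟨U, fun y hy => ⟨U, hU, hy, d, F, G, hF, hG, h⟩, hU, hxU⟩
  eventually_ne {x f} := by
    rintro ⟨U, hU, hxU, d, F, G, hF, hG, h⟩ hx
    have hFx : F.eval x.rep ≠ 0 := fun h0 => hx (by rw [(h x hxU).2, h0, zero_div])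
    exact eventually_nhds_iff.2 ⟨U ∩ _, fun y hy h0 => div_ne_zero hy.2 (h y hy.1).1
      ((h y hy.1).2.symm.trans h0), hU.inter (isOpen_proj hF), hxU, hFx⟩

/-- Near `z`, the map `φ` to projective space is given by homogeneous coordinates that are regular
functions. -/
def HasLift {ι : Type} (Z : RegSpace) (φ : Z.Pt → ℙ ℂ (ι → ℂ)) (z : Z.Pt) : Prop :=
  ∃ v : Z.Pt → ι → ℂ, (∀ i, (fun y => v y i) ∈ Z.Reg z) ∧
    ∀ᶠ y in 𝓝 z, ∃ h : v y ≠ 0, φ y = Projectivization.mk ℂ (v y) h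

theorem eval_smul_of_isHomogeneous {ι : Type} {d : ℕ} {F : MvPolynomial ι ℂ}
    (hF : F.IsHomogeneous d) (c : ℂ) (v : ι → ℂ) : F.eval (c • v) = c ^ d * F.eval v := by
  rw [MvPolynomial.eval_eq, MvPolynomial.eval_eq, Finset.mul_sum]
  refine Finset.sum_congr rfl fun e he => ?_
  have hd : ∑ i ∈ e.support, e i = d := by
    have : Finsupp.degree e = d := by
      rw [Finsupp.degree_eq_weight_one]
      exact hF (MvPolynomial.mem_support_iff.1 he)
    exact this
  simp only [Pi.smul_apply, smul_eq_mul, mul_pow, Finset.prod_mul_distrib,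
    Finset.prod_pow_eq_pow_sum, hd]
  ring

theorem eval_rep {ι : Type} {v : ι → ℂ} (hv : v ≠ 0) :
    ∃ c : ℂ, c ≠ 0 ∧ ∀ (d : ℕ) (F : MvPolynomial ι ℂ), F.IsHomogeneous d →
      F.eval v = c ^ d * F.eval (Projectivization.mk ℂ v hv).rep := by
  obtain ⟨a, ha⟩ := Projectivization.exists_smul_eq_mk_rep ℂ v hv
  refine ⟨(a⁻¹ : ℂˣ), Units.ne_zero _, fun d F hF => ?_⟩
  rw [← ha, Units.smul_def, eval_smul_of_isHomogeneous hF, ← mul_assoc, ← mul_pow]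
  simp

theorem eval_mem_reg {ι : Type} {Z : RegSpace} [Z.Nice] {z : Z.Pt} {v : Z.Pt → ι → ℂ}
    (hv : ∀ i, (fun y => v y i) ∈ Z.Reg z) (F : MvPolynomial ι ℂ) :
    (fun y => F.eval (v y)) ∈ Z.Reg z := by
  induction F using MvPolynomial.induction_on with
  | C a => simpa using Nice.const z a
  | add p q hp hq => simpa using Nice.add hp hq
  | mul_X p i hp => simpa using Nice.mul hp (hv i)

theorem mk_ne_zero_iff_eval {ι : Type} {v : ι → ℂ} (hv : v ≠ 0) {d : ℕ} {F : MvPolynomial ι ℂ}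
    (hF : F.IsHomogeneous d) : F.eval (Projectivization.mk ℂ v hv).rep ≠ 0 ↔ F.eval v ≠ 0 := by
  obtain ⟨c, hc, h⟩ := eval_rep hv
  rw [h d F hF]
  simp [hc]

/-- A map to projective space with local lifts is a morphism. -/
theorem isMorphism_proj {ι : Type} {Z : RegSpace} [Z.Nice] {φ : Z.Pt → ℙ ℂ (ι → ℂ)}
    (h : ∀ z, HasLift Z φ z) : IsMorphism Z (proj ι) φ := by
  have hcont : Continuous φ := by
    refine continuous_generateFrom_iff.2 ?_
    rintro W ⟨d, F, hF, rfl⟩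
    refine isOpen_iff_mem_nhds.2 fun z hz => ?_
    obtain ⟨v, hv, hφ⟩ := h z
    obtain ⟨hz0, hz1⟩ := hφ.self_of_nhds
    have hz' : F.eval (φ z).rep ≠ 0 := hz
    rw [hz1, mk_ne_zero_iff_eval hz0 hF] at hz'
    filter_upwards [hφ, Nice.eventually_ne (eval_mem_reg hv F) hz'] with y ⟨hy0, hy1⟩ hy
    change F.eval (φ y).rep ≠ 0
    rwa [hy1, mk_ne_zero_iff_eval hy0 hF]
  refine ⟨hcont, fun z f hf => ?_⟩
  obtain ⟨U, hU, hzU, d, F, G, hF, hG, hf⟩ := hf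
  obtain ⟨v, hv, hφ⟩ := h z
  obtain ⟨hz0, hz1⟩ := hφ.self_of_nhds
  have hz' := (hf _ hzU).1
  rw [hz1, mk_ne_zero_iff_eval hz0 hG] at hz'
  refine Nice.congr (Nice.div (eval_mem_reg hv F) (eval_mem_reg hv G) hz') ?_
  have hUev : ∀ᶠ y in 𝓝 z, φ y ∈ U :=
    hcont.continuousAt.eventually_mem (hU.mem_nhds hzU)
  filter_upwards [hφ, hUev] with y ⟨hy0, hy1⟩ hy
  obtain ⟨c, hc, hF'⟩ := eval_rep hy0
  rw [hF' d F hF, hF' d G hG, mul_div_mul_left _ _ (pow_ne_zero d hc), ← hy1]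
  exact (hf _ hy).2

theorem hasLift_id {ι : Type} (p : ℙ ℂ (ι → ℂ)) : HasLift (proj ι) id p := by
  obtain ⟨i, hi⟩ := Function.ne_iff.1 p.rep_nonzero
  have hi : p.rep i ≠ 0 := hi
  have hX : ∀ i, (MvPolynomial.X i : MvPolynomial ι ℂ).IsHomogeneous 1 :=
    fun i => MvPolynomial.isHomogeneous_X ℂ i
  have hU := isOpen_proj (hX i)
  have hi' : MvPolynomial.eval p.rep (.X i) ≠ 0 := by simpa using hi
  refine ⟨fun y k => y.rep k / y.rep i, fun k => ⟨_, hU, hi', 1,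
    .X k, .X i, hX k, hX i, fun y hy => ⟨hy, by simp⟩⟩, ?_⟩
  refine eventually_nhds_iff.2 ⟨_, fun y hy => ?_, hU, hi'⟩
  have hy : MvPolynomial.eval y.rep (.X i) ≠ 0 := hy
  rw [MvPolynomial.eval_X] at hy
  have h0 : (fun k => y.rep k / y.rep i) ≠ 0 := fun h => by
    have := congrFun h i
    simp [hy] at this
  refine ⟨h0, ?_⟩
  refine (Projectivization.mk_rep y).symm.trans
    ((Projectivization.mk_eq_mk_iff' ℂ _ _ y.rep_nonzero h0).2 ⟨y.rep i, ?_⟩)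
  funext k
  simp [mul_div_cancel₀, hy]

theorem IsMorphism.hasLift {ι : Type} {Z : RegSpace} {φ : Z.Pt → ℙ ℂ (ι → ℂ)}
    (h : IsMorphism Z (proj ι) φ) (z : Z.Pt) : HasLift Z φ z := by
  obtain ⟨v, hv, hφ⟩ := hasLift_id (φ z)
  exact ⟨fun y => v (φ y), fun i => h.2 z _ (hv i), h.1.continuousAt.eventually hφ⟩

theorem isClosed_proj {ι : Type} {d : ℕ} {F : MvPolynomial ι ℂ} (hF : F.IsHomogeneous d) :
    IsClosed {p : ℙ ℂ (ι → ℂ) | F.eval p.rep = 0} :=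
  isOpen_compl_iff.1 (isOpen_proj hF)

theorem eq_mk_iff {ι : Type} {v w : ι → ℂ} (hv : v ≠ 0) (hw : w ≠ 0) :
    Projectivization.mk ℂ v hv = Projectivization.mk ℂ w hw ↔ ∀ i j, v i * w j = v j * w i := by
  rw [Projectivization.mk_eq_mk_iff']
  constructor
  · rintro ⟨a, rfl⟩ i j
    simp only [Pi.smul_apply, smul_eq_mul]
    ring
  · intro h
    obtain ⟨i, hi⟩ := Function.ne_iff.1 hw
    have hi : w i ≠ 0 := hi
    refine ⟨v i / w i, funext fun j => ?_⟩
    simp only [Pi.smul_apply, smul_eq_mul]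
    rw [div_mul_eq_mul_div, h i j, mul_div_cancel_right₀ _ hi]

/-! ### Quasi-projective varieties -/

/-- `φ` is an isomorphism onto a locally closed subspace of `Y`. -/
structure IsLCImm (X Y : RegSpace) (φ : X.Pt → Y.Pt) : Prop where
  imm : IsImm X Y φ
  range : IsLocallyClosed (Set.range φ)

theorem IsLCImm.comp {X Y Z : RegSpace} [Z.Nice] {ψ : Y.Pt → Z.Pt} {φ : X.Pt → Y.Pt}
    (hψ : IsLCImm Y Z ψ) (hφ : IsLCImm X Y φ) : IsLCImm X Z (ψ ∘ φ) :=
  ⟨hψ.imm.comp hφ.imm, by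
    rw [Set.range_comp]
    exact hφ.range.image hψ.imm.isInducing hψ.range⟩

theorem IsLCImm.of_surjective {X Y : RegSpace} {φ : X.Pt → Y.Pt} (h : IsImm X Y φ)
    (hs : Function.Surjective φ) : IsLCImm X Y φ :=
  ⟨h, by rw [hs.range_eq]; exact isOpen_univ.isLocallyClosed⟩

theorem IsIso.isLCImm {X Y : RegSpace} {e : X.Pt ≃ Y.Pt} (h : IsIso X Y e) : IsLCImm X Y e :=
  .of_surjective h.isImm e.surjective

theorem IsLCImm.prod {X X' Y Y' : RegSpace} [X.Nice] [Y.Nice] [X'.Nice] [Y'.Nice]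
    {φ : X.Pt → X'.Pt} {ψ : Y.Pt → Y'.Pt} (hφ : IsLCImm X X' φ) (hψ : IsLCImm Y Y' ψ) :
    IsLCImm (prod X Y) (prod X' Y') (Prod.map φ ψ) :=
  ⟨hφ.imm.prod hψ.imm, by
    have : Set.range (Prod.map φ ψ) = Set.range φ ×ˢ Set.range ψ := Set.range_prodMap
    refine (congrArg (@IsLocallyClosed _ (RegSpace.prod X' Y').top) this).mpr ?_
    exact (hφ.range.preimage (isMorphism_fst X' Y').1).inter
      (hψ.range.preimage (isMorphism_snd X' Y').1)⟩

theorem isIso_ofProjective (N : ℕ) (V : Set (ℙ ℂ (Fin (N + 1) → ℂ))) :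
    IsIso (ofProjective N V) ((proj (Fin (N + 1))).restrict V) (Equiv.refl V) := by
  refine ⟨⟨continuous_id, ?_⟩, ⟨continuous_id, ?_⟩⟩
  · rintro x f ⟨g, ⟨U, hU, hxU, d, F, G, hF, hG, hg⟩, U', hU', hxU', hf⟩
    exact ⟨U ∩ U', hU.inter hU', ⟨hxU, hxU'⟩, d, F, G, hF, hG, fun y hy =>
      ⟨(hg _ hy.1).1, (hf y hy.2).trans (hg _ hy.1).2⟩⟩
  · rintro x f ⟨U, hU, hxU, d, F, G, hF, hG, hf⟩
    exact ⟨fun p => F.eval (Projectivization.rep p) / G.eval (Projectivization.rep p),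
      ⟨_, isOpen_proj hG, (hf x hxU).1, d, F, G, hF, hG, fun y hy => ⟨hy, rfl⟩⟩, U, hU, hxU,
      fun y hy => (hf y hy).2⟩

/-- Reindexing of homogeneous coordinates. -/
def projMap {ι κ : Type} (σ : ι ≃ κ) : ℙ ℂ (ι → ℂ) → ℙ ℂ (κ → ℂ) :=
  Projectivization.map (LinearEquiv.funCongrLeft ℂ ℂ σ.symm).toLinearMap
    (LinearEquiv.injective _)

theorem isMorphism_projMap {ι κ : Type} (σ : ι ≃ κ) : IsMorphism (proj ι) (proj κ) (projMap σ) := by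
  refine isMorphism_proj fun p => ?_
  obtain ⟨v, hv, h⟩ := hasLift_id p
  refine ⟨fun y k => v y (σ.symm k), fun k => hv _, h.mono fun y hy => ?_⟩
  obtain ⟨h0, h1⟩ := hy
  refine ⟨fun h => h0 (funext fun i => by simpa using congrFun h (σ i)), ?_⟩
  exact congrArg (projMap σ) h1

theorem projMap_symm {ι κ : Type} (σ : ι ≃ κ) (p : ℙ ℂ (ι → ℂ)) :
    projMap σ.symm (projMap σ p) = p := by
  induction p using Projectivization.ind with
  | h v hv =>
    rw [projMap, projMap, Projectivization.map_mk, Projectivization.map_mk]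
    congr 1
    funext i
    simp [LinearEquiv.funCongrLeft_apply, LinearMap.funLeft]

theorem isLCImm_projMap {ι κ : Type} (σ : ι ≃ κ) : IsLCImm (proj ι) (proj κ) (projMap σ) :=
  .of_surjective (.of_leftInverse (isMorphism_projMap σ) (isMorphism_projMap σ.symm)
    (projMap_symm σ)) fun p => ⟨projMap σ.symm p, projMap_symm σ.symm p⟩

/-- Quasi-projectivity as a type class. -/
class QP (X : RegSpace) : Prop where
  out : X.IsQuasiProjective

instance QP.nice (X : RegSpace) [h : QP X] : X.Nice := by
  obtain ⟨N, V, -, e, he⟩ := h.out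
  have : ((proj (Fin (N + 1))).restrict V).Nice := restrict_nice
  exact IsMorphism.nice_of_isIso (he.trans (isIso_ofProjective N V))

theorem QP.exists_imm (X : RegSpace) [h : QP X] :
    ∃ (ι : Type) (_ : Finite ι) (_ : Nonempty ι) (φ : X.Pt → ℙ ℂ (ι → ℂ)),
      IsLCImm X (proj ι) φ := by
  obtain ⟨N, V, hV, e, he⟩ := h.out
  refine ⟨Fin (N + 1), inferInstance, inferInstance, _,
    IsLCImm.comp (Z := proj (Fin (N + 1))) ⟨IsImm.val V, ?_⟩
      (he.trans (isIso_ofProjective N V)).isLCImm⟩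
  exact (Subtype.range_val (s := V)).symm ▸ hV

theorem QP.of_imm {X : RegSpace} [X.Nice] {ι : Type} [Finite ι] [Nonempty ι]
    {φ : X.Pt → ℙ ℂ (ι → ℂ)} (h : IsLCImm X (proj ι) φ) : QP X := by
  obtain ⟨n, ⟨σ⟩⟩ := Finite.exists_equiv_fin ι
  cases n with
  | zero => exact (Fin.elim0 (σ (Classical.arbitrary ι)))
  | succ N =>
    have h' := (isLCImm_projMap σ).comp h
    refine ⟨N, _, h'.range, Equiv.ofInjective _ h'.imm.inj, ?_⟩
    have : IsIso X ((proj (Fin (N + 1))).restrict (Set.range (projMap σ ∘ φ)))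
        (Equiv.ofInjective _ h'.imm.inj) :=
      IsImm.isIso (IsImm.of_comp isMorphism_val (isMorphism_restrict h'.imm.morph) h'.imm)
    exact this.trans (isIso_ofProjective N _).symm

theorem QP.of_lcImm {X Y : RegSpace} [X.Nice] [QP Y] {φ : X.Pt → Y.Pt} (h : IsLCImm X Y φ) :
    QP X := by
  obtain ⟨ι, _, _, ψ, hψ⟩ := QP.exists_imm Y
  exact QP.of_imm (hψ.comp h)

theorem QP.restrict {X : RegSpace} [QP X] {S : Set X.Pt} (hS : IsLocallyClosed S) :
    QP (X.restrict S) :=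
  QP.of_lcImm (φ := (Subtype.val : S → X.Pt)) ⟨.val S, by
    have : Set.range (Subtype.val : S → X.Pt) = S := Subtype.range_val
    exact this.symm ▸ hS⟩

theorem QP.of_isEmpty (X : RegSpace) [IsEmpty X.Pt] : QP X :=
  haveI : X.Nice :=
    { congr := fun {x} => isEmptyElim x
      const := fun x => isEmptyElim x
      add := fun {x} => isEmptyElim x
      mul := fun {x} => isEmptyElim x
      inv := fun {x} => isEmptyElim x
      eventually_reg := fun {x} => isEmptyElim x
      eventually_ne := fun {x} => isEmptyElim x }
  QP.of_imm (ι := Unit) (φ := fun x => isEmptyElim x)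
    ⟨.of_isEmpty (Y := proj Unit) _,
      (Set.range_eq_empty (fun x : X.Pt => (isEmptyElim x : (proj Unit).Pt))).symm ▸
        isOpen_empty.isLocallyClosed⟩

instance point_qp : QP point := by
  have h1 : (fun _ : Unit => (1 : ℂ)) ≠ 0 := fun h => one_ne_zero (congrFun h ())
  let q : (proj Unit).Pt := Projectivization.mk ℂ (fun _ => 1) h1
  refine QP.of_imm (ι := Unit) (φ := fun _ => q)
    (.of_surjective ⟨fun _ _ _ => Subsingleton.elim _ _, isMorphism_const q,
      fun _ _ _ _ => isMorphism_of_subsingleton _⟩ fun p => ⟨(), ?_⟩)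
  · induction p using Projectivization.ind with
    | h v hv => exact (eq_mk_iff _ hv).2 fun i j => by rw [Subsingleton.elim i j]

/-! ### The Segre embedding -/

/-- The Segre embedding. -/
def segre {ι κ : Type} (p : ℙ ℂ (ι → ℂ) × ℙ ℂ (κ → ℂ)) : ℙ ℂ (ι × κ → ℂ) :=
  Projectivization.mk ℂ (fun k => p.1.rep k.1 * p.2.rep k.2) (by
    obtain ⟨i, hi⟩ := Function.ne_iff.1 p.1.rep_nonzero
    obtain ⟨j, hj⟩ := Function.ne_iff.1 p.2.rep_nonzero
    exact fun h => mul_ne_zero hi hj (congrFun h (i, j)))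

theorem tensor_ne_zero {ι κ : Type} {v : ι → ℂ} {w : κ → ℂ} (hv : v ≠ 0) (hw : w ≠ 0) :
    (fun k : ι × κ => v k.1 * w k.2) ≠ 0 := by
  obtain ⟨i, hi⟩ := Function.ne_iff.1 hv
  obtain ⟨j, hj⟩ := Function.ne_iff.1 hw
  exact fun h => mul_ne_zero hi hj (congrFun h (i, j))

theorem segre_mk {ι κ : Type} {v : ι → ℂ} {w : κ → ℂ} (hv : v ≠ 0) (hw : w ≠ 0) :
    segre (Projectivization.mk ℂ v hv, Projectivization.mk ℂ w hw) =
      Projectivization.mk ℂ _ (tensor_ne_zero hv hw) := by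
  obtain ⟨a, ha⟩ := Projectivization.exists_smul_eq_mk_rep ℂ v hv
  obtain ⟨b, hb⟩ := Projectivization.exists_smul_eq_mk_rep ℂ w hw
  refine (Projectivization.mk_eq_mk_iff' ℂ _ _ _ _).2 ⟨(a : ℂ) * b, funext fun k => ?_⟩
  simp only [← ha, ← hb, Units.smul_def, Pi.smul_apply, smul_eq_mul]
  ring

/-- Homogeneous coordinates of a pair of points are found in a column and a row of the matrix of
homogeneous coordinates of its image. -/
theorem eq_mk_of_segre_eq {ι κ : Type} {p : ℙ ℂ (ι → ℂ) × ℙ ℂ (κ → ℂ)} {m : ι × κ → ℂ} (hm : m ≠ 0)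
    (h : segre p = Projectivization.mk ℂ m hm) {i : ι} {j : κ} (hij : m (i, j) ≠ 0) :
    (∃ h1, p.1 = Projectivization.mk ℂ (fun i' => m (i', j)) h1) ∧
      ∃ h2, p.2 = Projectivization.mk ℂ (fun j' => m (i, j')) h2 := by
  obtain ⟨p, q⟩ := p
  induction p using Projectivization.ind with
  | h v hv =>
  induction q using Projectivization.ind with
  | h w hw =>
  rw [segre_mk, Projectivization.mk_eq_mk_iff'] at h
  obtain ⟨a, ha⟩ := h
  have ha' : ∀ k, a * m k = v k.1 * w k.2 := fun k => congrFun ha k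
  have ha0 : a ≠ 0 := by
    rintro rfl
    exact tensor_ne_zero hv hw (by rw [← ha, zero_smul])
  refine ⟨⟨fun h => hij (congrFun h i), (eq_mk_iff _ _).2 fun k l => ?_⟩,
    ⟨fun h => hij (congrFun h j), (eq_mk_iff _ _).2 fun k l => ?_⟩⟩
  · refine mul_left_cancel₀ ha0 ?_
    linear_combination v k * ha' (l, j) - v l * ha' (k, j)
  · refine mul_left_cancel₀ ha0 ?_
    linear_combination w k * ha' (i, l) - w l * ha' (i, k)

theorem isImm_segre (ι κ : Type) : IsImm (prod (proj ι) (proj κ)) (proj (ι × κ)) segre where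
  inj := by
    intro p q h
    obtain ⟨i, hi⟩ := Function.ne_iff.1 p.1.rep_nonzero
    obtain ⟨j, hj⟩ := Function.ne_iff.1 p.2.rep_nonzero
    have hij : p.1.rep i * p.2.rep j ≠ 0 := mul_ne_zero hi hj
    obtain ⟨⟨_, h1⟩, ⟨_, h2⟩⟩ := eq_mk_of_segre_eq (p := p) _ rfl (i := i) (j := j) hij
    obtain ⟨⟨_, h1'⟩, ⟨_, h2'⟩⟩ := eq_mk_of_segre_eq (p := q) _ h.symm (i := i) (j := j) hij
    exact Prod.ext (h1.trans h1'.symm) (h2.trans h2'.symm)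
  morph := by
    refine isMorphism_proj fun p => ?_
    obtain ⟨v, hv, h⟩ := (isMorphism_fst (proj ι) (proj κ)).hasLift p
    obtain ⟨w, hw, h'⟩ := (isMorphism_snd (proj ι) (proj κ)).hasLift p
    refine ⟨fun y k => v y k.1 * w y k.2, fun k => Nice.mul (hv _) (hw _), ?_⟩
    filter_upwards [h, h'] with y ⟨hy, hy1⟩ ⟨hy', hy1'⟩
    refine ⟨tensor_ne_zero hy hy', ?_⟩
    rw [← segre_mk hy hy', ← hy1, ← hy1']
    rfl
  lift Z _ χ hχ := by
    have key : ∀ z, HasLift Z (fun z => (χ z).1) z ∧ HasLift Z (fun z => (χ z).2) z := by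
      intro z
      obtain ⟨v, hv, h⟩ := hχ.hasLift z
      obtain ⟨hz, -⟩ := h.self_of_nhds
      obtain ⟨⟨i, j⟩, hij⟩ := Function.ne_iff.1 hz
      have hev := h.and (Nice.eventually_ne (hv (i, j)) hij)
      exact ⟨⟨fun y i' => v y (i', j), fun _ => hv _, hev.mono fun y ⟨⟨h0, h1⟩, h2⟩ =>
          (eq_mk_of_segre_eq h0 h1 h2).1⟩, ⟨fun y j' => v y (i, j'), fun _ => hv _,
          hev.mono fun y ⟨⟨h0, h1⟩, h2⟩ => (eq_mk_of_segre_eq h0 h1 h2).2⟩⟩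
    exact isMorphism_prod (isMorphism_proj fun z => (key z).1) (isMorphism_proj fun z => (key z).2)

/-- The image of the Segre embedding consists of the matrices of rank one, which are described by
the vanishing of the minors. -/
theorem isClosed_range_segre (ι κ : Type) :
    IsClosed (Set.range (segre : ℙ ℂ (ι → ℂ) × ℙ ℂ (κ → ℂ) → _)) := by
  have hF : ∀ (i i' : ι) (j j' : κ), (MvPolynomial.X (i, j) * MvPolynomial.X (i', j') -
      MvPolynomial.X (i, j') * MvPolynomial.X (i', j) : MvPolynomial (ι × κ) ℂ).IsHomogeneous 2 :=
    fun i i' j j' => ((MvPolynomial.isHomogeneous_X ℂ _).mul (MvPolynomial.isHomogeneous_X ℂ _)).sub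
      ((MvPolynomial.isHomogeneous_X ℂ _).mul (MvPolynomial.isHomogeneous_X ℂ _))
  have : Set.range (segre : ℙ ℂ (ι → ℂ) × ℙ ℂ (κ → ℂ) → _) = ⋂ (i) (i') (j) (j'),
      {p | MvPolynomial.eval p.rep (MvPolynomial.X (i, j) * MvPolynomial.X (i', j') -
      MvPolynomial.X (i, j') * MvPolynomial.X (i', j) : MvPolynomial (ι × κ) ℂ) = 0} := by
    ext m
    simp only [Set.mem_iInter]
    change m ∈ _ ↔ ∀ i i' j j', MvPolynomial.eval m.rep _ = 0
    simp only [map_sub, map_mul, MvPolynomial.eval_X, sub_eq_zero]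
    constructor
    · rintro ⟨p, rfl⟩ i i' j j'
      obtain ⟨a, ha⟩ := Projectivization.exists_smul_eq_mk_rep ℂ
        (fun k : ι × κ => p.1.rep k.1 * p.2.rep k.2)
        (tensor_ne_zero p.1.rep_nonzero p.2.rep_nonzero)
      simp only [segre, ← ha, Units.smul_def, Pi.smul_apply, smul_eq_mul]
      ring
    · intro h
      obtain ⟨⟨i, j⟩, hij⟩ := Function.ne_iff.1 m.rep_nonzero
      have hij : m.rep (i, j) ≠ 0 := hij
      have h1 : (fun i' => m.rep (i', j)) ≠ 0 := fun h => hij (congrFun h i)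
      have h2 : (fun j' => m.rep (i, j')) ≠ 0 := fun h => hij (congrFun h j)
      refine ⟨(Projectivization.mk ℂ _ h1, Projectivization.mk ℂ _ h2), ?_⟩
      rw [segre_mk]
      refine Eq.trans ?_ m.mk_rep
      refine (Projectivization.mk_eq_mk_iff' ℂ _ _ _ _).2 ⟨m.rep (i, j), funext fun k => ?_⟩
      exact (h i k.1 j k.2).trans (mul_comm _ _)
  rw [this]
  exact isClosed_iInter fun i => isClosed_iInter fun i' => isClosed_iInter fun j =>
    isClosed_iInter fun j' => isClosed_proj (hF i i' j j')

instance prod_qp (X Y : RegSpace) [QP X] [QP Y] : QP (prod X Y) := by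
  obtain ⟨ι, _, _, φ, hφ⟩ := QP.exists_imm X
  obtain ⟨κ, _, _, ψ, hψ⟩ := QP.exists_imm Y
  exact QP.of_imm (IsLCImm.comp (Z := proj (ι × κ))
    ⟨isImm_segre ι κ, (isClosed_range_segre ι κ).isLocallyClosed⟩ (hφ.prod hψ))

/-! ### Finite products -/

instance pi_qp {ι : Type} [Finite ι] (X : ι → RegSpace) [h : ∀ i, QP (X i)] : QP (pi X) := by
  refine Finite.induction_empty_option
    (P := fun ι => ∀ [Finite ι] (X : ι → RegSpace) [∀ i, QP (X i)], QP (pi X)) ?_ ?_ ?_ ι X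
  · intro α β e ih _ X _
    have := Finite.of_equiv β e.symm
    have := ih (fun i => X (e i))
    refine QP.of_lcImm (Y := pi fun i => X (e i)) (φ := fun (x : ∀ j, (X j).Pt) i => x (e i))
      (.of_surjective ⟨fun x y hxy => ?_, isMorphism_pi fun i => isMorphism_apply _,
        fun Z _ χ hχ => isMorphism_pi fun j => ?_⟩ fun y => ?_)
    · funext j
      obtain ⟨i, rfl⟩ := e.surjective j
      exact congrFun hxy i
    · obtain ⟨i, rfl⟩ := e.surjective j
      exact (isMorphism_apply (X := fun i => X (e i)) i).comp hχ
    · exact ⟨(Equiv.piCongrLeft (fun j => (X j).Pt) e) y,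
        funext fun i => Equiv.piCongrLeft_apply_apply (fun j => (X j).Pt) e y i⟩
  · intro _ X _
    exact QP.of_lcImm (Y := point) (φ := fun _ => ())
      (.of_surjective ⟨fun x y _ => funext fun i => i.elim,
        isMorphism_of_subsingleton (Y := point) _,
        fun Z _ χ _ => isMorphism_pi fun j => j.elim⟩ fun _ => ⟨fun i => i.elim, rfl⟩)
  · intro α _ ih _ X _
    have := ih (fun i => X (some i))
    refine QP.of_lcImm (Y := prod (X none) (pi fun i => X (some i)))
      (φ := fun x : ∀ j, (X j).Pt => (x none, fun i => x (some i)))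
      (.of_surjective ⟨fun x y hxy => ?_, isMorphism_prod (isMorphism_apply _)
        (isMorphism_pi fun i => isMorphism_apply _), fun Z _ χ hχ => isMorphism_pi fun j => ?_⟩
        fun y => ?_)
    · funext j
      rcases j with _ | j
      · exact congrArg Prod.fst hxy
      · exact congrFun (congrArg Prod.snd hxy) j
    · rcases j with _ | j
      · exact (isMorphism_fst _ _).comp hχ
      · exact (isMorphism_apply (X := fun i => X (some i)) j).comp ((isMorphism_snd _ _).comp hχ)
    · exact ⟨fun j => match j with
        | none => y.1
        | some j => y.2 j, rfl⟩

/-! ### Disjoint unions -/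

/-- The embedding of a disjoint union of projective spaces as disjoint linear subspaces. -/
def joinMap {ι : Type} [DecidableEq ι] {κ : ι → Type} (p : Σ i, ℙ ℂ (κ i → ℂ)) :
    ℙ ℂ ((Σ i, κ i) → ℂ) :=
  Projectivization.mk ℂ (fun k => if h : k.1 = p.1 then p.2.rep (h ▸ k.2) else 0) (by
    obtain ⟨j, hj⟩ := Function.ne_iff.1 p.2.rep_nonzero
    exact fun h => hj (by simpa using congrFun h ⟨p.1, j⟩))

section Join

variable {ι : Type} [DecidableEq ι] {κ : ι → Type}

/-- Extension of coordinates by zero. -/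
def extZero (i : ι) (v : κ i → ℂ) : (Σ i, κ i) → ℂ :=
  fun k => if h : k.1 = i then v (h ▸ k.2) else 0

@[simp] theorem extZero_same (i : ι) (v : κ i → ℂ) (k : κ i) : extZero i v ⟨i, k⟩ = v k := by
  simp [extZero]

theorem extZero_of_ne {i : ι} (v : κ i → ℂ) {k : Σ i, κ i} (h : k.1 ≠ i) : extZero i v k = 0 := by
  simp [extZero, h]

theorem extZero_ne_zero {i : ι} {v : κ i → ℂ} (hv : v ≠ 0) : extZero i v ≠ 0 := by
  obtain ⟨j, hj⟩ := Function.ne_iff.1 hv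
  exact fun h => hj (by simpa using congrFun h ⟨i, j⟩)

theorem joinMap_mk {i : ι} {v : κ i → ℂ} (hv : v ≠ 0) :
    joinMap ⟨i, Projectivization.mk ℂ v hv⟩ = Projectivization.mk ℂ _ (extZero_ne_zero hv) := by
  obtain ⟨a, ha⟩ := Projectivization.exists_smul_eq_mk_rep ℂ v hv
  refine (Projectivization.mk_eq_mk_iff' ℂ _ _ _ _).2 ⟨a, funext fun k => ?_⟩
  by_cases h : k.1 = i
  · obtain ⟨j, k⟩ := k
    obtain rfl : j = i := h
    simp [← ha, Units.smul_def]
  · simp [h, extZero_of_ne]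

theorem eq_mk_of_joinMap_eq {p : Σ i, ℙ ℂ (κ i → ℂ)} {m : (Σ i, κ i) → ℂ} (hm : m ≠ 0)
    (h : joinMap p = Projectivization.mk ℂ m hm) {i : ι} {j : κ i} (hij : m ⟨i, j⟩ ≠ 0) :
    ∃ h1, p = ⟨i, Projectivization.mk ℂ (fun k => m ⟨i, k⟩) h1⟩ := by
  obtain ⟨i', p⟩ := p
  induction p using Projectivization.ind with
  | h v hv =>
  rw [joinMap_mk, eq_mk_iff] at h
  obtain ⟨k, hk⟩ := Function.ne_iff.1 hv
  have hk : v k ≠ 0 := hk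
  obtain rfl : i' = i := by
    by_contra hne
    have := h ⟨i', k⟩ ⟨i, j⟩
    rw [extZero_same, extZero_of_ne v (k := ⟨i, j⟩) (Ne.symm hne), zero_mul] at this
    exact mul_ne_zero hk hij this
  refine ⟨fun h => hij (congrFun h j), ?_⟩
  congr 1
  refine (eq_mk_iff _ _).2 fun k l => ?_
  simpa using h ⟨i', k⟩ ⟨i', l⟩

theorem isImm_joinMap (κ : ι → Type) [∀ i, Finite (κ i)] :
    IsImm (sigma fun i => proj (κ i)) (proj (Σ i, κ i)) joinMap where
  inj := by
    rintro ⟨i, p⟩ q h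
    induction p using Projectivization.ind with
    | h v hv =>
    obtain ⟨j, hj⟩ := Function.ne_iff.1 hv
    have hj : extZero i v ⟨i, j⟩ ≠ 0 := by simpa using hj
    obtain ⟨_, h1⟩ := eq_mk_of_joinMap_eq _ (joinMap_mk hv) hj
    obtain ⟨_, h2⟩ := eq_mk_of_joinMap_eq _ (h.symm.trans (joinMap_mk hv)) hj
    exact h1.trans h2.symm
  morph := by
    refine isMorphism_sigma fun i => isMorphism_proj fun p => ?_
    obtain ⟨v, hv, h⟩ := hasLift_id p
    refine ⟨fun y => extZero i (v y), fun k => ?_, h.mono fun y ⟨h0, h1⟩ => ?_⟩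
    · by_cases h : k.1 = i
      · obtain ⟨j, k⟩ := k
        obtain rfl : j = i := h
        simpa using hv k
      · simpa [extZero_of_ne _ h] using Nice.const p 0
    · refine ⟨extZero_ne_zero h0, ?_⟩
      rw [← joinMap_mk h0, ← h1]
      rfl
  lift Z _ χ hχ := by
    refine isMorphism_of_local fun z => ?_
    obtain ⟨v, hv, h⟩ := hχ.hasLift z
    obtain ⟨hz, -⟩ := h.self_of_nhds
    obtain ⟨⟨i, j⟩, hij⟩ := Function.ne_iff.1 hz
    have hev := h.and (Nice.eventually_ne (hv ⟨i, j⟩) hij)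
    obtain ⟨O, hO, hOo, hzO⟩ := eventually_nhds_iff.1
      (hev.and (eventually_all.2 fun k => Nice.eventually_reg (hv ⟨i, k⟩)))
    refine ⟨O, hOo, hzO, ?_⟩
    choose h1 h2 using fun y : O => eq_mk_of_joinMap_eq (hO y y.2).1.1.1 (hO y y.2).1.1.2
      (hO y y.2).1.2
    have key : IsMorphism (Z.restrict O) (proj (κ i))
        fun y : O => Projectivization.mk ℂ (fun k => v y ⟨i, k⟩) (h1 y) :=
      isMorphism_proj fun y => ⟨fun (y : O) k => v y ⟨i, k⟩,
        fun k => isMorphism_val.2 y _ ((hO y.1 y.2).2 k), Eventually.of_forall fun y => ⟨h1 y, rfl⟩⟩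
    exact ((isMorphism_mk (X := fun i => proj (κ i)) i).comp key).congr h2

theorem isClosed_range_joinMap 
    :    IsClosed (Set.range (joinMap : (Σ i, ℙ ℂ (κ i → ℂ)) → _)) := by
  have : Set.range (joinMap : (Σ i, ℙ ℂ (κ i → ℂ)) → _) = ⋂ (k : Σ i, κ i) (l : Σ i, κ i)
      (_ : k.1 ≠ l.1), {p | MvPolynomial.eval p.rep
        (MvPolynomial.X k * MvPolynomial.X l : MvPolynomial (Σ i, κ i) ℂ) = 0} := by
    ext m
    simp only [Set.mem_iInter]
    change m ∈ _ ↔ ∀ k l, _ → MvPolynomial.eval m.rep _ = 0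
    simp only [map_mul, MvPolynomial.eval_X]
    constructor
    · rintro ⟨⟨i, p⟩, rfl⟩ k l hkl
      induction p using Projectivization.ind with
      | h v hv =>
      rw [joinMap_mk]
      obtain ⟨a, ha⟩ := Projectivization.exists_smul_eq_mk_rep ℂ _ (extZero_ne_zero hv)
      rw [← ha]
      by_cases hk : k.1 = i
      · simp [Units.smul_def, extZero_of_ne v (k := l) fun hl => hkl (hk.trans hl.symm)]
      · simp [Units.smul_def, extZero_of_ne v hk]
    · intro h
      obtain ⟨⟨i, j⟩, hij⟩ := Function.ne_iff.1 m.rep_nonzero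
      have hij : m.rep ⟨i, j⟩ ≠ 0 := hij
      have h1 : (fun k => m.rep ⟨i, k⟩) ≠ 0 := fun h => hij (congrFun h j)
      refine ⟨⟨i, Projectivization.mk ℂ _ h1⟩, ?_⟩
      rw [joinMap_mk]
      refine Eq.trans ?_ m.mk_rep
      congr 1
      funext k
      by_cases hk : k.1 = i
      · obtain ⟨i', k⟩ := k
        obtain rfl : i' = i := hk
        simp
      · rw [extZero_of_ne _ hk]
        exact ((mul_eq_zero.1 (h k ⟨i, j⟩ hk)).resolve_right hij).symm
  rw [this]
  exact isClosed_iInter fun k => isClosed_iInter fun l => isClosed_iInter fun _ =>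
    isClosed_proj ((MvPolynomial.isHomogeneous_X ℂ _).mul (MvPolynomial.isHomogeneous_X ℂ _))

end Join

theorem range_sigmaMap {ι : Type} {X Y : ι → RegSpace} (φ : ∀ i, (X i).Pt → (Y i).Pt) :
    Set.range (Sigma.map (β₂ := fun i => (Y i).Pt) _root_.id φ) =
      {y : Σ i, (Y i).Pt | y.2 ∈ Set.range (φ y.1)} := by
  ext ⟨i, y⟩
  constructor
  · rintro ⟨⟨j, x⟩, h⟩
    obtain rfl : j = i := congrArg Sigma.fst h
    exact ⟨x, eq_of_heq (Sigma.mk.inj h).2⟩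
  · rintro ⟨x, hx⟩
    exact ⟨⟨i, x⟩, congrArg (Sigma.mk (β := fun i => (Y i).Pt) i) hx⟩

theorem isClosed_sigma {ι : Type} {X : ι → RegSpace} {S : Set (Σ i, (X i).Pt)} :
    @IsClosed _ (sigma X).top S ↔ ∀ i, IsClosed {x : (X i).Pt | (⟨i, x⟩ : Σ i, (X i).Pt) ∈ S} :=
  isClosed_sigma_iff (σ := fun i => (X i).Pt)

theorem isOpen_sigma {ι : Type} {X : ι → RegSpace} {S : Set (Σ i, (X i).Pt)} :
    @IsOpen _ (sigma X).top S ↔ ∀ i, IsOpen {x : (X i).Pt | (⟨i, x⟩ : Σ i, (X i).Pt) ∈ S} :=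
  isOpen_sigma_iff (σ := fun i => (X i).Pt)

instance sigma_qp {ι : Type} [Finite ι] (X : ι → RegSpace) [h : ∀ i, QP (X i)] :
    QP (sigma X) := by
  classical
  rcases isEmpty_or_nonempty ι with hι | hι
  · have : IsEmpty (sigma X).Pt := inferInstanceAs (IsEmpty (Σ i, (X i).Pt))
    exact QP.of_isEmpty _
  choose κ h1 h2 φ hφ using fun i => QP.exists_imm (X i)
  have hne : Nonempty (Σ i, κ i) := ⟨⟨Classical.arbitrary ι, Classical.arbitrary _⟩⟩
  refine QP.of_imm (IsLCImm.comp (Z := proj (Σ i, κ i))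
    ⟨isImm_joinMap κ, isClosed_range_joinMap.isLocallyClosed⟩
    ⟨IsImm.sigma (Y := fun i => proj (κ i)) fun i => (hφ i).imm, ?_⟩)
  refine (congrArg (@IsLocallyClosed _ (sigma fun i => proj (κ i)).top)
    (range_sigmaMap (Y := fun i => proj (κ i)) φ)).mpr ?_
  choose U C hU hC hUC using fun i => (hφ i).range
  refine ⟨{y | y.2 ∈ U y.1}, {y | y.2 ∈ C y.1}, isOpen_sigma.2 hU, isClosed_sigma.2 hC, ?_⟩
  ext y
  exact Set.ext_iff.1 (hUC y.1) y.2

/-! ### Separatedness -/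

/-- Two morphisms to a quasi-projective variety agree on a closed set. -/
theorem isClosed_eq_of_isMorphism {X Z : RegSpace} [QP X] [Z.Nice] {f g : Z.Pt → X.Pt}
    (hf : IsMorphism Z X f) (hg : IsMorphism Z X g) : IsClosed {z | f z = g z} := by
  obtain ⟨ι, _, _, φ, hφ⟩ := QP.exists_imm X
  refine isOpen_compl_iff.1 (isOpen_iff_mem_nhds.2 fun z hz => ?_)
  obtain ⟨v, hv, hv'⟩ := (hφ.imm.morph.comp hf).hasLift z
  obtain ⟨w, hw, hw'⟩ := (hφ.imm.morph.comp hg).hasLift z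
  obtain ⟨hv0, hv1⟩ := hv'.self_of_nhds
  obtain ⟨hw0, hw1⟩ := hw'.self_of_nhds
  have hne : ¬ ∀ i j, v z i * w z j = v z j * w z i := by
    rw [← eq_mk_iff hv0 hw0, ← hv1, ← hw1]
    exact fun h => hz (hφ.imm.inj h)
  push Not at hne
  obtain ⟨i, j, hij⟩ := hne
  filter_upwards [hv', hw', Nice.eventually_ne (Nice.sub (Nice.mul (hv i) (hw j))
    (Nice.mul (hv j) (hw i))) (sub_ne_zero.2 hij)] with y ⟨hy0, hy1⟩ ⟨hy0', hy1'⟩ hy h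
  have h : f y = g y := h
  have h2 : φ (f y) = φ (g y) := congrArg φ h
  rw [show φ (f y) = _ from hy1, show φ (g y) = _ from hy1', eq_mk_iff] at h2
  exact sub_ne_zero.1 hy (h2 i j)

end RegSpace

open RegSpace

/-! ### Classes of varieties with a group action -/

theorem RegSpace.IsImm.exists_isIso {X Y : RegSpace} [Y.Nice] [X.Nice] {φ : X.Pt → Y.Pt}
    (h : IsImm X Y φ) {S : Set Y.Pt} (hS : Set.range φ = S) :
    ∃ e : X.Pt ≃ S, (∀ x, (e x : Y.Pt) = φ x) ∧ IsIso X (Y.restrict S) e := by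
  subst hS
  exact ⟨Equiv.ofInjective φ h.inj, fun x => rfl,
    IsImm.isIso (IsImm.of_comp isMorphism_val (isMorphism_restrict h.morph) h)⟩

namespace GSpace

variable {Γ : Type} [Group Γ]

/-- Being a variety with a group action, as a type class. -/
class Var (X : GSpace Γ) : Prop where
  out : X.IsVariety

instance (X : GSpace Γ) [h : X.Var] : QP X.space := ⟨h.out.1⟩

/-- A variety with a group action as a generator of the Grothendieck group. -/
def toGVar (X : GSpace Γ) [h : X.Var] : GVar Γ := ⟨X, h.out⟩

/-- The quotient map that defines the Grothendieck group. -/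
def mkK (Γ : Type) [Group Γ] : FreeAbelianGroup (GVar Γ) →+ K Γ := QuotientAddGroup.mk' _

theorem mkK_surjective : Function.Surjective (mkK Γ) := QuotientAddGroup.mk'_surjective _

theorem mkK_eq_zero {r : FreeAbelianGroup (GVar Γ)} (h : KRel Γ r) : mkK Γ r = 0 :=
  (QuotientAddGroup.eq_zero_iff _).2 (AddSubgroup.subset_closure h)

theorem classOf_eq (X : GSpace Γ) [h : X.Var] :
    classOf X = mkK Γ (FreeAbelianGroup.of X.toGVar) :=
  dif_pos h.out

theorem classOf_eq_of_isIso {X Y : GSpace Γ} [X.Var] [Y.Var] (e : Y.space.Pt ≃ X.space.Pt)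
    (he : IsIso Y.space X.space e) (hact : ∀ γ y, e (Y.act γ y) = X.act γ (e y)) :
    classOf X = classOf Y := by
  rw [classOf_eq, classOf_eq, ← sub_eq_zero, ← map_sub]
  exact mkK_eq_zero (KRel.iso _ _ e he hact)

/-- The relation for a closed invariant subvariety, the subvariety and its complement being given
by immersions. -/
theorem classOf_cut {X Y U : GSpace Γ} [X.Var] [Y.Var] [U.Var] {i : Y.space.Pt → X.space.Pt}
    {j : U.space.Pt → X.space.Pt} (hi : IsImm Y.space X.space i) (hj : IsImm U.space X.space j)
    (hia : ∀ γ y, i (Y.act γ y) = X.act γ (i y)) (hja : ∀ γ y, j (U.act γ y) = X.act γ (j y))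
    (hc : IsClosed (Set.range i)) (hr : Set.range j = (Set.range i)ᶜ) :
    classOf X = classOf Y + classOf U := by
  obtain ⟨e, he, hei⟩ := hi.exists_isIso rfl
  obtain ⟨e', he', hei'⟩ := hj.exists_isIso hr
  rw [classOf_eq, classOf_eq, classOf_eq, ← sub_eq_zero, add_comm, ← map_add, ← map_sub]
  refine mkK_eq_zero (KRel.cut X.toGVar Y.toGVar U.toGVar (Set.range i) hc ?_ e
    ⟨hei, fun γ y => ?_⟩ e' ⟨hei', fun γ y => ?_⟩)
  · rintro γ _ ⟨y, rfl⟩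
    exact ⟨Y.act γ y, hia γ y⟩
  · exact (he _).trans ((hia γ y).trans (congrArg _ (he y).symm))
  · exact (he' _).trans ((hja γ y).trans (congrArg _ (he' y).symm))

theorem classOf_of_isEmpty (X : GSpace Γ) [IsEmpty X.space.Pt] : classOf X = 0 := by
  by_cases h : X.IsVariety
  · have : X.Var := ⟨h⟩
    have h1 := classOf_cut (X := X) (Y := X) (U := X) (i := id) (j := id) (.id _) (.id _)
      (fun _ _ => rfl) (fun _ _ => rfl) (by rw [Set.range_id]; exact isClosed_univ)
      (Subsingleton.elim _ _)
    exact left_eq_add.1 h1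
  · exact dif_neg h

theorem Var.of_isEmpty (X : GSpace Γ) [IsEmpty X.space.Pt] : X.Var :=
  ⟨(QP.of_isEmpty X.space).out, fun _ => (IsImm.of_isEmpty _).morph⟩

/-- An invariant subset as a space with group action. -/
def sub (X : GSpace Γ) (S : Set X.space.Pt) (hS : ∀ γ x, X.act γ x ∈ S ↔ x ∈ S) : GSpace Γ where
  space := X.space.restrict S
  act :=
    { toFun := fun γ => (X.act γ).subtypePerm (p := (· ∈ S)) (hS γ)
      map_one' := Equiv.ext fun x => Subtype.ext (by
        change X.act 1 x.1 = x.1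
        rw [map_one]; rfl)
      map_mul' := fun γ δ => Equiv.ext fun x => Subtype.ext (by
        change X.act (γ * δ) x.1 = X.act γ (X.act δ x.1)
        rw [map_mul]; rfl) }

instance (X : GSpace Γ) [X.space.Nice] (S : Set X.space.Pt) (hS) : (X.sub S hS).space.Nice :=
  restrict_nice

theorem Var.sub {X : GSpace Γ} [X.Var] {S : Set X.space.Pt} (hl : IsLocallyClosed S)
    (hS : ∀ γ x, X.act γ x ∈ S ↔ x ∈ S) : (X.sub S hS).Var :=
  ⟨(QP.restrict hl).out, fun γ => isMorphism_restrict
    (((‹X.Var›.out.2 γ)).comp isMorphism_val)⟩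

theorem classOf_sub_cut {X : GSpace Γ} [X.Var] {S T U : Set X.space.Pt} (hl : IsLocallyClosed S)
    {C : Set X.space.Pt} (hC : IsClosed C) (hT : S ∩ C = T) (hU : S ∩ Cᶜ = U)
    (hSi : ∀ γ x, X.act γ x ∈ S ↔ x ∈ S) (hTi : ∀ γ x, X.act γ x ∈ T ↔ x ∈ T)
    (hUi : ∀ γ x, X.act γ x ∈ U ↔ x ∈ U) :
    classOf (X.sub S hSi) = classOf (X.sub T hTi) + classOf (X.sub U hUi) := by
  subst hT hU
  have := Var.sub hl hSi
  have := Var.sub (hl.inter hC.isLocallyClosed) hTi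
  have := Var.sub (hl.inter hC.isOpen_compl.isLocallyClosed) hUi
  refine classOf_cut (X := X.sub S hSi) (Y := X.sub _ hTi) (U := X.sub _ hUi)
    (i := fun x : ↥(S ∩ C) => (⟨x, x.2.1⟩ : S)) (j := fun x : ↥(S ∩ Cᶜ) => (⟨x, x.2.1⟩ : S))
    (.of_comp isMorphism_val (isMorphism_restrict isMorphism_val) (.val _))
    (.of_comp isMorphism_val (isMorphism_restrict isMorphism_val) (.val _))
    (fun _ _ => rfl) (fun _ _ => rfl) ?_ ?_
  · refine (congrArg (@IsClosed _ (X.space.restrict S).top) (?_ : _ = Subtype.val ⁻¹' C)).mpr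
      (hC.preimage continuous_subtype_val)
    ext x
    exact ⟨by rintro ⟨y, rfl⟩; exact y.2.2, fun hx => ⟨⟨x.1, x.2, hx⟩, rfl⟩⟩
  · ext x
    constructor
    · rintro ⟨y, rfl⟩ ⟨z, hz⟩
      have hz : z.1 = y.1 := congrArg Subtype.val hz
      exact y.2.2 (hz ▸ z.2.2)
    · intro hx
      exact ⟨⟨x.1, x.2, fun hc => hx ⟨⟨x.1, x.2, hc⟩, rfl⟩⟩, rfl⟩

theorem isLocallyClosed_level {P : Type} [TopologicalSpace P] {f : P → ℕ}
    (hf : ∀ k, IsClosed {x | k ≤ f x}) (k : ℕ) : IsLocallyClosed {x | f x = k} := by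
  have : {x | f x = k} = {x | k ≤ f x} ∩ {x | k + 1 ≤ f x}ᶜ := by
    ext x
    change f x = k ↔ k ≤ f x ∧ ¬ (k + 1 ≤ f x)
    omega
  rw [this]
  exact (hf k).isLocallyClosed.inter (hf _).isOpen_compl.isLocallyClosed

/-- A variety is the sum of the strata of an invariant upper semicontinuous function. -/
theorem classOf_eq_sum_level (X : GSpace Γ) [X.Var] (f : X.space.Pt → ℕ)
    (hinv : ∀ γ x, f (X.act γ x) = f x) (hf : ∀ k, IsClosed {x | k ≤ f x}) (N : ℕ)
    (hN : ∀ x, f x < N) :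
    classOf X = ∑ k ∈ Finset.range N,
      classOf (X.sub {x | f x = k} fun γ x => by
        change f (X.act γ x) = k ↔ f x = k
        rw [hinv]) := by
  have hi : ∀ k γ x, X.act γ x ∈ {x | k ≤ f x} ↔ x ∈ {x | k ≤ f x} := fun k γ x => by
    change k ≤ f (X.act γ x) ↔ k ≤ f x
    rw [hinv]
  have step : ∀ M, classOf X = ∑ k ∈ Finset.range M, classOf (X.sub {x | f x = k} fun γ x => by
        change f (X.act γ x) = k ↔ f x = k
        rw [hinv]) + classOf (X.sub {x | M ≤ f x} (hi M)) := by
    intro M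
    induction M with
    | zero =>
      have := Var.sub (hf 0).isLocallyClosed (hi 0)
      rw [Finset.range_zero, Finset.sum_empty, zero_add]
      exact classOf_eq_of_isIso (Equiv.subtypeUnivEquiv (p := (· ∈ {x | 0 ≤ f x}))
        fun x => Nat.zero_le _) ⟨isMorphism_val, isMorphism_restrict (.id _)⟩ fun _ _ => rfl
    | succ M ih =>
      rw [ih, Finset.sum_range_succ, add_assoc, add_right_inj]
      have hS : {x | M ≤ f x} ∩ {x | M + 1 ≤ f x} = {x | M + 1 ≤ f x} := by
        ext x
        change M ≤ f x ∧ M + 1 ≤ f x ↔ M + 1 ≤ f x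
        omega
      have hT : {x | M ≤ f x} ∩ {x | M + 1 ≤ f x}ᶜ = {x | f x = M} := by
        ext x
        change M ≤ f x ∧ ¬ (M + 1 ≤ f x) ↔ f x = M
        omega
      rw [add_comm]
      exact classOf_sub_cut (hf M).isLocallyClosed (hf (M + 1)) hS hT _ _ _
  rw [step N]
  have : IsEmpty (X.sub {x | N ≤ f x} (hi N)).space.Pt :=
    ⟨fun x : {x | N ≤ f x} => absurd (hN x.1) (not_lt.2 x.2)⟩
  rw [classOf_of_isEmpty (X.sub {x | N ≤ f x} (hi N)), add_zero]

/-- Two varieties have the same class if there is an equivariant bijective morphism between them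
that is an isomorphism on each stratum of an upper semicontinuous function.  The latter is checked
on immersions `j k` into the source, the images of which in the target are open in the strata. -/
theorem classOf_eq_of_strata {X X' : GSpace Γ} [X.Var] [X'.Var] (F : X'.space.Pt ≃ X.space.Pt)
    (hF : IsMorphism X'.space X.space F) (hact : ∀ γ x, F (X'.act γ x) = X.act γ (F x))
    (f : X.space.Pt → ℕ) (hinv : ∀ γ x, f (X.act γ x) = f x) (hf : ∀ k, IsClosed {x | k ≤ f x})
    (N : ℕ) (hN : ∀ x, f x < N) {κ : Type} (D : κ → RegSpace) [∀ k, (D k).Nice] (n : κ → ℕ)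
    (j : ∀ k, (D k).Pt → X'.space.Pt) (hj : ∀ k, IsImm (D k) X'.space (j k))
    (hj' : ∀ k, IsImm (D k) X.space (F ∘ j k)) (O : κ → Set X.space.Pt) (hO : ∀ k, IsOpen (O k))
    (hr : ∀ k, Set.range (F ∘ j k) = O k ∩ {x | f x = n k})
    (hcov : ∀ x, ∃ k, x ∈ Set.range (j k)) : classOf X = classOf X' := by
  have hinv' : ∀ γ x, f (F (X'.act γ x)) = f (F x) := fun γ x => by rw [hact, hinv]
  have hf' : ∀ k, IsClosed {x | k ≤ f (F x)} := fun k => (hf k).preimage hF.1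
  rw [classOf_eq_sum_level X f hinv hf N hN,
    classOf_eq_sum_level X' (fun x => f (F x)) hinv' hf' N fun x => hN _]
  refine Finset.sum_congr rfl fun m _ => ?_
  have hi : ∀ γ x, X.act γ x ∈ {x | f x = m} ↔ x ∈ {x | f x = m} := fun γ x => by
    change f (X.act γ x) = m ↔ f x = m
    rw [hinv]
  have hi' : ∀ γ x, X'.act γ x ∈ {x | f (F x) = m} ↔ x ∈ {x | f (F x) = m} := fun γ x => by
    change f (F (X'.act γ x)) = m ↔ f (F x) = m
    rw [hinv']
  have := Var.sub (isLocallyClosed_level hf m) hi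
  have := Var.sub (isLocallyClosed_level hf' m) hi'
  have hm : ∀ (k : {k // n k = m}) d, f (F (j k d)) = m := fun k d => by
    have : F (j k d) ∈ Set.range (F ∘ j k) := ⟨d, rfl⟩
    rw [hr] at this
    exact this.2.trans k.2
  have hjr : ∀ (k : κ) x, x ∈ Set.range (j k) ↔ F x ∈ O k ∧ f (F x) = n k := fun k x => by
    have : x ∈ Set.range (j k) ↔ F x ∈ Set.range (F ∘ j k) := by
      rw [Set.range_comp, Set.mem_image_equiv, Equiv.symm_apply_apply]
    rw [this, hr]
    rfl
  refine classOf_eq_of_isIso (X := X.sub _ hi) (Y := X'.sub _ hi')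
    (F.subtypeEquiv (p := (· ∈ {x | f (F x) = m})) (q := (· ∈ {x | f x = m})) fun x => Iff.rfl) ?_
    fun γ x => Subtype.ext (hact γ x.1)
  refine isIso_of_charts (X := X'.space.restrict _) (Y := X.space.restrict _) _
    (D := fun k : {k // n k = m} => D k)
    (fun k d => (⟨j k d, hm k d⟩ : {x | f (F x) = m}))
    (fun k => .of_comp isMorphism_val (isMorphism_restrict (hj k).morph) (hj k)) (fun k => ?_) ?_
    (fun k => .of_comp isMorphism_val (isMorphism_restrict (hj' k).morph) (hj' k)) (fun k => ?_)
  · refine (congrArg (@IsOpen _ (X'.space.restrict _).top)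
      (?_ : _ = Subtype.val ⁻¹' (F ⁻¹' O k))).mpr
        (((hO k).preimage hF.1).preimage continuous_subtype_val)
    ext x
    constructor
    · rintro ⟨d, rfl⟩
      exact ((hjr k _).1 ⟨d, rfl⟩).1
    · intro hx
      obtain ⟨d, hd⟩ := (hjr k x.1).2 ⟨hx, x.2.trans k.2.symm⟩
      exact ⟨d, Subtype.ext hd⟩
  · intro x
    obtain ⟨k, hk⟩ := hcov x.1
    have hk' := (hjr k x.1).1 hk
    obtain ⟨d, hd⟩ := hk
    exact ⟨⟨k, hk'.2.symm.trans x.2⟩, d, Subtype.ext hd⟩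
  · refine (congrArg (@IsOpen _ (X.space.restrict _).top)
      (?_ : _ = Subtype.val ⁻¹' O k)).mpr ((hO k).preimage continuous_subtype_val)
    ext x
    constructor
    · rintro ⟨d, rfl⟩
      exact ((hjr k _).1 ⟨d, rfl⟩).1
    · intro hx
      have : x.1 ∈ Set.range (F ∘ j k) := by
        rw [hr]
        exact ⟨hx, x.2.trans k.2.symm⟩
      obtain ⟨d, hd⟩ := this
      exact ⟨d, Subtype.ext hd⟩

/-- The number of members of a finite family of closed sets that contain a point is upper
semicontinuous. -/
theorem isClosed_le_card {P ι : Type} [TopologicalSpace P] [Finite ι] (C : ι → Set P)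
    (hC : ∀ i, IsClosed (C i)) (k : ℕ) : IsClosed {x | k ≤ Nat.card {i // x ∈ C i}} := by
  classical
  have := Fintype.ofFinite ι
  have : {x | k ≤ Nat.card {i // x ∈ C i}} =
      ⋃ (T : Finset ι) (_ : k ≤ T.card), ⋂ i ∈ T, C i := by
    ext x
    simp only [Set.mem_iUnion, Set.mem_iInter, exists_prop]
    change k ≤ Nat.card _ ↔ _
    rw [Nat.card_eq_fintype_card, Fintype.card_subtype]
    constructor
    · intro h
      exact ⟨_, h, fun i hi => (Finset.mem_filter.1 hi).2⟩
    · rintro ⟨T, hT, h⟩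
      exact hT.trans (Finset.card_le_card fun i hi =>
        Finset.mem_filter.2 ⟨Finset.mem_univ _, h i hi⟩)
  rw [this]
  exact isClosed_iUnion_of_finite fun T => isClosed_iUnion_of_finite fun _ =>
    isClosed_biInter fun i _ => hC i

end GSpace

/-! ### Disjoint unions of varieties with a group action -/

namespace RegSpace

theorem isMorphism_sigmaMk {ι : Type} {X : ι → RegSpace} {W : RegSpace} (i : ι)
    {f : W.Pt → (X i).Pt} (hf : IsMorphism W (X i) f) :
    IsMorphism W (sigma X) fun w => (⟨i, f w⟩ : Σ i, (X i).Pt) :=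
  (isMorphism_mk i).comp hf

end RegSpace

namespace GSpace

variable {Γ : Type} [Group Γ]

theorem isIso_act (X : GSpace Γ) [X.Var] (γ : Γ) : IsIso X.space X.space (X.act γ) := by
  refine ⟨‹X.Var›.out.2 γ, ?_⟩
  have := ‹X.Var›.out.2 γ⁻¹
  rwa [map_inv] at this

/-- The disjoint union of two spaces with group action. -/
def sum (X Y : GSpace Γ) : GSpace Γ where
  space := RegSpace.sigma fun b : Bool => (cond b X Y).space
  act :=
    { toFun := fun γ => Equiv.sigmaCongrRight fun b => (cond b X Y).act γ
      map_one' := Equiv.ext fun z => Sigma.ext rfl (heq_of_eq (by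
        change (cond z.1 X Y).act 1 z.2 = z.2
        rw [map_one]; rfl))
      map_mul' := fun γ δ => Equiv.ext fun z => Sigma.ext rfl (heq_of_eq (by
        change (cond z.1 X Y).act (γ * δ) z.2 =
          (cond z.1 X Y).act γ ((cond z.1 X Y).act δ z.2)
        rw [map_mul]; rfl)) }

instance sum_var (X Y : GSpace Γ) [hX : X.Var] [hY : Y.Var] : (X.sum Y).Var := by
  have h : ∀ b : Bool, (cond b X Y).Var := by rintro (_ | _); exacts [hY, hX]
  exact ⟨(sigma_qp fun b : Bool => (cond b X Y).space).out, fun γ => isMorphism_sigma fun b =>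
    (isMorphism_mk b).comp ((cond b X Y).isIso_act γ).1⟩

theorem classOf_sum (X Y : GSpace Γ) [X.Var] [Y.Var] :
    classOf (X.sum Y) = classOf X + classOf Y := by
  have hr : ∀ b : Bool, Set.range (Sigma.mk (β := fun b : Bool => (cond b X Y).space.Pt) b) =
      Sigma.fst ⁻¹' {b} := fun b => Set.range_sigmaMk b
  refine classOf_cut (X := X.sum Y)
    (i := Sigma.mk (β := fun b : Bool => (cond b X Y).space.Pt) true)
    (j := Sigma.mk (β := fun b : Bool => (cond b X Y).space.Pt) false)
    (IsImm.sigmaMk (X := fun b : Bool => (cond b X Y).space) true)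
    (IsImm.sigmaMk (X := fun b : Bool => (cond b X Y).space) false)
    (fun _ _ => rfl) (fun _ _ => rfl) ?_ ?_
  · exact isClosed_range_sigmaMk (σ := fun b : Bool => (cond b X Y).space.Pt)
  · refine (hr false).trans (Eq.trans ?_ (congrArg compl (hr true)).symm)
    ext ⟨b, x⟩
    change b = false ↔ ¬ b = true
    simp

/-- Every element of the Grothendieck group is a difference of two classes. -/
theorem exists_classOf_sub (a : K Γ) :
    ∃ X Y : GSpace Γ, X.Var ∧ Y.Var ∧ a = classOf X - classOf Y := by
  let E : GSpace Γ := ⟨RegSpace.sigma fun _ : Empty => point, 1⟩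
  have : IsEmpty E.space.Pt := inferInstanceAs (IsEmpty (Σ _ : Empty, Unit))
  have hE : E.Var := Var.of_isEmpty E
  have hE0 : classOf E = 0 := classOf_of_isEmpty E
  obtain ⟨a, rfl⟩ := mkK_surjective a
  induction a using FreeAbelianGroup.induction_on with
  | zero => exact ⟨E, E, hE, hE, by simp⟩
  | of X =>
    have hX : X.1.Var := ⟨X.2⟩
    exact ⟨X.1, E, hX, hE, by rw [hE0, sub_zero, classOf_eq]; rfl⟩
  | neg X =>
    have hX : X.1.Var := ⟨X.2⟩
    exact ⟨E, X.1, hE, hX, by rw [hE0, zero_sub, classOf_eq, map_neg]; rfl⟩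
  | add x y hx hy =>
    obtain ⟨X, Y, hX, hY, h⟩ := hx
    obtain ⟨X', Y', hX', hY', h'⟩ := hy
    exact ⟨X.sum X', Y.sum Y', inferInstance, inferInstance, by
      rw [map_add, h, h', classOf_sum, classOf_sum]; abel⟩

end GSpace

namespace SSpace

/-! ### Constructions of 𝕊-varieties -/

/-- Being an `𝕊`-variety, as a type class. -/
class Var (X : SSpace) : Prop where
  out : X.IsVariety

instance (X : SSpace) [h : X.Var] (A : Type) [Finite A] : QP (X.obj A) := ⟨h.out.1 A⟩

instance (X : SSpace) [h : X.Var] (n : ℕ) : (X.level n).Var :=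
  ⟨h.out.1 (Fin n), fun _ => h.out.2 _ _ _⟩

theorem Var.of_qp {X : SSpace} (h : ∀ (A : Type) [Finite A], QP (X.obj A))
    (h' : ∀ (A B : Type) [Finite A] [Finite B] (e : A ≃ B),
      IsMorphism (X.obj A) (X.obj B) (X.map e)) : X.Var :=
  ⟨fun A _ => (h A).out, h'⟩

theorem isMorphism_map (X : SSpace) [h : X.Var] {A B : Type} [Finite A] [Finite B] (e : A ≃ B) :
    IsMorphism (X.obj A) (X.obj B) (X.map e) :=
  h.out.2 A B e

theorem map_symm_map (X : SSpace) {A B : Type} [Finite A] [Finite B] (e : A ≃ B)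
    (x : (X.obj A).Pt) : X.map e.symm (X.map e x) = x := by
  rw [← X.map_trans, Equiv.self_trans_symm, X.map_refl]

theorem map_map_symm (X : SSpace) {A B : Type} [Finite A] [Finite B] (e : A ≃ B)
    (x : (X.obj B).Pt) : X.map e (X.map e.symm x) = x :=
  X.map_symm_map e.symm x

theorem map_map_eq (X : SSpace) {A B B' C : Type} [Finite A] [Finite B] [Finite B'] [Finite C]
    {e : A ≃ B} {f : B ≃ C} {e' : A ≃ B'} {f' : B' ≃ C} (h : ∀ a, f (e a) = f' (e' a))
    (x : (X.obj A).Pt) : X.map f (X.map e x) = X.map f' (X.map e' x) := by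
  rw [← X.map_trans, ← X.map_trans]
  exact congrArg (fun e => X.map e x) (Equiv.ext h)

theorem isImm_map (X : SSpace) [h : X.Var] {A B : Type} [Finite A] [Finite B] (e : A ≃ B) :
    IsImm (X.obj A) (X.obj B) (X.map e) :=
  .of_leftInverse (X.isMorphism_map e) (X.isMorphism_map e.symm) (X.map_symm_map e)

theorem map_injective (X : SSpace) {A B : Type} [Finite A] [Finite B] (e : A ≃ B) :
    Function.Injective (X.map e) :=
  Function.LeftInverse.injective (X.map_symm_map e)

theorem map_surjective (X : SSpace) {A B : Type} [Finite A] [Finite B] (e : A ≃ B) :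
    Function.Surjective (X.map e) := fun x => ⟨X.map e.symm x, X.map_map_symm e x⟩

instance box_var (X Y : SSpace) [X.Var] [Y.Var] : (X.box Y).Var :=
  .of_qp (fun _ _ => inferInstanceAs (QP (RegSpace.sigma _))) fun A B _ _ e =>
    isMorphism_sigma fun c => isMorphism_sigmaMk (X := fun c : B → Bool =>
      RegSpace.prod (X.obj {a // c a = true}) (Y.obj {a // c a = false})) (c ∘ e.symm)
      (isMorphism_prod ((X.isMorphism_map (e.subtypeEquiv (p := fun a => c a = true)
          (q := fun b => (c ∘ e.symm) b = true) fun a => by simp)).comp (isMorphism_fst _ _))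
        ((Y.isMorphism_map (e.subtypeEquiv (p := fun a => c a = false)
          (q := fun b => (c ∘ e.symm) b = false) fun a => by simp)).comp (isMorphism_snd _ _)))

instance {A : Type} [Finite A] : Finite (Setoid A) :=
  Finite.of_injective (fun s : Setoid A => s.r) fun _ _ h =>
    Setoid.ext fun a b => iff_of_eq (congrFun (congrFun h a) b)

instance comp_var (X Y : SSpace) [X.Var] [Y.Var] : (X.comp Y).Var :=
  .of_qp (fun _ _ => inferInstanceAs (QP (RegSpace.sigma _))) fun _ B _ _ e =>
    isMorphism_sigma fun s => isMorphism_sigmaMk (X := fun s : Setoid B =>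
      RegSpace.prod (X.obj (Quotient s)) (RegSpace.pi fun q : Quotient s => Y.obj (Block s q)))
      (moveSetoid e s)
      (isMorphism_prod ((X.isMorphism_map (moveQuot e s)).comp (isMorphism_fst _ _))
        (isMorphism_pi fun q => (Y.isMorphism_map (moveBlock e s q)).comp
          ((isMorphism_apply (X := fun q : Quotient s => Y.obj (Block s q))
            ((moveQuot e s).symm q)).comp
            (isMorphism_snd _ _))))

/-- The disjoint union of a family of `𝕊`-spaces. -/
def sum {ι : Type} (Y : ι → SSpace) : SSpace where
  obj A _ := RegSpace.sigma fun i => (Y i).obj A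
  map e z := ⟨z.1, (Y z.1).map e z.2⟩
  map_refl _ _ z := Sigma.ext rfl (heq_of_eq ((Y z.1).map_refl _ z.2))
  map_trans e f z := Sigma.ext rfl (heq_of_eq ((Y z.1).map_trans e f z.2))

instance sum_var {ι : Type} [Finite ι] (Y : ι → SSpace) [∀ i, (Y i).Var] : (sum Y).Var :=
  .of_qp (fun _ _ => inferInstanceAs (QP (RegSpace.sigma _))) fun _ B _ _ e =>
    isMorphism_sigma fun i => isMorphism_sigmaMk (X := fun i => (Y i).obj B) i
      ((Y i).isMorphism_map e)

/-- The part of an `𝕊`-space in the degrees with the property `p`. -/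
def filter (X : SSpace) (p : ℕ → Prop) : SSpace where
  obj A _ := RegSpace.sigma fun _ : PLift (p (Nat.card A)) => X.obj A
  map e z := ⟨⟨Nat.card_congr e ▸ z.1.down⟩, X.map e z.2⟩
  map_refl A _ z := Sigma.ext rfl (heq_of_eq (X.map_refl A z.2))
  map_trans e f z := Sigma.ext rfl (heq_of_eq (X.map_trans e f z.2))

instance (P : Prop) : Finite (PLift P) := Finite.of_subsingleton

instance filter_var (X : SSpace) [X.Var] (p : ℕ → Prop) : (X.filter p).Var :=
  .of_qp (fun _ _ => inferInstanceAs (QP (RegSpace.sigma _))) fun _ B _ _ e =>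
    isMorphism_sigma fun h => isMorphism_sigmaMk (X := fun _ : PLift (p (Nat.card B)) => X.obj B)
      ⟨Nat.card_congr e ▸ h.down⟩ (X.isMorphism_map e)

/-- The constant functor. -/
def const (X : RegSpace) : SSpace where
  obj _ _ := X
  map _ := id
  map_refl _ _ _ := rfl
  map_trans _ _ _ := rfl

instance const_var (X : RegSpace) [QP X] : (const X).Var :=
  .of_qp (fun _ _ => inferInstanceAs (QP X)) fun _ _ _ _ _ => IsMorphism.id X

/-- The space `G` with its action of the symmetric group as an `𝕊`-space concentrated in degree
`m`.  A set with `m` elements is identified with `{0, …, m - 1}` by a chosen bijection. -/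
def single (m : ℕ) (G : GSpace (Equiv.Perm (Fin m))) : SSpace where
  obj A _ := RegSpace.sigma fun _ : PLift (Nat.card A = m) => G.space
  map e z := ⟨⟨Nat.card_congr e ▸ z.1.down⟩,
    G.act ((Finite.equivFinOfCardEq z.1.down).symm.trans
      (e.trans (Finite.equivFinOfCardEq (Nat.card_congr e ▸ z.1.down)))) z.2⟩
  map_refl _ _ z := Sigma.ext rfl (heq_of_eq (by
    rw [Equiv.refl_trans, Equiv.symm_trans_self]
    exact congrArg (fun σ : Equiv.Perm _ => σ z.2) (map_one G.act)))
  map_trans e f z := Sigma.ext rfl (heq_of_eq (by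
    dsimp only
    rw [← Equiv.Perm.mul_apply, ← map_mul]
    refine congrArg (fun σ => G.act σ z.2) (Equiv.ext fun i => ?_)
    simp))

instance single_var (m : ℕ) (G : GSpace (Equiv.Perm (Fin m))) [G.Var] : (single m G).Var :=
  .of_qp (fun _ _ => inferInstanceAs (QP (RegSpace.sigma _))) fun _ B _ _ e =>
    isMorphism_sigma fun h => isMorphism_sigmaMk (X := fun _ : PLift (Nat.card B = m) => G.space)
      ⟨Nat.card_congr e ▸ h.down⟩ (G.isIso_act ((Finite.equivFinOfCardEq h.down).symm.trans
        (e.trans (Finite.equivFinOfCardEq (Nat.card_congr e ▸ h.down))))).1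

/-- The `𝕊`-space with given values at the sets `{0, …, n - 1}`. -/
def ofLevels (G : ∀ n, GSpace (Equiv.Perm (Fin n))) : SSpace where
  obj A _ := RegSpace.sigma fun n : {n // Nat.card A = n} => (single n (G n)).obj A
  map e z := ⟨⟨z.1.1, Nat.card_congr e ▸ z.1.2⟩, (single z.1.1 (G z.1.1)).map e z.2⟩
  map_refl A _ z := Sigma.ext rfl (heq_of_eq ((single z.1.1 (G z.1.1)).map_refl A z.2))
  map_trans e f z := Sigma.ext rfl (heq_of_eq ((single z.1.1 (G z.1.1)).map_trans e f z.2))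

instance ofLevels_var (G : ∀ n, GSpace (Equiv.Perm (Fin n))) [∀ n, (G n).Var] :
    (ofLevels G).Var :=
  .of_qp (fun _ _ => inferInstanceAs (QP (RegSpace.sigma _))) fun _ B _ _ e =>
    isMorphism_sigma fun n => isMorphism_sigmaMk (X := fun n : {n // Nat.card B = n} =>
      (single n (G n)).obj B) ⟨n.1, Nat.card_congr e ▸ n.2⟩ ((single n.1 (G n.1)).isMorphism_map e)

/-! ### Natural maps of 𝕊-spaces -/

/-- A natural map between `𝕊`-spaces in the degrees up to `N`. -/
structure Hom (N : ℕ) (X Y : SSpace) where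
  /-- the map at `A` -/
  app (A : Type) [Finite A] (h : Nat.card A ≤ N) : (X.obj A).Pt → (Y.obj A).Pt
  nat {A B : Type} [Finite A] [Finite B] (hA : Nat.card A ≤ N) (hB : Nat.card B ≤ N) (e : A ≃ B)
    (x : (X.obj A).Pt) : app B hB (X.map e x) = Y.map e (app A hA x)

/-- A natural map that consists of immersions. -/
def Hom.Imm {N : ℕ} {X Y : SSpace} (f : Hom N X Y) : Prop :=
  ∀ (A : Type) [Finite A] (h : Nat.card A ≤ N), IsImm (X.obj A) (Y.obj A) (f.app A h)

/-- A natural map that consists of surjections. -/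
def Hom.Surj {N : ℕ} {X Y : SSpace} (f : Hom N X Y) : Prop :=
  ∀ (A : Type) [Finite A] (h : Nat.card A ≤ N), Function.Surjective (f.app A h)

/-- In the degrees up to `N`, the `𝕊`-space `Y` is isomorphic to a closed subspace of `X` and `U` is
isomorphic to its complement. -/
def IsCut (N : ℕ) (X Y U : SSpace) : Prop :=
  ∃ (i : Hom N Y X) (j : Hom N U X), i.Imm ∧ j.Imm ∧
    (∀ (A : Type) [Finite A] (h : Nat.card A ≤ N), IsClosed (Set.range (i.app A h))) ∧
    ∀ (A : Type) [Finite A] (h : Nat.card A ≤ N),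
      Set.range (j.app A h) = (Set.range (i.app A h))ᶜ

theorem card_fin_le {n N : ℕ} (h : n ≤ N) : Nat.card (Fin n) ≤ N := by rwa [Nat.card_fin]

theorem IsCut.cls_eq {N : ℕ} {X Y U : SSpace} [X.Var] [Y.Var] [U.Var] (h : IsCut N X Y U) {n : ℕ}
    (hn : n ≤ N) : cls X n = cls Y n + cls U n := by
  obtain ⟨i, j, hi, hj, hc, hr⟩ := h
  exact GSpace.classOf_cut (X := X.level n) (Y := Y.level n) (U := U.level n)
    (hi _ (card_fin_le hn)) (hj _ (card_fin_le hn)) (fun γ y => i.nat _ _ γ y)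
    (fun γ y => j.nat _ _ γ y) (hc _ _) (hr _ _)

theorem cls_eq_of_hom {n : ℕ} {X Y : SSpace} [X.Var] [Y.Var] (f : Hom n X Y) (hf : f.Imm)
    (hs : f.Surj) : cls Y n = cls X n := by
  have hn := card_fin_le (le_refl n)
  have hb : Function.Bijective (f.app (Fin n) hn) := ⟨(hf _ hn).inj, hs _ hn⟩
  exact GSpace.classOf_eq_of_isIso (X := Y.level n) (Y := X.level n)
    (Equiv.ofBijective (f.app (Fin n) hn) hb) (IsImm.isIso (hf _ hn)) fun γ y => f.nat _ _ γ y

/-- An isomorphism as a decomposition with empty complement. -/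
theorem IsCut.of_hom {N : ℕ} {X Y : SSpace} (f : Hom N Y X) (hf : f.Imm) (hs : f.Surj)
    (U : SSpace) (hU : ∀ (A : Type) [Finite A], Nat.card A ≤ N → IsEmpty (U.obj A).Pt) :
    IsCut N X Y U := by
  refine ⟨f, ⟨fun A _ h x => ((hU A h).false x).elim,
    fun {A} {_} _ _ hA _ _ x => ((hU A hA).false x).elim⟩,
    hf, fun A _ h => ?_, fun A _ h => ?_, fun A _ h => ?_⟩
  · have := hU A h
    exact IsImm.of_isEmpty _
  · rw [(hs A h).range_eq]
    exact isClosed_univ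
  · have := hU A h
    rw [(hs A h).range_eq, Set.compl_univ, Set.range_eq_empty]

theorem cls_eq_zero {n : ℕ} (X : SSpace) (h : IsEmpty (X.obj (Fin n)).Pt) : cls X n = 0 :=
  haveI : IsEmpty (X.level n).space.Pt := h
  GSpace.classOf_of_isEmpty (X.level n)

theorem isImm_sigma_snd (X : RegSpace) (P : Prop) :
    IsImm (RegSpace.sigma fun _ : PLift P => X) X fun z : Σ _ : PLift P, X.Pt => z.2 := by
  refine ⟨fun x y h => Sigma.ext (Subsingleton.elim _ _) (heq_of_eq h),
    isMorphism_sigma fun _ => IsMorphism.id X, fun Z _ χ hχ => isMorphism_of_local fun z => ?_⟩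
  exact ⟨Set.univ, isOpen_univ, trivial,
    ((isMorphism_mk (X := fun _ : PLift P => X) (χ z).1).comp (hχ.comp isMorphism_val)).congr
      fun y => Sigma.ext (Subsingleton.elim _ _) HEq.rfl⟩

/-- The inclusion of a part of an `𝕊`-space. -/
def filterHom (N : ℕ) (X : SSpace) (p : ℕ → Prop) : Hom N (X.filter p) X where
  app _ _ _ z := z.2
  nat _ _ _ _ := rfl

theorem filterHom_imm (N : ℕ) (X : SSpace) (p : ℕ → Prop) : (filterHom N X p).Imm :=
  fun _ _ _ => isImm_sigma_snd _ _

theorem filterHom_surj {N : ℕ} (X : SSpace) {p : ℕ → Prop} (hp : ∀ k ≤ N, p k) :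
    (filterHom N X p).Surj :=
  fun _ _ h x => ⟨⟨⟨hp _ h⟩, x⟩, rfl⟩

theorem isEmpty_filter {X : SSpace} {p : ℕ → Prop} {A : Type} [Finite A] (h : ¬ p (Nat.card A)) :
    IsEmpty ((X.filter p).obj A).Pt :=
  ⟨fun z : Σ _ : PLift (p (Nat.card A)), (X.obj A).Pt => h z.1.down⟩

theorem cls_filter_of_not {X : SSpace} {p : ℕ → Prop} {n : ℕ} (h : ¬ p n) :
    cls (X.filter p) n = 0 :=
  cls_eq_zero _ (isEmpty_filter (by rwa [Nat.card_fin]))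

/-- The degrees with the property `r` are divided into those with the properties `p` and `q`. -/
theorem isCut_filter (N : ℕ) (X : SSpace) [X.Var] {p q r : ℕ → Prop}
    (h : ∀ k ≤ N, (r k ↔ p k ∨ q k)) (h' : ∀ k ≤ N, ¬ (p k ∧ q k)) :
    IsCut N (X.filter r) (X.filter p) (X.filter q) := by
  have key : ∀ (p : ℕ → Prop), (∀ k ≤ N, p k → r k) → ∃ i : Hom N (X.filter p) (X.filter r),
      i.Imm ∧ ∀ (A : Type) [Finite A] (h : Nat.card A ≤ N),
        Set.range (i.app A h) = {_z | p (Nat.card A)} := by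
    intro p hp
    refine ⟨⟨fun A _ h z => ⟨⟨hp _ h z.1.down⟩, z.2⟩, fun _ _ _ _ => rfl⟩, fun A _ h => ?_,
      fun A _ h => ?_⟩
    · exact IsImm.of_comp (isImm_sigma_snd _ _).morph (isMorphism_sigma fun h' =>
        isMorphism_mk (X := fun _ : PLift (r (Nat.card A)) => X.obj A) ⟨hp _ h h'.down⟩)
        (isImm_sigma_snd _ _)
    · ext z
      exact ⟨by rintro ⟨y, rfl⟩; exact y.1.down, fun hz => ⟨⟨⟨hz⟩, z.2⟩, rfl⟩⟩
  obtain ⟨i, hi, hir⟩ := key p fun k hk hp => (h k hk).2 (Or.inl hp)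
  obtain ⟨j, hj, hjr⟩ := key q fun k hk hq => (h k hk).2 (Or.inr hq)
  refine ⟨i, j, hi, hj, fun A _ hA => ?_, fun A _ hA => ?_⟩
  · rw [hir]
    exact isClosed_const
  · rw [hir, hjr]
    ext z
    have hz : r (Nat.card A) := (z : Σ _ : PLift (r (Nat.card A)), (X.obj A).Pt).1.down
    have h1 := h _ hA
    have h2 := h' _ hA
    change q (Nat.card A) ↔ ¬ p (Nat.card A)
    tauto

theorem cls_filter {X : SSpace} [X.Var] {p : ℕ → Prop} {n : ℕ} (h : p n) :
    cls (X.filter p) n = cls X n := by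
  have h1 := (isCut_filter n X (p := p) (q := fun k => ¬ p k) (r := fun _ => True)
    (fun k _ => by tauto) fun k _ => by tauto).cls_eq le_rfl
  rw [cls_filter_of_not (p := fun k => ¬ p k) (fun h' => h' h), add_zero] at h1
  rw [← h1]
  exact (cls_eq_of_hom _ (filterHom_imm n X _) (filterHom_surj X fun _ _ => trivial)).symm

/-- The part of degree `m` of an `𝕊`-space is determined by its value at `{0, …, m - 1}`. -/
def singleLevelHom (N : ℕ) (X : SSpace) (m : ℕ) :
    Hom N (single m (X.level m)) (X.filter (· = m)) where
  app A _ _ z := ⟨z.1, X.map (Finite.equivFinOfCardEq z.1.down).symm z.2⟩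
  nat _ _ e z := Sigma.ext rfl (heq_of_eq (X.map_map_eq (fun i => by simp) z.2))

theorem singleLevelHom_imm (N : ℕ) (X : SSpace) [X.Var] (m : ℕ) : (singleLevelHom N X m).Imm :=
  fun A _ _ => IsImm.sigma (ι := PLift (Nat.card A = m)) (X := fun _ => X.obj (Fin m))
    (Y := fun _ => X.obj A) fun h => X.isImm_map (Finite.equivFinOfCardEq h.down).symm

theorem singleLevelHom_surj (N : ℕ) (X : SSpace) (m : ℕ) : (singleLevelHom N X m).Surj := by
  rintro A _ _ ⟨h, x⟩
  exact ⟨⟨h, X.map (Finite.equivFinOfCardEq h.down) x⟩,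
    Sigma.ext rfl (heq_of_eq (X.map_symm_map _ x))⟩

theorem cls_ofLevels (G : ∀ n, GSpace (Equiv.Perm (Fin n))) [∀ n, (G n).Var] (n : ℕ) :
    cls (ofLevels G) n = classOf (G n) := by
  have hn : Nat.card (Fin n) = n := Nat.card_fin n
  let σ : Equiv.Perm (Fin n) := Finite.equivFinOfCardEq hn
  let f : (G n).space.Pt → ((ofLevels G).obj (Fin n)).Pt :=
    fun x => ⟨⟨n, hn⟩, ⟨⟨hn⟩, (G n).act σ x⟩⟩
  have hf : IsImm (G n).space ((ofLevels G).obj (Fin n)) f :=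
    (IsImm.sigmaMk (X := fun k : {k // Nat.card (Fin n) = k} => (single k (G k)).obj (Fin n))
      ⟨n, hn⟩).comp ((IsImm.sigmaMk (X := fun _ : PLift (Nat.card (Fin n) = n) => (G n).space)
        ⟨hn⟩).comp ((G n).isIso_act σ).isImm)
  have hs : Function.Surjective f := by
    rintro ⟨⟨k, hk⟩, ⟨⟨h⟩, x⟩⟩
    obtain rfl : n = k := hn.symm.trans hk
    refine ⟨((G n).act σ).symm x, ?_⟩
    simp only [f, Equiv.apply_symm_apply]
    rfl
  refine GSpace.classOf_eq_of_isIso (X := (ofLevels G).level n) (Y := G n)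
    (Equiv.ofBijective f ⟨hf.inj, hs⟩) (IsImm.isIso hf) fun γ y => ?_
  change f _ = (ofLevels G).map γ (f y)
  refine Sigma.ext rfl (heq_of_eq (Sigma.ext rfl (heq_of_eq ?_)))
  change (G n).act σ ((G n).act γ y) = (G n).act _ ((G n).act σ y)
  rw [← Equiv.Perm.mul_apply, ← Equiv.Perm.mul_apply, ← map_mul, ← map_mul]
  refine congrArg (fun τ => (G n).act τ y) (Equiv.ext fun i => ?_)
  simp [σ]

/-! ### Homomorphisms defined by their values on classes -/

theorem exists_cls_sub (a : KS) : ∃ X Y : SSpace, X.Var ∧ Y.Var ∧ a = cls X - cls Y := by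
  choose G G' hG hG' h using fun n => GSpace.exists_classOf_sub (a n)
  exact ⟨ofLevels G, ofLevels G', inferInstance, inferInstance, funext fun n => by
    rw [Pi.sub_apply, cls_ofLevels, cls_ofLevels, h n]⟩

/-- Classes generate the Grothendieck group. -/
theorem hom_ext {H : Type*} [AddCommGroup H] {θ θ' : KS →+ H}
    (h : ∀ X : SSpace, X.Var → θ (cls X) = θ' (cls X)) : θ = θ' := by
  ext a
  obtain ⟨X, Y, hX, hY, rfl⟩ := exists_cls_sub a
  rw [map_sub, map_sub, h X hX, h Y hY]

/-- Functions of `𝕊`-varieties that are additive for closed subvarieties in the degrees up to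
`N`. -/
def IsAdditive {H : Type*} [AddCommGroup H] (N : ℕ) (Ψ : SSpace → H) : Prop :=
  ∀ X Y U : SSpace, X.Var → Y.Var → U.Var → IsCut N X Y U → Ψ X = Ψ Y + Ψ U

theorem IsAdditive.eq_zero {H : Type*} [AddCommGroup H] {N : ℕ} {Ψ : SSpace → H}
    (hΨ : IsAdditive N Ψ) (X : SSpace) [hX : X.Var]
    (h : ∀ (A : Type) [Finite A], Nat.card A ≤ N → IsEmpty (X.obj A).Pt) : Ψ X = 0 := by
  have := hΨ X X X hX hX hX (.of_hom ⟨fun _ _ _ => id, fun _ _ _ _ => rfl⟩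
    (fun _ _ _ => .id _) (fun _ _ _ => Function.surjective_id) X h)
  exact left_eq_add.1 this

theorem IsAdditive.eq_of_hom {H : Type*} [AddCommGroup H] {N : ℕ} {Ψ : SSpace → H}
    (hΨ : IsAdditive N Ψ) {X Y : SSpace} [hX : X.Var] [hY : Y.Var] (f : Hom N Y X) (hf : f.Imm)
    (hs : f.Surj) : Ψ X = Ψ Y := by
  have hE : ∀ (A : Type) [Finite A], Nat.card A ≤ N →
      IsEmpty ((X.filter fun _ => False).obj A).Pt := fun _ _ _ => isEmpty_filter id
  rw [hΨ X Y _ hX hY (filter_var X _) (.of_hom f hf hs _ hE), hΨ.eq_zero _ hE, add_zero]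

/-- Restriction of an immersion of spaces with group action to `𝕊`-spaces in a single degree. -/
def singleHom (N m : ℕ) {G G' : GSpace (Equiv.Perm (Fin m))} (φ : G'.space.Pt → G.space.Pt)
    (hφ : ∀ γ x, φ (G'.act γ x) = G.act γ (φ x)) : Hom N (single m G') (single m G) where
  app _ _ _ z := ⟨z.1, φ z.2⟩
  nat _ _ _ z := Sigma.ext rfl (heq_of_eq (hφ _ z.2))

theorem singleHom_imm {N m : ℕ} {G G' : GSpace (Equiv.Perm (Fin m))} {φ : G'.space.Pt → G.space.Pt}
    {hφ : ∀ γ x, φ (G'.act γ x) = G.act γ (φ x)} (h : IsImm G'.space G.space φ) :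
    (singleHom N m φ hφ).Imm :=
  fun _ _ _ => IsImm.sigma fun _ => h

theorem range_singleHom {N m : ℕ} {G G' : GSpace (Equiv.Perm (Fin m))}
    {φ : G'.space.Pt → G.space.Pt} {hφ : ∀ γ x, φ (G'.act γ x) = G.act γ (φ x)} (A : Type)
    [Finite A] (h : Nat.card A ≤ N) :
    Set.range ((singleHom N m φ hφ).app A h) =
      {z : Σ _ : PLift (Nat.card A = m), G.space.Pt | z.2 ∈ Set.range φ} :=
  range_sigmaMap (X := fun _ : PLift (Nat.card A = m) => G'.space)
    (Y := fun _ : PLift (Nat.card A = m) => G.space) fun _ => φ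

/-- An additive function of `𝕊`-varieties comes from a homomorphism on the Grothendieck group. -/
theorem IsAdditive.exists_hom {H : Type*} [AddCommGroup H] {N : ℕ} {Ψ : SSpace → H}
    (hΨ : IsAdditive N Ψ) : ∃ θ : KS →+ H, (∀ X : SSpace, X.Var → θ (cls X) = Ψ X) ∧
      ∀ a : KS, (∀ m ≤ N, a m = 0) → θ a = 0 := by
  have hker : ∀ m, AddSubgroup.closure {r | KRel (Equiv.Perm (Fin m)) r} ≤
      (FreeAbelianGroup.lift fun G : GVar (Equiv.Perm (Fin m)) => Ψ (single m G.1)).ker := by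
    intro m
    rw [AddSubgroup.closure_le]
    rintro r (⟨G, G', e, he, hact⟩ | ⟨G, G', G'', Z, hc, -, i, hi, j, hj⟩)
    · have : G.1.Var := ⟨G.2⟩
      have : G'.1.Var := ⟨G'.2⟩
      change FreeAbelianGroup.lift _ _ = 0
      rw [map_sub, FreeAbelianGroup.lift_apply_of, FreeAbelianGroup.lift_apply_of, sub_eq_zero]
      refine hΨ.eq_of_hom (singleHom N m e hact) (singleHom_imm he.isImm) fun A _ _ z => ?_
      exact ⟨⟨z.1, e.symm z.2⟩, Sigma.ext rfl (heq_of_eq (e.apply_symm_apply _))⟩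
    · have h1 : G.1.Var := ⟨G.2⟩
      have h2 : G'.1.Var := ⟨G'.2⟩
      have h3 : G''.1.Var := ⟨G''.2⟩
      change FreeAbelianGroup.lift _ _ = 0
      rw [map_sub, map_add, FreeAbelianGroup.lift_apply_of, FreeAbelianGroup.lift_apply_of,
        FreeAbelianGroup.lift_apply_of, sub_eq_zero, add_comm]
      have hri : Set.range (fun y => (i y : G.1.space.Pt)) = Z :=
        (i.surjective.range_comp Subtype.val).trans Subtype.range_val
      have hrj : Set.range (fun y => (j y : G.1.space.Pt)) = Zᶜ :=
        (j.surjective.range_comp Subtype.val).trans Subtype.range_val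
      refine hΨ _ _ _ inferInstance inferInstance inferInstance
        ⟨singleHom N m (fun y => (i y : G.1.space.Pt)) hi.2,
          singleHom N m (fun y => (j y : G.1.space.Pt)) hj.2,
          singleHom_imm ((IsImm.val _).comp hi.1.isImm),
          singleHom_imm ((IsImm.val _).comp hj.1.isImm), fun A _ h => ?_, fun A _ h => ?_⟩
      · rw [range_singleHom, hri]
        exact isClosed_sigma.2 fun _ => hc
      · rw [range_singleHom, range_singleHom, hri, hrj]
        rfl
  let θ : ∀ m, K (Equiv.Perm (Fin m)) →+ H := fun m => QuotientAddGroup.lift _ _ (hker m)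
  refine ⟨∑ m ∈ Finset.range (N + 1), (θ m).comp (Pi.evalAddMonoidHom _ m), fun X hX => ?_,
    fun a ha => ?_⟩
  · have hθ : ∀ m, θ m (cls X m) = Ψ (single m (X.level m)) := fun m => by
      change θ m (classOf (X.level m)) = _
      rw [GSpace.classOf_eq]
      exact (QuotientAddGroup.lift_mk _ (hker m) _).trans (FreeAbelianGroup.lift_apply_of _ _)
    have key : ∀ M ≤ N + 1, ∑ m ∈ Finset.range M, Ψ (single m (X.level m)) =
        Ψ (X.filter (· < M)) := by
      intro M hM
      induction M with
      | zero =>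
        rw [Finset.range_zero, Finset.sum_empty]
        exact (hΨ.eq_zero _ fun A _ _ => isEmpty_filter (Nat.not_lt_zero _)).symm
      | succ M ih =>
        rw [Finset.sum_range_succ, ih (by omega), hΨ (X.filter (· < M + 1)) (X.filter (· < M))
          (X.filter (· = M)) inferInstance inferInstance inferInstance
          (isCut_filter N X (fun k _ => by omega) fun k _ => by omega),
          hΨ.eq_of_hom (singleLevelHom N X M) (singleLevelHom_imm N X M)
            (singleLevelHom_surj N X M)]
    rw [AddMonoidHom.finsetSum_apply]
    simp only [AddMonoidHom.comp_apply, Pi.evalAddMonoidHom_apply, hθ]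
    rw [key (N + 1) le_rfl]
    exact (hΨ.eq_of_hom (filterHom N X _) (filterHom_imm N X _)
      (filterHom_surj X fun k hk => Nat.lt_succ_of_le hk)).symm
  · rw [AddMonoidHom.finsetSum_apply]
    refine Finset.sum_eq_zero fun m hm => ?_
    rw [AddMonoidHom.comp_apply, Pi.evalAddMonoidHom_apply,
      ha m (Nat.lt_succ_iff.1 (Finset.mem_range.1 hm)), map_zero]

/-! ### Functoriality of the product and the composition -/

/-- The identity. -/
def idHom (N : ℕ) (X : SSpace) : Hom N X X := ⟨fun _ _ _ => id, fun _ _ _ _ => rfl⟩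

theorem idHom_imm (N : ℕ) (X : SSpace) : (idHom N X).Imm := fun _ _ _ => .id _

theorem idHom_surj (N : ℕ) (X : SSpace) : (idHom N X).Surj := fun _ _ _ => Function.surjective_id

theorem card_subtype_le' {A : Type} [Finite A] {N : ℕ} (h : Nat.card A ≤ N) (p : A → Prop) :
    Nat.card {a // p a} ≤ N :=
  (Nat.card_le_card_of_injective _ Subtype.val_injective).trans h

theorem card_quotient_le {A : Type} [Finite A] {N : ℕ} (h : Nat.card A ≤ N) (s : Setoid A) :
    Nat.card (Quotient s) ≤ N :=
  (Nat.card_le_card_of_surjective _ Quotient.mk_surjective).trans h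

/-- Natural maps between the factors induce a natural map between the products. -/
def boxHom {N : ℕ} {X X' Y Y' : SSpace} (f : Hom N X X') (g : Hom N Y Y') :
    Hom N (X.box Y) (X'.box Y') where
  app _ _ h z := ⟨z.1, f.app _ (card_subtype_le' h _) z.2.1, g.app _ (card_subtype_le' h _) z.2.2⟩
  nat _ _ _ _ := Sigma.ext rfl (heq_of_eq (Prod.ext (f.nat _ _ _ _) (g.nat _ _ _ _)))

theorem boxHom_imm {N : ℕ} {X X' Y Y' : SSpace} [X.Var] [X'.Var] [Y.Var] [Y'.Var] {f : Hom N X X'}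
    {g : Hom N Y Y'} (hf : f.Imm) (hg : g.Imm) : (boxHom f g).Imm := fun A _ h =>
  IsImm.sigma
    (X := fun c : A → Bool => RegSpace.prod (X.obj {a // c a = true}) (Y.obj {a // c a = false}))
    (Y := fun c : A → Bool => RegSpace.prod (X'.obj {a // c a = true}) (Y'.obj {a // c a = false}))
    fun c => (hf {a // c a = true} (card_subtype_le' h _)).prod
      (hg {a // c a = false} (card_subtype_le' h _))

theorem range_boxHom {N : ℕ} {X X' Y Y' : SSpace} (f : Hom N X X') (g : Hom N Y Y') (A : Type)
    [Finite A] (h : Nat.card A ≤ N) : Set.range ((boxHom f g).app A h) =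
      {z : Σ c : A → Bool, (X'.obj {a // c a = true}).Pt × (Y'.obj {a // c a = false}).Pt |
        z.2.1 ∈ Set.range (f.app {a // z.1 a = true} (card_subtype_le' h _)) ∧
          z.2.2 ∈ Set.range (g.app {a // z.1 a = false} (card_subtype_le' h _))} := by
  ext ⟨c, x, y⟩
  constructor
  · rintro ⟨⟨c', x', y'⟩, hz⟩
    obtain rfl : c' = c := congrArg Sigma.fst hz
    have := eq_of_heq (Sigma.mk.inj hz).2
    exact ⟨⟨x', congrArg Prod.fst this⟩, ⟨y', congrArg Prod.snd this⟩⟩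
  · rintro ⟨⟨x', hx⟩, ⟨y', hy⟩⟩
    exact ⟨⟨c, x', y'⟩, Sigma.ext rfl (heq_of_eq (Prod.ext hx hy))⟩

theorem isClosed_box {X Y : SSpace} [X.Var] [Y.Var] {A : Type} [Finite A]
    {S : ∀ c : A → Bool, Set (X.obj {a // c a = true}).Pt} (hS : ∀ c, IsClosed (S c))
    {T : ∀ c : A → Bool, Set (Y.obj {a // c a = false}).Pt} (hT : ∀ c, IsClosed (T c)) :
    @IsClosed _ ((X.box Y).obj A).top
      {z : Σ c : A → Bool, (X.obj {a // c a = true}).Pt × (Y.obj {a // c a = false}).Pt |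
        z.2.1 ∈ S z.1 ∧ z.2.2 ∈ T z.1} :=
  isClosed_sigma.2 fun c => ((hS c).preimage (isMorphism_fst _ _).1).inter
    ((hT c).preimage (isMorphism_snd _ _).1)

theorem IsCut.box_right {N : ℕ} {X Y U : SSpace} [X.Var] [Y.Var] [U.Var] (h : IsCut N X Y U)
    (Z : SSpace) [Z.Var] : IsCut N (X.box Z) (Y.box Z) (U.box Z) := by
  obtain ⟨i, j, hi, hj, hc, hr⟩ := h
  refine ⟨boxHom i (idHom N Z), boxHom j (idHom N Z), boxHom_imm hi (idHom_imm N Z),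
    boxHom_imm hj (idHom_imm N Z), fun A _ h => ?_, fun A _ h => ?_⟩
  · rw [range_boxHom]
    refine isClosed_box (X := X) (Y := Z) (T := fun c : A → Bool =>
      Set.range ((idHom N Z).app {a // c a = false} (card_subtype_le' h _)))
      (fun c => hc _ (card_subtype_le' h _)) fun c => ?_
    rw [((idHom_surj N Z) _ _).range_eq]
    exact isClosed_univ
  · rw [range_boxHom, range_boxHom]
    ext z
    have h1 := (idHom_surj N Z) {a // z.1 a = false} (card_subtype_le' h _) z.2.2
    have h2 := Set.ext_iff.1 (hr {a // z.1 a = true} (card_subtype_le' h _)) z.2.1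
    change _ ∧ _ ↔ ¬ (_ ∧ _)
    rw [h2]
    change ¬ _ ∧ _ ↔ _
    tauto

theorem IsCut.box_left {N : ℕ} {X Y U : SSpace} [X.Var] [Y.Var] [U.Var] (h : IsCut N X Y U)
    (Z : SSpace) [Z.Var] : IsCut N (Z.box X) (Z.box Y) (Z.box U) := by
  obtain ⟨i, j, hi, hj, hc, hr⟩ := h
  refine ⟨boxHom (idHom N Z) i, boxHom (idHom N Z) j, boxHom_imm (idHom_imm N Z) hi,
    boxHom_imm (idHom_imm N Z) hj, fun A _ h => ?_, fun A _ h => ?_⟩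
  · rw [range_boxHom]
    refine isClosed_box (X := Z) (Y := X) (S := fun c : A → Bool =>
      Set.range ((idHom N Z).app {a // c a = true} (card_subtype_le' h _)))
      (fun c => ?_) fun c => hc _ (card_subtype_le' h _)
    rw [((idHom_surj N Z) _ _).range_eq]
    exact isClosed_univ
  · rw [range_boxHom, range_boxHom]
    ext z
    have h1 := (idHom_surj N Z) {a // z.1 a = true} (card_subtype_le' h _) z.2.1
    have h2 := Set.ext_iff.1 (hr {a // z.1 a = false} (card_subtype_le' h _)) z.2.2
    change _ ∧ _ ↔ ¬ (_ ∧ _)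
    rw [h2]
    change _ ∧ ¬ _ ↔ _
    tauto

/-- Natural maps between the factors induce a natural map between the compositions. -/
def compHom {N : ℕ} {X X' Y Y' : SSpace} (f : Hom N X X') (g : Hom N Y Y') :
    Hom N (X.comp Y) (X'.comp Y') where
  app _ _ h z := ⟨z.1, f.app _ (card_quotient_le h _) z.2.1,
    fun q => g.app _ (card_subtype_le' h _) (z.2.2 q)⟩
  nat _ _ _ _ := Sigma.ext rfl (heq_of_eq (Prod.ext (f.nat _ _ _ _)
    (funext fun _ => g.nat _ _ _ _)))

/-- The component of the composition that belongs to a partition. -/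
abbrev compPart (X Y : SSpace) {A : Type} [Finite A] (s : Setoid A) : RegSpace :=
  RegSpace.prod (X.obj (Quotient s)) (RegSpace.pi fun q : Quotient s => Y.obj (Block s q))

/-- The points of the composition. -/
abbrev compPt (X Y : SSpace) (A : Type) [Finite A] : Type :=
  Σ s : Setoid A, (X.obj (Quotient s)).Pt × ∀ q : Quotient s, (Y.obj (Block s q)).Pt

theorem isImm_compPart (X Y : SSpace) {A : Type} [Finite A] (s : Setoid A) :
    IsImm (compPart X Y s) ((X.comp Y).obj A)
      (Sigma.mk (β := fun s : Setoid A => (compPart X Y s).Pt) s) :=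
  IsImm.sigmaMk (X := fun s : Setoid A => compPart X Y s) s

theorem compHom_imm {N : ℕ} {X X' Y Y' : SSpace} [X.Var] [X'.Var] [Y.Var] [Y'.Var]
    {f : Hom N X X'} {g : Hom N Y Y'} (hf : f.Imm) (hg : g.Imm) : (compHom f g).Imm :=
  fun A _ h => IsImm.sigma (X := fun s : Setoid A => compPart X Y s)
    (Y := fun s : Setoid A => compPart X' Y' s) fun s =>
      (hf (Quotient s) (card_quotient_le h _)).prod
        (IsImm.pi fun q => hg (Block s q) (card_subtype_le' h _))

theorem range_compHom {N : ℕ} {X X' Y Y' : SSpace} (f : Hom N X X') (g : Hom N Y Y') (A : Type)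
    [Finite A] (h : Nat.card A ≤ N) : Set.range ((compHom f g).app A h) =
      {z : compPt X' Y' A | z.2.1 ∈ Set.range (f.app (Quotient z.1) (card_quotient_le h _)) ∧
        ∀ q, z.2.2 q ∈ Set.range (g.app (Block z.1 q) (card_subtype_le' h _))} := by
  ext ⟨s, x, y⟩
  constructor
  · rintro ⟨⟨s', x', y'⟩, hz⟩
    obtain rfl : s' = s := congrArg Sigma.fst hz
    have := eq_of_heq (Sigma.mk.inj hz).2
    exact ⟨⟨x', congrArg Prod.fst this⟩, fun q => ⟨y' q, congrFun (congrArg Prod.snd this) q⟩⟩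
  · rintro ⟨⟨x', hx⟩, hy⟩
    choose y' hy using hy
    exact ⟨⟨s, x', y'⟩, Sigma.ext rfl (heq_of_eq (Prod.ext hx (funext hy)))⟩

theorem IsCut.comp_right {N : ℕ} {X Y U : SSpace} [X.Var] [Y.Var] [U.Var] (h : IsCut N X Y U)
    (Z : SSpace) [Z.Var] : IsCut N (X.comp Z) (Y.comp Z) (U.comp Z) := by
  obtain ⟨i, j, hi, hj, hc, hr⟩ := h
  have hZ : ∀ (A : Type) [Finite A] (h : Nat.card A ≤ N) (z : compPt X Z A) (q : Quotient z.1),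
      z.2.2 q ∈ Set.range ((idHom N Z).app (Block z.1 q) (card_subtype_le' h _)) :=
    fun A _ h z q => ⟨_, rfl⟩
  refine ⟨compHom i (idHom N Z), compHom j (idHom N Z), compHom_imm hi (idHom_imm N Z),
    compHom_imm hj (idHom_imm N Z), fun A _ h => ?_, fun A _ h => ?_⟩
  · have : Set.range ((compHom i (idHom N Z)).app A h) =
        {z : compPt X Z A | z.2.1 ∈ Set.range (i.app (Quotient z.1) (card_quotient_le h _))} := by
      rw [range_compHom]
      ext z
      exact and_iff_left (hZ A h z)
    rw [this]
    exact isClosed_sigma (X := fun s : Setoid A => compPart X Z s).2 fun s =>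
      (hc (Quotient s) (card_quotient_le h _)).preimage (isMorphism_fst (X.obj (Quotient s))
        (RegSpace.pi fun q : Quotient s => Z.obj (Block s q))).1
  · rw [range_compHom, range_compHom]
    ext z
    have h1 := hZ A h z
    have h2 := Set.ext_iff.1 (hr (Quotient z.1) (card_quotient_le h _)) z.2.1
    change _ ∧ _ ↔ ¬ (_ ∧ _)
    rw [h2]
    change ¬ _ ∧ _ ↔ _
    tauto

/-! ### Decompositions in the second argument of the composition -/

/-- The disjoint union of two `𝕊`-spaces. -/
def add (Y U : SSpace) : SSpace := sum fun b : Bool => cond b Y U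

instance cond_var (Y U : SSpace) [hY : Y.Var] [hU : U.Var] (b : Bool) : (cond b Y U).Var := by
  cases b <;> assumption

instance add_var (Y U : SSpace) [Y.Var] [U.Var] : (add Y U).Var :=
  inferInstanceAs (sum fun b : Bool => cond b Y U).Var

theorem Hom.map_mem_range {N : ℕ} {X Y : SSpace} (i : Hom N Y X) {A B : Type} [Finite A] [Finite B]
    (hA : Nat.card A ≤ N) (hB : Nat.card B ≤ N) (e : A ≃ B) (x : (X.obj A).Pt) :
    X.map e x ∈ Set.range (i.app B hB) ↔ x ∈ Set.range (i.app A hA) := by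
  constructor
  · rintro ⟨y, hy⟩
    refine ⟨Y.map e.symm y, ?_⟩
    rw [i.nat hB hA, hy, X.map_symm_map]
  · rintro ⟨y, rfl⟩
    exact ⟨Y.map e y, i.nat hA hB e y⟩

/-- The two parts of a decomposition as maps indexed by the Booleans. -/
def cutHom {N : ℕ} {X Y U : SSpace} (i : Hom N Y X) (j : Hom N U X) (b : Bool) :
    Hom N (cond b Y U) X :=
  match b with
  | true => i
  | false => j

/-- The map from the disjoint union of the two parts of a decomposition. -/
def addHom {N : ℕ} {X Y U : SSpace} (i : Hom N Y X) (j : Hom N U X) : Hom N (add Y U) X where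
  app A _ h z := (cutHom i j z.1).app A h z.2
  nat hA hB e z := (cutHom i j z.1).nat hA hB e z.2

/-- Cutting `X` into a closed part and its complement does not change the class of `W ∘ X`: the
obvious bijection is an isomorphism on each of the strata given by the number of blocks the point
of which lies in the closed part. -/
theorem IsCut.cls_comp {n : ℕ} {X Y U : SSpace} [X.Var] [Y.Var] [U.Var] (h : IsCut n X Y U)
    (W : SSpace) [W.Var] : cls (W.comp X) n = cls (W.comp (add Y U)) n := by
  obtain ⟨i, j, hi, hj, hc, hr⟩ := h
  have hn : Nat.card (Fin n) ≤ n := card_fin_le le_rfl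
  have hB : ∀ (s : Setoid (Fin n)) (q : Quotient s), Nat.card (Block s q) ≤ n :=
    fun s q => card_subtype_le' hn _
  have hg : ∀ b, (cutHom i j b).Imm := by rintro (_ | _); exacts [hj, hi]
  let g := addHom i j
  have hgb : ∀ (A : Type) [Finite A] (h : Nat.card A ≤ n), Function.Bijective (g.app A h) := by
    intro A _ h
    have hr' := Set.ext_iff.1 (hr A h)
    constructor
    · rintro ⟨b, x⟩ ⟨b', x'⟩ hx
      change (cutHom i j b).app A h x = (cutHom i j b').app A h x' at hx
      rcases b with _ | _ <;> rcases b' with _ | _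
      · exact Sigma.ext rfl (heq_of_eq ((hj A h).inj hx))
      · exact ((hr' _).1 ⟨x, rfl⟩ ⟨x', hx.symm⟩).elim
      · exact ((hr' _).1 ⟨x', rfl⟩ ⟨x, hx⟩).elim
      · exact Sigma.ext rfl (heq_of_eq ((hi A h).inj hx))
    · intro x
      by_cases hx : x ∈ Set.range (i.app A h)
      · obtain ⟨y, rfl⟩ := hx
        exact ⟨⟨true, y⟩, rfl⟩
      · obtain ⟨y, rfl⟩ := (hr' x).2 hx
        exact ⟨⟨false, y⟩, rfl⟩
  let F : compPt W (add Y U) (Fin n) → compPt W X (Fin n) := (compHom (idHom n W) g).app (Fin n) hn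
  have hFb : Function.Bijective F := by
    constructor
    · rintro ⟨s, w, x⟩ ⟨s', w', x'⟩ h
      obtain rfl : s = s' := congrArg Sigma.fst h
      have := eq_of_heq (Sigma.mk.inj h).2
      have h1 : w = w' := congrArg Prod.fst this
      have h2 : x = x' := funext fun q =>
        (hgb (Block s q) (hB s q)).1 (congrFun (congrArg Prod.snd this) q)
      rw [h1, h2]
    · rintro ⟨s, w, x⟩
      choose y hy using fun q => (hgb (Block s q) (hB s q)).2 (x q)
      exact ⟨⟨s, w, y⟩, Sigma.ext rfl (heq_of_eq (Prod.ext rfl (funext hy)))⟩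
  let f : compPt W X (Fin n) → ℕ := fun z =>
    Nat.card {q : Quotient z.1 // z.2.2 q ∈ Set.range (i.app (Block z.1 q) (hB z.1 q))}
  let κ := Σ s : Setoid (Fin n), Quotient s → Bool
  let D : κ → RegSpace := fun k => RegSpace.prod (W.obj (Quotient k.1))
    (RegSpace.pi fun q : Quotient k.1 => (cond (k.2 q) Y U).obj (Block k.1 q))
  let J : ∀ k, (D k).Pt → compPt W (add Y U) (Fin n) :=
    fun k d => ⟨k.1, d.1, fun q => ⟨k.2 q, d.2 q⟩⟩
  have hJr : ∀ z, ∃ k, z ∈ Set.range (J k) := by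
    rintro ⟨s, w, x⟩
    exact ⟨⟨s, fun q => (x q).1⟩, ⟨w, fun q => (x q).2⟩, rfl⟩
  refine GSpace.classOf_eq_of_strata (X := (W.comp X).level n) (X' := (W.comp (add Y U)).level n)
    (Equiv.ofBijective F hFb) ?_ (fun γ x => (compHom (idHom n W) g).nat hn hn γ x) f ?_ ?_ (n + 1)
    ?_ D (fun k => Nat.card {q // k.2 q = true}) J ?_ ?_
    (fun k => Sigma.mk (β := fun s : Setoid (Fin n) => (compPart W X s).Pt) k.1 ''
      {p | ∀ q, k.2 q = false → p.2 q ∉ Set.range (i.app (Block k.1 q) (hB k.1 q))}) ?_ ?_ hJr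
  · refine isMorphism_sigma fun s => isMorphism_sigmaMk (X := fun s : Setoid (Fin n) =>
      compPart W X s) s (isMorphism_prod (isMorphism_fst _ _) (isMorphism_pi fun q => ?_))
    have hgq : IsMorphism ((add Y U).obj (Block s q)) (X.obj (Block s q))
        (g.app (Block s q) (hB s q)) :=
      isMorphism_sigma fun b => (hg b (Block s q) (hB s q)).morph
    exact hgq.comp ((isMorphism_apply (X := fun q : Quotient s => (add Y U).obj (Block s q)) q).comp
      (isMorphism_snd (W.obj (Quotient s)) _))
  · rintro γ ⟨s, w, x⟩
    refine (Nat.card_congr ((moveQuot γ s).symm.subtypeEquiv fun q => ?_))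
    exact i.map_mem_range (hB s _) (hB (moveSetoid γ s) _) (moveBlock γ s q) _
  · intro k
    refine isClosed_sigma (X := fun s : Setoid (Fin n) => compPart W X s).2 fun s => ?_
    exact GSpace.isClosed_le_card (P := (compPart W X s).Pt)
      (fun (q : Quotient s) => {p | p.2 q ∈ Set.range (i.app (Block s q) (hB s q))})
      (fun q => (hc (Block s q) (hB s q)).preimage
        ((isMorphism_apply (X := fun q : Quotient s => X.obj (Block s q)) q).comp
          (isMorphism_snd (W.obj (Quotient s)) _)).1) k
  · rintro ⟨s, w, x⟩
    exact Nat.lt_succ_of_le ((card_subtype_le' le_rfl _).trans (card_quotient_le hn s))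
  · rintro ⟨s, l⟩
    exact (isImm_compPart W (add Y U) s).comp ((IsImm.id (W.obj (Quotient s))).prod
      (IsImm.pi fun q => IsImm.sigmaMk (X := fun b => (cond b Y U).obj (Block s q)) (l q)))
  · rintro ⟨s, l⟩
    exact (isImm_compPart W X s).comp ((IsImm.id (W.obj (Quotient s))).prod
      (IsImm.pi fun q => hg (l q) (Block s q) (hB s q)))
  · rintro ⟨s, l⟩
    refine isOpenMap_sigmaMk (σ := fun s : Setoid (Fin n) => (compPart W X s).Pt) _ ?_
    have : {p : (compPart W X s).Pt | ∀ q, l q = false →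
        p.2 q ∉ Set.range (i.app (Block s q) (hB s q))} =
        ⋂ q, ⋂ _ : l q = false, {p | p.2 q ∈ Set.range (i.app (Block s q) (hB s q))}ᶜ := by
      ext p
      simp only [Set.mem_iInter]
      rfl
    rw [this]
    refine isOpen_iInter_of_finite fun q => isOpen_iInter_of_finite fun _ => isOpen_compl_iff.2 ?_
    exact (hc (Block s q) (hB s q)).preimage
        ((isMorphism_apply (X := fun q : Quotient s => X.obj (Block s q)) q).comp
          (isMorphism_snd (W.obj (Quotient s)) _)).1
  · rintro ⟨s, l⟩
    have hval : ∀ b (A : Type) [Finite A] (h : Nat.card A ≤ n) (y : ((cond b Y U).obj A).Pt),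
        ((cutHom i j b).app A h y ∈ Set.range (i.app A h) ↔ b = true) := by
      rintro (_ | _) A _ h y
      · exact iff_of_false ((Set.ext_iff.1 (hr A h) _).1 ⟨y, rfl⟩) (by simp)
      · exact iff_of_true ⟨y, rfl⟩ rfl
    ext z
    constructor
    · rintro ⟨⟨w, y⟩, rfl⟩
      refine ⟨⟨⟨w, fun q => (cutHom i j (l q)).app (Block s q) (hB s q) (y q)⟩, fun q hq h => ?_,
        rfl⟩, ?_⟩
      · exact Bool.false_ne_true (hq.symm.trans ((hval (l q) _ _ (y q)).1 h))
      · exact Nat.card_congr (Equiv.subtypeEquivRight fun q =>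
          hval (l q) (Block s q) (hB s q) (y q))
    · rintro ⟨⟨⟨w, x⟩, hx, rfl⟩, hl⟩
      have hsub : {q | x q ∈ Set.range (i.app (Block s q) (hB s q))} = {q | l q = true} := by
        refine Set.eq_of_subset_of_ncard_le (fun q hq => ?_) (le_of_eq hl.symm)
        by_contra hlq
        exact hx q (by simpa using hlq) hq
      have : ∀ q, ∃ y, (cutHom i j (l q)).app (Block s q) (hB s q) y = x q := by
        intro q
        have hq : x q ∈ Set.range (i.app (Block s q) (hB s q)) ↔ l q = true :=
          Set.ext_iff.1 hsub q
        rcases hl' : l q with _ | _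
        · rw [hl'] at hq
          exact (Set.ext_iff.1 (hr (Block s q) (hB s q)) _).2 fun h => by cases hq.1 h
        · exact hq.2 hl'
      choose y hy using this
      exact ⟨⟨w, y⟩, Sigma.ext rfl (heq_of_eq (Prod.ext rfl (funext hy)))⟩

end SSpace

/-! ### Polynomiality of the composition in its second argument -/

namespace GSpace

/-- A variety is the sum of the fibres of an invariant locally constant function. -/
theorem classOf_sub_eq_sum {Γ : Type} [Group Γ] (X : GSpace Γ) [X.Var] {κ : Type} [DecidableEq κ]
    (L : X.space.Pt → κ) (hL : IsLocallyConstant L) (hinv : ∀ γ x, L (X.act γ x) = L x)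
    (F : Finset κ) :
    classOf (X.sub {x | L x ∈ F} fun γ x => by
      change L (X.act γ x) ∈ F ↔ L x ∈ F
      rw [hinv]) = ∑ u ∈ F, classOf (X.sub {x | L x = u} fun γ x => by
        change L (X.act γ x) = u ↔ L x = u
        rw [hinv]) := by
  induction F using Finset.induction_on with
  | empty =>
    rw [Finset.sum_empty]
    have : IsEmpty (X.sub {x | L x ∈ (∅ : Finset κ)} fun γ x => by
        change L (X.act γ x) ∈ (∅ : Finset κ) ↔ L x ∈ (∅ : Finset κ)
        rw [hinv]).space.Pt :=
      ⟨fun x : {x | L x ∈ (∅ : Finset κ)} => Finset.notMem_empty _ x.2⟩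
    exact classOf_of_isEmpty _
  | insert u F hu ih =>
    rw [Finset.sum_insert hu, ← ih]
    refine classOf_sub_cut (C := {x | L x = u}) ?_ ?_ ?_ ?_ _ _ _
    · exact (hL ((insert u F : Finset κ) : Set κ)).isLocallyClosed
    · exact hL.isClosed_fiber u
    · ext x
      change L x ∈ insert u F ∧ L x = u ↔ L x = u
      rw [and_iff_right_iff_imp]
      intro h
      rw [h]
      exact Finset.mem_insert_self _ _
    · ext x
      change L x ∈ insert u F ∧ ¬ L x = u ↔ L x ∈ F
      rw [Finset.mem_insert]
      constructor
      · rintro ⟨h | h, h'⟩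
        exacts [(h' h).elim, h]
      · intro h
        exact ⟨Or.inr h, fun h' => hu (h' ▸ h)⟩

end GSpace

/-- The sum over the supersets of a proper subset, with signs, vanishes. -/
theorem sum_neg_one_pow_superset {ι : Type*} [Fintype ι] [DecidableEq ι] {U : Finset ι}
    (hU : U ≠ Finset.univ) : ∑ T : Finset ι with U ⊆ T, (-1 : ℤ) ^ T.card = 0 := by
  obtain ⟨i, hi⟩ : ∃ i, i ∉ U := by
    by_contra! h
    exact hU (Finset.eq_univ_iff_forall.2 h)
  refine Finset.sum_involution (fun T _ => if i ∈ T then T.erase i else insert i T) ?_ ?_ ?_ ?_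
  · intro T _
    split_ifs with h
    · rw [← Finset.card_erase_add_one h, pow_succ]
      ring
    · rw [Finset.card_insert_of_notMem h, pow_succ]
      ring
  · intro T _ _
    split_ifs with h
    · exact fun h' => (h' ▸ Finset.notMem_erase i T) h
    · exact fun h' => h (h' ▸ Finset.mem_insert_self i T)
  · intro T hT
    have hT := (Finset.mem_filter.1 hT).2
    refine Finset.mem_filter.2 ⟨Finset.mem_univ _, fun x hx => ?_⟩
    split_ifs with h
    · exact Finset.mem_erase.2 ⟨fun h' => hi (h' ▸ hx), hT hx⟩
    · exact Finset.mem_insert_of_mem (hT hx)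
  · intro T _
    by_cases h : i ∈ T
    · simp [h]
    · simp [h]

namespace SSpace

/-- The map between disjoint unions given by a map of the index sets. -/
def reindexHom (N : ℕ) {ι κ : Type} (e : κ → ι) (Y : ι → SSpace) :
    Hom N (sum fun k => Y (e k)) (sum Y) where
  app _ _ _ z := ⟨e z.1, z.2⟩
  nat _ _ _ _ := rfl

theorem reindexHom_imm (N : ℕ) {ι κ : Type} [Finite ι] [Finite κ] {e : κ → ι}
    (he : Function.Injective e) (Y : ι → SSpace) [∀ i, (Y i).Var] : (reindexHom N e Y).Imm := by
  intro A _ _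
  refine isImm_of_charts (D := fun k => (Y (e k)).obj A) ?_
    (fun k => Sigma.mk (β := fun k => ((Y (e k)).obj A).Pt) k)
    (fun k => IsImm.sigmaMk (X := fun k => (Y (e k)).obj A) k)
    (fun k => isOpen_range_sigmaMk (σ := fun k => ((Y (e k)).obj A).Pt))
    (fun z => ⟨z.1, z.2, rfl⟩) (fun k => IsImm.sigmaMk (X := fun i => (Y i).obj A) (e k))
    fun k => ⟨Set.range (Sigma.mk (β := fun i => ((Y i).obj A).Pt) (e k)),
      isOpen_range_sigmaMk (σ := fun i => ((Y i).obj A).Pt), ?_⟩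
  · rintro ⟨k, y⟩ ⟨k', y'⟩ h
    obtain rfl : k = k' := he (congrArg Sigma.fst h)
    exact Sigma.ext rfl (Sigma.mk.inj h).2
  · refine Set.inter_eq_left.2 ?_
    rintro _ ⟨y, rfl⟩
    exact ⟨⟨k, y⟩, rfl⟩

theorem reindexHom_surj (N : ℕ) {ι κ : Type} {e : κ → ι} (he : Function.Surjective e)
    (Y : ι → SSpace) : (reindexHom N e Y).Surj := by
  rintro A _ _ ⟨i, y⟩
  obtain ⟨k, rfl⟩ := he i
  exact ⟨⟨k, y⟩, rfl⟩

/-- Leaving out parts of a disjoint union of `𝕊`-varieties from among `n + 1` given ones, with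
signs, the classes of the compositions of degree `n` cancel: the composition is a disjoint union
over the sets of those given parts that are used by the blocks, and there are at most `n`
blocks. -/
theorem sum_neg_one_pow_cls_comp {n : ℕ} (W : SSpace) [W.Var] {ι : Type} [Finite ι]
    (Y : ι → SSpace) [∀ i, (Y i).Var] (c : Fin (n + 1) → ι) (hc : Function.Injective c) :
    ∑ T : Finset (Fin (n + 1)), (-1 : ℤ) ^ T.card •
      cls (W.comp (sum fun x : {x // ∀ i, c i = x → i ∈ T} => Y x)) n = 0 := by
  classical
  have hn : Nat.card (Fin n) ≤ n := card_fin_le le_rfl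
  let V := (W.comp (sum Y)).level n
  -- the indices of the given components that are used by some block
  let L : V.space.Pt → Finset (Fin (n + 1)) := fun z : compPt W (sum Y) (Fin n) =>
    Finset.univ.filter fun i => ∃ q, (z.2.2 q).1 = c i
  have hL : IsLocallyConstant L := by
    rw [IsLocallyConstant.iff_eventually_eq]
    rintro ⟨s, w, x⟩
    refine eventually_sigma (X := fun s : Setoid (Fin n) => compPart W (sum Y) s).2 ?_
    have h : ∀ q, ∀ᶠ p : (compPart W (sum Y) s).Pt in 𝓝 (w, x), (p.2 q).1 = (x q).1 := fun q =>
      IsOpen.mem_nhds (s := {p : (compPart W (sum Y) s).Pt | (p.2 q).1 = (x q).1})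
        ((isOpen_sigma_fst_preimage (σ := fun i => ((Y i).obj (Block s q)).Pt) {(x q).1}).preimage
          ((isMorphism_apply (X := fun q : Quotient s => (sum Y).obj (Block s q)) q).comp
            (isMorphism_snd (W.obj (Quotient s)) _)).1) rfl
    filter_upwards [eventually_all.2 h] with p hp
    refine Finset.filter_congr fun i _ => exists_congr fun q => ?_
    exact iff_of_eq (congrArg (· = c i) (hp q))
  have hinv : ∀ γ x, L (V.act γ x) = L x := by
    rintro γ ⟨s, w, x⟩
    refine Finset.filter_congr fun i _ => ?_
    exact (moveQuot γ s).symm.exists_congr fun q => Iff.rfl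
  -- `n` blocks do not suffice to use all `n + 1` components
  have hcard : ∀ z, L z ≠ Finset.univ := by
    rintro ⟨s, w, x⟩ h
    have : ∀ i, ∃ q, (x q).1 = c i := fun i => by
      have : i ∈ L ⟨s, w, x⟩ := h ▸ Finset.mem_univ i
      exact (Finset.mem_filter.1 this).2
    choose q hq using this
    have h1 : Function.Injective q := fun i i' h => hc (by rw [← hq, ← hq, h])
    have := (Nat.card_le_card_of_injective q h1).trans (card_quotient_le hn s)
    rw [Nat.card_fin] at this
    omega
  let G : Finset (Fin (n + 1)) → K (Equiv.Perm (Fin n)) := fun u =>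
    classOf (V.sub {x | L x = u} fun γ x => by
        change L (V.act γ x) = u ↔ L x = u
        rw [hinv])
  have key : ∀ T : Finset (Fin (n + 1)),
      cls (W.comp (sum fun x : {x // ∀ i, c i = x → i ∈ T} => Y x)) n =
        ∑ u ∈ T.powerset, G u := by
    intro T
    refine Eq.trans ?_ (GSpace.classOf_sub_eq_sum V L hL hinv T.powerset)
    have hS : ∀ γ x, V.act γ x ∈ {x | L x ∈ T.powerset} ↔ x ∈ {x | L x ∈ T.powerset} := by
      intro γ x
      change L (V.act γ x) ∈ T.powerset ↔ L x ∈ T.powerset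
      rw [hinv]
    have : (V.sub _ hS).Var :=
      GSpace.Var.sub (hL (T.powerset : Set (Finset (Fin (n + 1))))).isLocallyClosed hS
    let g := compHom (idHom n W) (reindexHom n (fun x : {x // ∀ i, c i = x → i ∈ T} => x.1) Y)
    have hg : IsImm _ _ (g.app (Fin n) hn) :=
      compHom_imm (idHom_imm n W) (reindexHom_imm n Subtype.val_injective Y) (Fin n) hn
    have hr : Set.range (g.app (Fin n) hn) = {x | L x ∈ T.powerset} := by
      rw [range_compHom]
      ext ⟨s, w, x⟩
      constructor
      · rintro ⟨-, h⟩
        refine Finset.mem_powerset.2 fun i hi => ?_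
        obtain ⟨q, hq⟩ := (Finset.mem_filter.1 hi).2
        obtain ⟨y, hy⟩ := h q
        exact y.1.2 i (hq.symm.trans (congrArg Sigma.fst hy).symm)
      · intro h
        refine ⟨⟨w, rfl⟩, fun q => ⟨⟨⟨(x q).1, fun i hi => ?_⟩, (x q).2⟩, rfl⟩⟩
        exact Finset.mem_powerset.1 h (Finset.mem_filter.2 ⟨Finset.mem_univ _, q, hi.symm⟩)
    obtain ⟨e, he, hei⟩ := hg.exists_isIso hr
    symm
    exact GSpace.classOf_eq_of_isIso (X := V.sub _ hS) (Y := (W.comp _).level n) e hei fun γ y =>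
      Subtype.ext ((he _).trans ((g.nat hn hn γ y).trans (congrArg _ (he y).symm)))
  simp only [key, Finset.smul_sum]
  rw [Finset.sum_comm' (t' := Finset.univ) (s' := fun u => Finset.univ.filter (u ⊆ ·)) (by simp)]
  refine Finset.sum_eq_zero fun u _ => ?_
  rw [← Finset.sum_smul]
  by_cases hu : u = Finset.univ
  · have : IsEmpty (V.sub {x | L x = u} fun γ x => by
        change L (V.act γ x) = u ↔ L x = u
        rw [hinv]).space.Pt := ⟨fun x : {x | L x = u} => hcard x.1 (x.2.trans hu)⟩
    rw [show G u = 0 from GSpace.classOf_of_isEmpty _, smul_zero]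
  · rw [sum_neg_one_pow_superset hu, zero_smul]

end SSpace

/-! ### Polynomial maps between abelian groups -/

/-- Every function on a commutative monoid with values in an abelian group is the composition of a
monoid homomorphism to a commutative ring with an additive functional, the kernel of which
contains no ideal. -/
theorem exists_linearization.{u, v} {M : Type u} [CommMonoid M] {H : Type v} [AddCommGroup H]
    (v : M → H) :
    ∃ (R : Type u) (_ : CommRing R) (t : M →* R) (V : R →+ H), (∀ m, V (t m) = v m) ∧
      ∀ r, (∀ m, V (t m * r) = 0) → r = 0 := by
  let R₀ := FreeAbelianGroup M
  let V : R₀ →+ H := FreeAbelianGroup.lift v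
  -- the largest ideal in the kernel of `V`
  let J : Ideal R₀ :=
    { carrier := {a | ∀ b, V (b * a) = 0}
      add_mem' := fun {a a'} h h' b => by rw [mul_add, map_add, h, h', add_zero]
      zero_mem' := fun b => by rw [mul_zero, map_zero]
      smul_mem' := fun c a h b => by rw [smul_eq_mul, ← mul_assoc, h] }
  let V' : R₀ ⧸ J →+ H := QuotientAddGroup.lift _ V fun a ha => by
    have := (show ∀ b, V (b * a) = 0 from ha) 1
    rwa [one_mul] at this
  refine ⟨R₀ ⧸ J, inferInstance,
    (Ideal.Quotient.mk J : R₀ →* R₀ ⧸ J).comp FreeAbelianGroup.ofMulHom,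
    V', fun m => FreeAbelianGroup.lift_apply_of _ _, fun r h => ?_⟩
  obtain ⟨a, rfl⟩ := Ideal.Quotient.mk_surjective r
  refine Ideal.Quotient.eq_zero_iff_mem.2 fun b => ?_
  induction b using FreeAbelianGroup.induction_on with
  | zero => rw [zero_mul, map_zero]
  | of m => exact h m
  | neg m => rw [neg_mul, map_neg, neg_eq_zero]; exact h m
  | add b b' h h' => rw [add_mul, map_add, h, h', add_zero]

theorem fwdDiff_iter_zero {H : Type*} [AddCommGroup H] (f : ℕ → H) (n : ℕ) :
    (fwdDiff 1)^[n] f 0 =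
      ∑ k ∈ Finset.range (n + 1), ((-1 : ℤ) ^ (n - k) * n.choose k) • f k := by
  rw [fwdDiff_iter_eq_sum_shift]
  exact Finset.sum_congr rfl fun k _ => by rw [zero_add, smul_eq_mul, mul_one]

theorem prod_one_sub_eq_sum {R ι : Type*} [CommRing R] [Fintype ι] (f : ι → R) :
    ∏ i, (1 - f i) = ∑ T : Finset ι, (-1 : ℤ) ^ T.card • ∏ i ∈ T, f i := by
  simp only [sub_eq_add_neg]
  rw [Finset.prod_one_add, Finset.powerset_univ]
  refine Finset.sum_congr rfl fun T _ => ?_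
  rw [Finset.prod_neg, zsmul_eq_mul]
  push_cast
  rfl

namespace IsPolynomialOfDegreeLE

universe u v

variable {G : Type u} {H : Type v} [AddCommGroup G] [AddCommGroup H]

/-- The linearization of a polynomial map: `1 - t g` is nilpotent for all `g`. -/
theorem exists_linearization {d : ℕ} {φ : G → H} (hφ : IsPolynomialOfDegreeLE d φ) :
    ∃ (R : Type u) (_ : CommRing R) (t : Multiplicative G →* R) (V : R →+ H),
      (∀ g, V (t (.ofAdd g)) = φ g) ∧
        ∀ h : Fin (d + 1) → G, ∏ i, (1 - t (.ofAdd (h i))) = 0 := by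
  obtain ⟨R, _, t, V, hV, h0⟩ := SVar.exists_linearization fun g : Multiplicative G => φ g.toAdd
  refine ⟨R, _, t, V, fun g => hV _, fun h => h0 _ fun b => ?_⟩
  rw [prod_one_sub_eq_sum, Finset.mul_sum, map_sum, ← hφ b.toAdd h]
  refine Finset.sum_congr rfl fun T _ => ?_
  rw [mul_smul_comm, map_zsmul, ← map_prod, ← map_mul, hV, ← ofAdd_sum]
  rfl

theorem mono {d e : ℕ} (hde : d ≤ e) {φ : G → H} (hφ : IsPolynomialOfDegreeLE d φ) :
    IsPolynomialOfDegreeLE e φ := by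
  obtain ⟨R, _, t, V, hV, h0⟩ := hφ.exists_linearization
  intro b h
  have h1 : ∏ i, (1 - t (.ofAdd (h i))) = 0 := by
    have := Finset.prod_dvd_prod_of_subset _ _ (fun i => 1 - t (.ofAdd (h i)))
      (Finset.subset_univ (Finset.univ.map (Fin.castLEEmb (Nat.succ_le_succ hde))))
    rw [Finset.prod_map] at this
    refine zero_dvd_iff.1 (dvd_trans (dvd_of_eq ?_) this)
    exact (h0 fun i => h (Fin.castLE (Nat.succ_le_succ hde) i)).symm
  have h2 : V (t (.ofAdd b) * ∏ i, (1 - t (.ofAdd (h i)))) = 0 := by rw [h1, mul_zero, map_zero]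
  rw [prod_one_sub_eq_sum, Finset.mul_sum, map_sum] at h2
  refine Eq.trans (Finset.sum_congr rfl fun T _ => ?_) h2
  rw [mul_smul_comm, map_zsmul, ← map_prod, ← map_mul, ← ofAdd_sum, ← ofAdd_add, hV]

theorem fwdDiff_iter_eq_zero {d m : ℕ} (hm : d < m) {φ : G → H} (hφ : IsPolynomialOfDegreeLE d φ)
    (b c : G) : (fwdDiff 1)^[m] (fun k : ℕ => φ (b + k • c)) 0 = 0 := by
  obtain ⟨m, rfl⟩ : ∃ m', m = m' + 1 := ⟨m - 1, by omega⟩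
  have h1 := hφ.mono (Nat.lt_succ_iff.1 hm) b fun _ => c
  simp only [Finset.sum_const] at h1
  rw [← Finset.powerset_univ,
    Finset.sum_powerset_apply_card (fun k => (-1 : ℤ) ^ k • φ (b + k • c)),
    Finset.card_univ, Fintype.card_fin] at h1
  rw [fwdDiff_iter_zero]
  have h2 := congrArg (fun y => (-1 : ℤ) ^ (m + 1) • y) h1
  simp only [smul_zero, Finset.smul_sum] at h2
  rw [← h2]
  refine Finset.sum_congr rfl fun k hk => ?_
  have hk : k ≤ m + 1 := Nat.lt_succ_iff.1 (Finset.mem_range.1 hk)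
  rw [← natCast_zsmul (_ • _) ((m + 1).choose k), smul_smul, smul_smul]
  congr 1
  obtain ⟨j, hj⟩ := Nat.exists_eq_add_of_le hk
  rw [hj, Nat.add_sub_cancel_left, pow_add]
  have : (-1 : ℤ) ^ k * (-1) ^ k = 1 := by rw [← pow_add, ← two_mul, pow_mul]; simp
  linear_combination (- (-1 : ℤ) ^ j * ((k + j).choose k)) * this

/-- Newton's formula. -/
theorem apply_add_nsmul {d : ℕ} {φ : G → H} (hφ : IsPolynomialOfDegreeLE d φ) (b c : G) (k : ℕ) :
    φ (b + k • c) = ∑ i ∈ Finset.range (d + 1),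
      k.choose i • (fwdDiff 1)^[i] (fun k : ℕ => φ (b + k • c)) 0 := by
  have h1 := shift_eq_sum_fwdDiff_iter 1 (fun k : ℕ => φ (b + k • c)) k 0
  rw [zero_add, smul_eq_mul, mul_one] at h1
  have h2 : ∀ N, k ≤ N → d ≤ N → ∑ i ∈ Finset.range (N + 1),
      k.choose i • (fwdDiff 1)^[i] (fun k : ℕ => φ (b + k • c)) 0 = ∑ i ∈ Finset.range (k + 1),
      k.choose i • (fwdDiff 1)^[i] (fun k : ℕ => φ (b + k • c)) 0 := fun N hN _ =>
    (Finset.sum_subset (Finset.range_mono (Nat.succ_le_succ hN)) fun i _ hi => by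
      rw [Nat.choose_eq_zero_of_lt (by simpa using hi), zero_smul]).symm
  have h3 : ∀ N, k ≤ N → d ≤ N → ∑ i ∈ Finset.range (N + 1),
      k.choose i • (fwdDiff 1)^[i] (fun k : ℕ => φ (b + k • c)) 0 = ∑ i ∈ Finset.range (d + 1),
      k.choose i • (fwdDiff 1)^[i] (fun k : ℕ => φ (b + k • c)) 0 := fun N _ hN =>
    (Finset.sum_subset (Finset.range_mono (Nat.succ_le_succ hN)) fun i _ hi => by
      rw [hφ.fwdDiff_iter_eq_zero (by simpa using hi), smul_zero]).symm
  exact h1.trans ((h2 _ (le_max_left k d) (le_max_right k d)).symm.trans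
    (h3 _ (le_max_left k d) (le_max_right k d)))

end IsPolynomialOfDegreeLE

/-- The binomial coefficients of a polynomial sequence form a polynomial sequence. -/
theorem exists_eval_eq_choose (P : Polynomial ℚ) (f : ℕ → ℕ) (hP : ∀ k, (f k : ℚ) = P.eval (k : ℚ))
    (j : ℕ) : ∃ Q : Polynomial ℚ, ∀ k, ((f k).choose j : ℚ) = Q.eval (k : ℚ) := by
  refine ⟨Polynomial.C ((j.factorial : ℚ)⁻¹) * (descPochhammer ℚ j).comp P, fun k => ?_⟩
  rw [Nat.cast_choose_eq_descPochhammer_div, Polynomial.eval_mul, Polynomial.eval_C,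
    Polynomial.eval_comp, ← hP, div_eq_inv_mul]

/-- A polynomial map takes a polynomial sequence to one with vanishing differences of high order. -/
theorem IsPolynomialOfDegreeLE.eventually_fwdDiff_iter {H L : Type*} [AddCommGroup H]
    [AddCommGroup L] {e : ℕ} {ψ : H → L} (hψ : IsPolynomialOfDegreeLE e ψ) (d : ℕ) (a : ℕ → H) :
    ∀ᶠ D in atTop,
      (fwdDiff 1)^[D] (fun k : ℕ => ψ (∑ i ∈ Finset.range d, k.choose i • a i)) 0 = 0 := by
  obtain ⟨R, _, t, V, hV, h0⟩ := hψ.exists_linearization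
  let ν : ℕ → R := fun i => t (.ofAdd (a i)) - 1
  have hν : ∀ i, ν i ^ (e + 1) = 0 := fun i => by
    have := h0 fun _ => a i
    rw [Finset.prod_const, Finset.card_univ, Fintype.card_fin] at this
    change (_ - _) ^ _ = _
    rw [← neg_sub 1, neg_pow, this, mul_zero]
  have hpow : ∀ i N, t (.ofAdd (a i)) ^ N =
      ∑ j ∈ Finset.range (e + 1), ((N.choose j : ℤ) : R) * ν i ^ j := fun i N => by
    have h1 : t (.ofAdd (a i)) = ν i + 1 := (sub_add_cancel _ _).symm
    rw [h1, add_pow]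
    simp only [one_pow, mul_one]
    have hM : ∀ M, N ≤ M → e ≤ M → ∑ j ∈ Finset.range (N + 1), ν i ^ j * (N.choose j : R) =
        ∑ j ∈ Finset.range (M + 1), ν i ^ j * (N.choose j : R) := fun M hN _ =>
      Finset.sum_subset (Finset.range_mono (Nat.succ_le_succ hN)) fun j _ hj => by
        rw [Nat.choose_eq_zero_of_lt (by simpa using hj), Nat.cast_zero, mul_zero]
    have hM' : ∀ M, N ≤ M → e ≤ M → ∑ j ∈ Finset.range (e + 1), ν i ^ j * (N.choose j : R) =
        ∑ j ∈ Finset.range (M + 1), ν i ^ j * (N.choose j : R) := fun M _ hN =>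
      Finset.sum_subset (Finset.range_mono (Nat.succ_le_succ hN)) fun j _ hj => by
        rw [pow_eq_zero_of_le (by simpa using hj) (hν i), zero_mul]
    rw [hM _ (le_max_left N e) (le_max_right N e), ← hM' _ (le_max_left N e) (le_max_right N e)]
    exact Finset.sum_congr rfl fun j _ => by rw [mul_comm]; push_cast; rfl
  -- expand the product of the powers of the unipotent elements `t (a i) = 1 + ν i`
  let q : (Fin d → ℕ) → ℕ → ℤ := fun x k => ∏ i : Fin d, (((k.choose i).choose (x i) : ℕ) : ℤ)
  have hsum : ∀ k : ℕ, ψ (∑ i ∈ Finset.range d, k.choose i • a i) =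
      ∑ x ∈ Fintype.piFinset fun _ : Fin d => Finset.range (e + 1),
        q x k • V (∏ i : Fin d, ν i ^ x i) := by
    intro k
    rw [← hV, ← Fin.sum_univ_eq_sum_range (fun i => k.choose i • a i), ofAdd_sum, map_prod]
    simp only [ofAdd_nsmul, map_pow, hpow]
    rw [Finset.prod_univ_sum, map_sum]
    refine Finset.sum_congr rfl fun x _ => ?_
    rw [Finset.prod_mul_distrib, ← map_zsmul, zsmul_eq_mul, Int.cast_prod]
  have hq : ∀ x, ∀ᶠ D in atTop, (fwdDiff 1)^[D] (q x) 0 = 0 := by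
    intro x
    obtain ⟨Q, hQ⟩ : ∃ Q : Polynomial ℚ, ∀ k : ℕ, (q x k : ℚ) = Q.eval (k : ℚ) := by
      choose P hP using fun i : Fin d => exists_eval_eq_choose Polynomial.X id (by simp) i
      choose Q hQ using fun i : Fin d => exists_eval_eq_choose (P i) _ (hP i) (x i)
      refine ⟨∏ i, Q i, fun k => ?_⟩
      rw [Polynomial.eval_prod]
      simp only [q]
      push_cast
      exact Finset.prod_congr rfl fun i _ => hQ i k
    filter_upwards [eventually_gt_atTop Q.natDegree] with D hD
    have h1 := congrFun (Polynomial.fwdDiff_iter_eq_zero_of_degree_lt hD) 0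
    rw [fwdDiff_iter_eq_sum_shift] at h1
    rw [fwdDiff_iter_zero]
    have h2 : ((∑ k ∈ Finset.range (D + 1), ((-1 : ℤ) ^ (D - k) * D.choose k) • q x k :
        ℤ) : ℚ) = 0 := by
      refine Eq.trans ?_ h1
      push_cast
      refine Finset.sum_congr rfl fun k _ => ?_
      rw [zero_add, nsmul_eq_mul, mul_one, zsmul_eq_mul, ← hQ, zsmul_eq_mul, Int.cast_mul,
        Int.cast_id]
    exact_mod_cast h2
  filter_upwards [(eventually_all_finset _).2 fun x (_ : x ∈ Fintype.piFinset fun _ : Fin d =>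
    Finset.range (e + 1)) => hq x] with D hD
  simp only [hsum]
  rw [fwdDiff_iter_zero]
  simp only [Finset.smul_sum]
  rw [Finset.sum_comm]
  refine Finset.sum_eq_zero fun x hx => ?_
  have h1 := hD x hx
  rw [fwdDiff_iter_zero] at h1
  simp only [smul_smul]
  rw [← Finset.sum_smul]
  simp only [smul_eq_mul] at h1 ⊢
  rw [h1, zero_smul]

/-- Two sequences with vanishing differences of high order that agree at all positive numbers agree
at `0`. -/
theorem eq_of_eventually_fwdDiff_iter {H : Type*} [AddCommGroup H] {f g : ℕ → H}
    (hf : ∀ᶠ D in atTop, (fwdDiff 1)^[D] f 0 = 0) (hg : ∀ᶠ D in atTop, (fwdDiff 1)^[D] g 0 = 0)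
    (h : ∀ k, 0 < k → f k = g k) : f 0 = g 0 := by
  obtain ⟨D, hf, hg⟩ := (hf.and hg).exists
  rw [fwdDiff_iter_zero, Finset.sum_range_succ'] at hf hg
  have h1 := hf.trans hg.symm
  rw [Finset.sum_congr rfl fun k _ => by rw [h _ (by simp)]] at h1
  have h2 := add_left_cancel h1
  simp only [Nat.sub_zero, Nat.choose_zero_right, Nat.cast_one, mul_one] at h2
  have h3 := congrArg (fun y => (-1 : ℤ) ^ D • y) h2
  simp only [smul_smul, ← pow_add, ← two_mul, pow_mul, neg_one_sq, one_pow, one_smul] at h3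
  exact h3

/-- Polynomial maps are determined by their values on a set of generators that is closed under
addition. -/
theorem IsPolynomialOfDegreeLE.ext {G H : Type*} [AddCommGroup G] [AddCommGroup H] {d : ℕ}
    {φ ψ : G → H} (hφ : IsPolynomialOfDegreeLE d φ) (hψ : IsPolynomialOfDegreeLE d ψ) {C : Set G}
    (hC : ∀ b, ∃ c ∈ C, ∃ c' ∈ C, b = c - c') (hadd : ∀ c ∈ C, ∀ c' ∈ C, c + c' ∈ C)
    (h : ∀ c ∈ C, φ c = ψ c) : φ = ψ := by
  funext b
  obtain ⟨c, hc, c', hc', rfl⟩ := hC b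
  have hk : ∀ k : ℕ, c - c' + (k + 1) • c' ∈ C := fun k => by
    induction k with
    | zero => simpa using hc
    | succ k ih =>
      rw [succ_nsmul, ← add_assoc]
      exact hadd _ ih _ hc'
  have := eq_of_eventually_fwdDiff_iter (f := fun k : ℕ => φ (c - c' + k • c'))
    (g := fun k : ℕ => ψ (c - c' + k • c'))
    ((eventually_gt_atTop d).mono fun m hm => hφ.fwdDiff_iter_eq_zero hm _ _)
    ((eventually_gt_atTop d).mono fun m hm => hψ.fwdDiff_iter_eq_zero hm _ _) fun k hk' => by
      obtain ⟨k, rfl⟩ : ∃ j, k = j + 1 := ⟨k - 1, by omega⟩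
      exact h _ (hk k)
  simpa using this

/-! ### Extension of polynomial functions to the Grothendieck group -/

/-- Two families with the same multiset of values differ by a bijection of their index sets. -/
theorem exists_equiv_of_sum_singleton_eq {α : Type*} {ι κ : Type} [Fintype ι] [Fintype κ]
    {Y : ι → α} {Z : κ → α}
    (h : ∑ i, ({Y i} : Multiset α) = ∑ k, {Z k}) : ∃ e : ι ≃ κ, ∀ i, Z (e i) = Y i := by
  classical
  have hc : ∀ a, Nonempty ({i // Y i = a} ≃ {k // Z k = a}) := fun a => by
    have := congrArg (Multiset.count a) h
    rw [Multiset.count_sum', Multiset.count_sum'] at this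
    simp only [Multiset.count_singleton, Finset.sum_boole] at this
    refine ⟨Fintype.equivOfCardEq ?_⟩
    rw [Fintype.card_subtype, Fintype.card_subtype]
    simpa [eq_comm] using this
  refine ⟨(Equiv.sigmaFiberEquiv Y).symm.trans ((Equiv.sigmaCongrRight fun a => (hc a).some).trans
    (Equiv.sigmaFiberEquiv Z)), fun i => ?_⟩
  exact ((hc (Y i)).some ⟨i, rfl⟩).2

/-- Every finite multiset is the multiset of values of a finite family. -/
theorem exists_fin_sum_singleton {α : Type*} (m : Multiset α) :
    ∃ (k : ℕ) (Y : Fin k → α), ∑ i, ({Y i} : Multiset α) = m := by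
  induction m using Quotient.inductionOn with
  | h l =>
    refine ⟨l.length, l.get, ?_⟩
    change (Finset.univ.val.map fun i => ({l.get i} : Multiset α)).sum = _
    rw [← Function.comp_def (fun a => ({a} : Multiset α)) l.get, ← Multiset.map_map,
      Multiset.sum_map_singleton, Fin.univ_val_map, List.ofFn_get]
    rfl

/-- Products of `d + 1` differences vanish in the span if they vanish for the generators. -/
theorem prod_eq_zero_of_mem_span {R : Type*} [CommRing R] {S : Set R} {k : ℕ}
    (h : ∀ x : Fin k → R, (∀ i, x i ∈ S) → ∏ i, x i = 0) (x : Fin k → R)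
    (hx : ∀ i, x i ∈ Ideal.span S) : ∏ i, x i = 0 := by
  have h0 : Ideal.span S ^ k = ⊥ := by
    refine (Submodule.span_pow (R := R) S k).trans ((Submodule.span_eq_bot).2 fun y hy => ?_)
    obtain ⟨f, rfl⟩ := Set.mem_pow.1 hy
    rw [List.prod_ofFn]
    exact h _ fun i => (f i).2
  have h1 := Ideal.prod_mem_prod (s := Finset.univ) (I := fun _ : Fin k => Ideal.span S)
    fun i _ => hx i
  rw [Finset.prod_const, Finset.card_univ, Fintype.card_fin, h0] at h1
  exact h1

namespace SSpace

/-- The disjoint union of `Y` and a family. -/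
abbrev optionSum {ι : Type} (Y : SSpace) (Z : ι → SSpace) : SSpace :=
  sum fun x : Option ι => x.elim Y Z

instance option_elim_var {ι : Type} (Y : SSpace) [hY : Y.Var] (Z : ι → SSpace)
    [hZ : ∀ i, (Z i).Var] (x : Option ι) : (x.elim Y Z).Var := by
  cases x
  exacts [hY, hZ _]

/-- The associativity of disjoint unions. -/
def optionSumHom (N : ℕ) {ι : Type} (U : SSpace) (Z : ι → SSpace) :
    Hom N (optionSum U Z) (add (sum Z) U) where
  app _ _ _ z := match z with
    | ⟨none, u⟩ => ⟨false, u⟩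
    | ⟨some i, y⟩ => ⟨true, i, y⟩
  nat _ _ _ z := match z with
    | ⟨none, _⟩ => rfl
    | ⟨some _, _⟩ => rfl

theorem optionSumHom_surj (N : ℕ) {ι : Type} (U : SSpace) (Z : ι → SSpace) :
    (optionSumHom N U Z).Surj := by
  rintro A _ _ ⟨_ | _, z⟩
  exacts [⟨⟨none, z⟩, rfl⟩, ⟨⟨some z.1, z.2⟩, rfl⟩]

theorem optionSumHom_imm (N : ℕ) {ι : Type} [Finite ι] (U : SSpace) [U.Var] (Z : ι → SSpace)
    [∀ i, (Z i).Var] : (optionSumHom N U Z).Imm := by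
  intro A _ h
  have hs := optionSumHom_surj N U Z A h
  refine isImm_of_charts (D := fun x : Option ι => (x.elim U Z).obj A) ?_
    (fun k => Sigma.mk (β := fun x : Option ι => ((x.elim U Z).obj A).Pt) k)
    (fun k => IsImm.sigmaMk (X := fun x : Option ι => (x.elim U Z).obj A) k)
    (fun k => isOpen_range_sigmaMk (σ := fun x : Option ι => ((x.elim U Z).obj A).Pt))
    (fun z => ⟨z.1, z.2, rfl⟩) ?_ ?_
  · rintro ⟨_ | i, y⟩ ⟨_ | i', y'⟩ h
    · exact Sigma.ext rfl (Sigma.mk.inj h).2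
    · cases congrArg Sigma.fst h
    · cases congrArg Sigma.fst h
    · have := eq_of_heq (Sigma.mk.inj h).2
      obtain rfl : i = i' := congrArg Sigma.fst this
      exact Sigma.ext rfl (Sigma.mk.inj this).2
  · rintro (_ | i)
    · exact IsImm.sigmaMk (X := fun b : Bool => (cond b (sum Z) U).obj A) false
    · exact (IsImm.sigmaMk (X := fun b : Bool => (cond b (sum Z) U).obj A) true).comp
        (IsImm.sigmaMk (X := fun i => (Z i).obj A) i)
  · rintro (_ | i)
    · exact ⟨Set.range (Sigma.mk (β := fun b : Bool => ((cond b (sum Z) U).obj A).Pt) false),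
        isOpen_range_sigmaMk (σ := fun b : Bool => ((cond b (sum Z) U).obj A).Pt),
        Set.inter_eq_left.2 fun z _ => hs z⟩
    · exact ⟨Set.range (Sigma.mk (β := fun b : Bool => ((cond b (sum Z) U).obj A).Pt) true ∘
          Sigma.mk (β := fun i => ((Z i).obj A).Pt) i),
        ((isOpenMap_sigmaMk (σ := fun b : Bool => ((cond b (sum Z) U).obj A).Pt) (i := true)).comp
          (isOpenMap_sigmaMk (σ := fun i => ((Z i).obj A).Pt) (i := i))).isOpen_range,
        Set.inter_eq_left.2 fun z _ => hs z⟩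

/-- Natural maps between the parts induce a natural map between the disjoint unions. -/
def sumHom {N : ℕ} {ι : Type} {Y X : ι → SSpace} (f : ∀ i, Hom N (Y i) (X i)) :
    Hom N (sum Y) (sum X) where
  app _ _ h z := ⟨z.1, (f z.1).app _ h z.2⟩
  nat hA hB e z := Sigma.ext rfl (heq_of_eq ((f z.1).nat hA hB e z.2))

theorem sumHom_imm {N : ℕ} {ι : Type} {Y X : ι → SSpace} {f : ∀ i, Hom N (Y i) (X i)}
    (hf : ∀ i, (f i).Imm) : (sumHom f).Imm :=
  fun A _ h => IsImm.sigma fun i => hf i A h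

theorem range_sumHom {N : ℕ} {ι : Type} {Y X : ι → SSpace} (f : ∀ i, Hom N (Y i) (X i))
    (A : Type) [Finite A] (h : Nat.card A ≤ N) : Set.range ((sumHom f).app A h) =
      {z : Σ i, ((X i).obj A).Pt | z.2 ∈ Set.range ((f z.1).app A h)} :=
  range_sigmaMap (X := fun i => (Y i).obj A) (Y := fun i => (X i).obj A) fun i => (f i).app A h

theorem IsCut.optionSum {N : ℕ} {X Y U : SSpace} [X.Var] [Y.Var] [U.Var] (h : IsCut N X Y U)
    {ι : Type} [Finite ι] (Z : ι → SSpace) [∀ i, (Z i).Var] :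
    IsCut N (optionSum X Z) (optionSum Y Z) U := by
  obtain ⟨i, j, hi, hj, hc, hr⟩ := h
  let f : ∀ x : Option ι, Hom N (x.elim Y Z) (x.elim X Z) := fun x =>
    match x with
    | none => i
    | some k => idHom N (Z k)
  have hf : ∀ x, (f x).Imm := by
    rintro (_ | k)
    exacts [hi, idHom_imm N _]
  refine ⟨sumHom f, ⟨fun A _ h u => ⟨none, j.app A h u⟩,
      fun hA hB e u => Sigma.ext rfl (heq_of_eq (j.nat hA hB e u))⟩, sumHom_imm hf,
    fun A _ h => (IsImm.sigmaMk (X := fun x : Option ι => (x.elim X Z).obj A) none).comp (hj A h),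
    fun A _ h => ?_, fun A _ h => ?_⟩
  · rw [range_sumHom]
    refine isClosed_sigma (X := fun x : Option ι => (x.elim X Z).obj A).2 ?_
    rintro (_ | k)
    · exact hc A h
    · convert isClosed_univ
      exact Set.eq_univ_of_forall fun y => ⟨y, rfl⟩
  · rw [range_sumHom]
    ext ⟨_ | k, y⟩
    · refine Iff.trans ⟨?_, ?_⟩ (Set.ext_iff.1 (hr A h) y)
      · rintro ⟨u, hu⟩
        exact ⟨u, eq_of_heq (Sigma.mk.inj hu).2⟩
      · rintro ⟨u, rfl⟩
        exact ⟨u, rfl⟩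
    · refine iff_of_false ?_ fun h => h ⟨y, rfl⟩
      rintro ⟨u, hu⟩
      cases congrArg Sigma.fst hu

/-- Functions of `𝕊`-varieties that behave like polynomials of degree `d` in the class of the
variety in the degrees up to `N`. -/
structure IsPoly {H : Type*} [AddCommGroup H] (N d : ℕ) (Φ : SSpace → H) : Prop where
  of_hom (X Y : SSpace) (hX : X.Var) (hY : Y.Var) (f : Hom N X Y) (hf : f.Imm) (hs : f.Surj) :
    Φ X = Φ Y
  cut (X Y U : SSpace) (hX : X.Var) (hY : Y.Var) (hU : U.Var) (h : IsCut N X Y U) :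
    Φ X = Φ (add Y U)
  sum_eq_zero {ι : Type} [Finite ι] (Y : ι → SSpace) (hY : ∀ i, (Y i).Var) (c : Fin (d + 1) → ι)
    (hc : Function.Injective c) :
    ∑ T : Finset (Fin (d + 1)), (-1 : ℤ) ^ T.card •
      Φ (sum fun x : {x // ∀ i, c i = x → i ∈ T} => Y x) = 0

/-- A function of `𝕊`-varieties that behaves like a polynomial extends to the Grothendieck group. -/
theorem IsPoly.exists_extension {H : Type*} [AddCommGroup H] {N d : ℕ} {Φ : SSpace → H}
    (hΦ : IsPoly N d Φ) : ∃ φ : KS → H, (∀ X : SSpace, X.Var → φ (cls X) = Φ X) ∧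
      IsPolynomialOfDegreeLE d φ ∧ ∀ a b : KS, (∀ m ≤ N, a m = b m) → φ a = φ b := by
  classical
  let S := {X : SSpace // X.Var}
  have hS : ∀ Y : S, Y.1.Var := fun Y => Y.2
  -- the value at a disjoint union depends only on the multiset of its parts
  obtain ⟨v, hv⟩ : ∃ v : Multiset S → H, ∀ {ι : Type} [Fintype ι] (Y : ι → S),
      v (∑ i, {Y i}) = Φ (sum fun i => (Y i).1) := by
    choose k Z hZ using exists_fin_sum_singleton (α := S)
    refine ⟨fun m => Φ (sum fun i => (Z m i).1), fun {ι} _ Y => ?_⟩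
    obtain ⟨e, he⟩ := exists_equiv_of_sum_singleton_eq (hZ (∑ i, {Y i}))
    change Φ (sum fun i => (Z (∑ i, {Y i}) i).1) = _
    rw [show Z (∑ i, {Y i}) = fun i => Y (e i) from funext fun i => (he i).symm]
    exact hΦ.of_hom _ _ inferInstance inferInstance (reindexHom N e fun i => (Y i).1)
      (reindexHom_imm N e.injective _) (reindexHom_surj N e.surjective _)
  obtain ⟨R, _, t₀, V, hV, h0⟩ := exists_linearization fun m : Multiplicative (Multiset S) =>
    v m.toAdd
  let x : Multiset S → R := fun m => t₀ (.ofAdd m)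
  have hx : ∀ m m', x (m + m') = x m * x m' := fun m m' => map_mul t₀ (.ofAdd m) (.ofAdd m')
  have hx0 : x 0 = 1 := map_one t₀
  have hVx : ∀ m, V (x m) = v m := fun m => hV _
  have h0' : ∀ r, (∀ m, V (x m * r) = 0) → r = 0 := fun r h => h0 r fun m => h m.toAdd
  let u : S → R := fun Y => x {Y}
  -- the polynomiality of `Φ` in the presence of arbitrary further parts, given by `m`
  have hnil : ∀ Y : Fin (d + 1) → S, ∏ i, (1 - u (Y i)) = 0 := by
    intro Y
    refine h0' _ fun m => ?_
    obtain ⟨k, Z, rfl⟩ := exists_fin_sum_singleton m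
    have hxs : ∀ T : Finset (Fin (d + 1)), ∏ i ∈ T, u (Y i) = x (∑ i ∈ T, {Y i}) := fun T => by
      induction T using Finset.induction_on with
      | empty => exact hx0.symm
      | insert i T hi ih => rw [Finset.prod_insert hi, Finset.sum_insert hi, ih, hx]
    rw [prod_one_sub_eq_sum, Finset.mul_sum, map_sum,
      ← hΦ.sum_eq_zero (fun i => (Sum.elim Z Y i).1) (fun i => hS _) Sum.inr Sum.inr_injective]
    refine Finset.sum_congr rfl fun T _ => ?_
    rw [mul_smul_comm, map_zsmul, hxs, ← hx, hVx]
    refine congrArg _ (Eq.trans (congrArg v ?_)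
      (hv fun i : {i : Fin k ⊕ Fin (d + 1) // ∀ j, Sum.inr j = i → j ∈ T} => Sum.elim Z Y i.1))
    rw [← Finset.sum_subtype (Finset.univ.filter fun i => ∀ j, Sum.inr j = i → j ∈ T)
      (fun i => by simp) fun i => ({Sum.elim Z Y i} : Multiset S), Finset.sum_filter,
      Fintype.sum_sum_type]
    simp
  have hvo : ∀ (X : S) {ι : Type} [Fintype ι] (Z : ι → S),
      v ({X} + ∑ i, {Z i}) = Φ (optionSum X.1 fun i => (Z i).1) := fun X ι _ Z => by
    have := hv fun o : Option ι => o.elim X Z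
    rw [Fintype.sum_option] at this
    refine this.trans (congrArg (fun F => Φ (sum F)) (funext fun o => ?_))
    cases o <;> rfl
  have hcut : ∀ X Y U : S, IsCut N X.1 Y.1 U.1 → u X = u Y * u U := by
    intro X Y U h
    refine sub_eq_zero.1 (h0' _ fun m => ?_)
    change V (x m * (x {X} - x {Y} * x {U})) = 0
    rw [← hx]
    obtain ⟨k, Z, rfl⟩ := exists_fin_sum_singleton m
    rw [mul_sub, map_sub, ← hx, ← hx, hVx, hVx, sub_eq_zero, add_comm, hvo,
      hΦ.cut _ _ _ inferInstance inferInstance inferInstance (h.optionSum fun i => (Z i).1),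
      ← hΦ.of_hom _ _ inferInstance inferInstance (optionSumHom N U.1 _) (optionSumHom_imm N _ _)
        (optionSumHom_surj N _ _)]
    have h1 := hvo U fun o : Option (Fin k) => o.elim Y Z
    rw [Fintype.sum_option] at h1
    refine Eq.trans (congrArg (fun F => Φ (optionSum U.1 F)) (funext fun o => ?_)) (h1.symm.trans
      (congrArg v ?_))
    · cases o <;> rfl
    · change {U} + ({Y} + ∑ i, {Z i}) = _
      abel
  -- `1 - u Y` is nilpotent
  have hunit : ∀ Y, IsUnit (u Y) := fun Y => by
    have := hnil fun _ => Y
    rw [Finset.prod_const] at this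
    have := IsNilpotent.isUnit_one_sub ⟨_, this⟩
    rwa [sub_sub_cancel] at this
  choose w hw using hunit
  let Ψ : SSpace → Additive Rˣ := fun X => if h : X.Var then Additive.ofMul (w ⟨X, h⟩) else 0
  have hΨ : ∀ Y : S, Ψ Y.1 = Additive.ofMul (w Y) := fun Y => dif_pos Y.2
  have hΨa : IsAdditive N Ψ := by
    intro X Y U hX hY hU h
    rw [hΨ ⟨X, hX⟩, hΨ ⟨Y, hY⟩, hΨ ⟨U, hU⟩, ← ofMul_mul]
    refine congrArg _ (Units.ext ?_)
    rw [Units.val_mul, hw, hw, hw]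
    exact hcut ⟨X, hX⟩ ⟨Y, hY⟩ ⟨U, hU⟩ h
  obtain ⟨θ, hθ, hθ0⟩ := hΨa.exists_hom
  let t : KS → R := fun a => ((θ a).toMul : Rˣ)
  have ht : ∀ a b, t (a + b) = t a * t b := fun a b => by
    change (((θ (a + b)).toMul : Rˣ) : R) = _
    rw [map_add]; rfl
  have htc : ∀ Y : S, t (cls Y.1) = u Y := fun Y => by
    change (((θ (cls Y.1)).toMul : Rˣ) : R) = _
    rw [hθ Y.1 Y.2, hΨ, ← hw]; rfl
  have ht0 : t 0 = 1 := by
    change (((θ 0).toMul : Rˣ) : R) = _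
    rw [map_zero]; rfl
  -- `1 - t a` is a combination of elements `1 - u Y`, also for a difference `a` of classes
  have hspan : ∀ a, 1 - t a ∈ Ideal.span (Set.range fun Y : S => 1 - u Y) := by
    intro a
    obtain ⟨X, Y, hX, hY, rfl⟩ := exists_cls_sub a
    have h1 : t (cls X - cls Y) * u ⟨Y, hY⟩ = u ⟨X, hX⟩ := by
      rw [← htc, ← htc, ← ht, sub_add_cancel]
    have h2 : t (-cls Y) * u ⟨Y, hY⟩ = 1 := by rw [← htc, ← ht, neg_add_cancel, ht0]
    have h3 : 1 - t (cls X - cls Y) =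
        t (-cls Y) * ((1 - u ⟨X, hX⟩) - (1 - u ⟨Y, hY⟩)) := by
      linear_combination (-t (-cls Y)) * h1 - (1 - t (cls X - cls Y)) * h2
    rw [h3]
    exact Ideal.mul_mem_left _ _ (sub_mem (Ideal.subset_span ⟨_, rfl⟩) (Ideal.subset_span ⟨_, rfl⟩))
  refine ⟨fun a => V (t a), fun X hX => ?_, fun b h => ?_, fun a b h => ?_⟩
  · have h1 := hv fun _ : Unit => (⟨X, hX⟩ : S)
    rw [Fintype.sum_unique] at h1
    change V (t (cls X)) = _
    rw [htc ⟨X, hX⟩]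
    refine (hVx _).trans (h1.trans ?_)
    refine hΦ.of_hom _ _ inferInstance inferInstance
      ⟨fun A _ _ z => z.2, fun _ _ _ _ => rfl⟩ (fun A _ _ => ?_) fun A _ _ y => ⟨⟨(), y⟩, rfl⟩
    refine ⟨fun z z' h => Sigma.ext rfl (heq_of_eq h), isMorphism_sigma fun _ => .id _,
      fun Z _ χ hχ => ?_⟩
    exact isMorphism_sigmaMk (X := fun _ : Unit => X.obj A) () hχ
  · have hts : ∀ T : Finset (Fin (d + 1)), t (∑ i ∈ T, h i) = ∏ i ∈ T, t (h i) := fun T => by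
      induction T using Finset.induction_on with
      | empty => exact ht0
      | insert i T hi ih => rw [Finset.prod_insert hi, Finset.sum_insert hi, ht, ih]
    have h1 := prod_eq_zero_of_mem_span (S := Set.range fun Y : S => 1 - u Y) (k := d + 1)
      (fun y hy => by
        choose Y hY using hy
        rw [← hnil Y]
        exact Finset.prod_congr rfl fun i _ => (hY i).symm) (fun i => 1 - t (h i)) fun i => hspan _
    have h2 : V (t b * ∏ i, (1 - t (h i))) = 0 := by rw [h1, mul_zero, map_zero]
    rw [prod_one_sub_eq_sum, Finset.mul_sum, map_sum] at h2
    refine Eq.trans (Finset.sum_congr rfl fun T _ => ?_) h2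
    change (-1 : ℤ) ^ T.card • V (t (b + ∑ i ∈ T, h i)) = _
    rw [mul_smul_comm, map_zsmul, ht, hts]
  · have : θ a = θ b := by
      rw [← sub_eq_zero, ← map_sub]
      exact hθ0 _ fun m hm => sub_eq_zero.2 (h m hm)
    change V ((θ a).toMul : Rˣ) = V ((θ b).toMul : Rˣ)
    rw [this]

/-! ### The composition on the Grothendieck group -/

theorem isAdditive_comp (Y : SSpace) [Y.Var] (n : ℕ) :
    IsAdditive n fun X => cls (X.comp Y) n := fun X Z U _ _ _ h =>
  IsCut.cls_eq (X := X.comp Y) (Y := Z.comp Y) (U := U.comp Y) (h.comp_right Y) le_rfl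

/-- The component of degree `n` of the composition, with the two arguments in reversed order. -/
theorem exists_comp_component (n : ℕ) :
    ∃ ψ : KS → KS →+ K (Equiv.Perm (Fin n)),
      (∀ X Y : SSpace, X.Var → Y.Var → ψ (cls Y) (cls X) = cls (X.comp Y) n) ∧
      IsPolynomialOfDegreeLE n ψ ∧ ∀ b b' : KS, (∀ m ≤ n, b m = b' m) → ψ b = ψ b' := by
  classical
  choose θ hθ _ using fun Y : {Y : SSpace // Y.Var} =>
    have := Y.2
    (isAdditive_comp Y.1 n).exists_hom
  let Φ : SSpace → KS →+ K (Equiv.Perm (Fin n)) := fun Y => if h : Y.Var then θ ⟨Y, h⟩ else 0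
  have hΦ : ∀ X Y : SSpace, X.Var → Y.Var → Φ Y (cls X) = cls (X.comp Y) n := fun X Y hX hY => by
    have : Φ Y = θ ⟨Y, hY⟩ := dif_pos hY
    rw [this, hθ _ _ hX]
  have hp : IsPoly n n Φ := by
    refine ⟨fun X Y hX hY f hf hs => hom_ext fun W hW => ?_, fun X Y U hX hY hU h =>
      hom_ext fun W hW => ?_, fun {ι} _ Y hY c hc => hom_ext fun W hW => ?_⟩
    · rw [hΦ _ _ hW hX, hΦ _ _ hW hY]
      refine (cls_eq_of_hom (compHom (idHom n W) f) (compHom_imm (idHom_imm n W) hf) ?_).symm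
      intro A _ h
      rw [← Set.range_eq_univ, range_compHom]
      exact Set.eq_univ_of_forall fun z => ⟨⟨_, rfl⟩, fun q => hs _ _ _⟩
    · rw [hΦ _ _ hW hX, hΦ _ _ hW inferInstance]
      exact h.cls_comp W
    · rw [AddMonoidHom.finsetSum_apply, AddMonoidHom.zero_apply,
        ← sum_neg_one_pow_cls_comp W Y c hc]
      refine Finset.sum_congr rfl fun T _ => ?_
      rw [AddMonoidHom.smul_apply, hΦ _ _ hW inferInstance]
  obtain ⟨ψ, hψ, h1, h2⟩ := hp.exists_extension
  exact ⟨ψ, fun X Y hX hY => by rw [hψ Y hY, hΦ X Y hX hY], h1, h2⟩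

theorem isCut_add (N : ℕ) (Y U : SSpace) : IsCut N (add Y U) Y U := by
  have hr : ∀ (A : Type) [Finite A] (b : Bool),
      Set.range (Sigma.mk (β := fun b : Bool => ((cond b Y U).obj A).Pt) b) = Sigma.fst ⁻¹' {b} :=
    fun A _ b => Set.range_sigmaMk b
  refine ⟨⟨fun A _ _ y => ⟨true, y⟩, fun _ _ _ _ => rfl⟩, ⟨fun A _ _ y => ⟨false, y⟩,
    fun _ _ _ _ => rfl⟩, fun A _ _ => IsImm.sigmaMk (X := fun b : Bool => (cond b Y U).obj A) true,
    fun A _ _ => IsImm.sigmaMk (X := fun b : Bool => (cond b Y U).obj A) false, fun A _ _ =>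
      isClosed_range_sigmaMk (σ := fun b : Bool => ((cond b Y U).obj A).Pt) (i := true),
    fun A _ _ => ?_⟩
  refine (hr A false).trans (Eq.trans ?_ (congrArg compl (hr A true)).symm)
  ext ⟨b, x⟩
  change b = false ↔ ¬ b = true
  simp

theorem cls_add (Y U : SSpace) [Y.Var] [U.Var] : cls (add Y U) = cls Y + cls U :=
  funext fun n => (isCut_add n Y U).cls_eq le_rfl

/-- The elements of `F1` that are classes of `𝕊`-varieties. -/
def effective : Set F1 := {b | ∃ Y : SSpace, Y.Var ∧ IsEmpty (Y.obj (Fin 0)).Pt ∧ (b : KS) = cls Y}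

theorem exists_effective_sub (b : F1) : ∃ c ∈ effective, ∃ c' ∈ effective, b = c - c' := by
  obtain ⟨Y, Y', hY, hY', h⟩ := exists_cls_sub b
  have key : ∀ Z : SSpace, cls (Z.filter (1 ≤ ·)) ∈ F1 := fun Z =>
    cls_filter_of_not (by simp)
  have he : ∀ Z : SSpace, IsEmpty ((Z.filter (1 ≤ ·)).obj (Fin 0)).Pt := fun Z =>
    isEmpty_filter (by simp)
  refine ⟨⟨_, key Y⟩, ⟨_, inferInstance, he Y, rfl⟩, ⟨_, key Y'⟩, ⟨_, inferInstance, he Y', rfl⟩,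
    Subtype.ext (funext fun n => ?_)⟩
  change (b : KS) n = cls (Y.filter (1 ≤ ·)) n - cls (Y'.filter (1 ≤ ·)) n
  rcases Nat.eq_zero_or_pos n with rfl | hn
  · rw [cls_filter_of_not (by simp), cls_filter_of_not (by simp), sub_zero]
    exact b.2
  · rw [cls_filter (p := (1 ≤ ·)) hn, cls_filter (p := (1 ≤ ·)) hn, h]
    rfl

theorem effective_add : ∀ c ∈ effective, ∀ c' ∈ effective, c + c' ∈ effective := by
  rintro c ⟨Y, hY, he, hc⟩ c' ⟨Y', hY', he', hc'⟩
  refine ⟨add Y Y', inferInstance, ⟨?_⟩, ?_⟩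
  · rintro ⟨_ | _, y⟩
    exacts [he'.false y, he.false y]
  · rw [cls_add, ← hc, ← hc']
    rfl

/-- Polynomial maps on `F1` are determined by their values on classes. -/
theorem effective_ext {H : Type*} [AddCommGroup H] {d : ℕ} {φ ψ : F1 → H}
    (hφ : IsPolynomialOfDegreeLE d φ) (hψ : IsPolynomialOfDegreeLE d ψ)
    (h : ∀ (c : F1) (Y : SSpace), Y.Var → IsEmpty (Y.obj (Fin 0)).Pt → (c : KS) = cls Y →
      φ c = ψ c) : φ = ψ :=
  hφ.ext hψ exists_effective_sub effective_add fun c ⟨Y, hY, he, hc⟩ => h c Y hY he hc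

end SSpace

open SSpace

theorem IsPolynomialOfDegreeLE.comp_hom {G G' H : Type*} [AddCommGroup G] [AddCommGroup G']
    [AddCommGroup H] {d : ℕ} {φ : G → H} (hφ : IsPolynomialOfDegreeLE d φ) (f : G' →+ G) :
    IsPolynomialOfDegreeLE d fun g => φ (f g) := fun b h => by
  rw [← hφ (f b) fun i => f (h i)]
  refine Finset.sum_congr rfl fun T _ => ?_
  change _ • φ (f (b + _)) = _
  rw [map_add, map_sum]

theorem IsPolynomialOfDegreeLE.hom_comp {G H H' : Type*} [AddCommGroup G] [AddCommGroup H]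
    [AddCommGroup H'] {d : ℕ} {φ : G → H} (hφ : IsPolynomialOfDegreeLE d φ) (f : H →+ H') :
    IsPolynomialOfDegreeLE d fun g => f (φ g) := fun b h => by
  rw [← map_zero f, ← hφ b h, map_sum]
  exact Finset.sum_congr rfl fun T _ => (map_zsmul f _ _).symm

theorem isPolynomialOfDegreeLE_zero {G H : Type*} [AddCommGroup G] [AddCommGroup H] (d : ℕ) :
    IsPolynomialOfDegreeLE d fun _ : G => (0 : H) := fun _ _ =>
  Finset.sum_eq_zero fun _ _ => smul_zero _

theorem isPolynomialOfDegreeLE_hom {G H : Type*} [AddCommGroup G] [AddCommGroup H] (f : G →+ H) :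
    IsPolynomialOfDegreeLE 1 f := fun b h => by
  have : (Finset.univ : Finset (Finset (Fin 2))) = {∅, {0}, {1}, {0, 1}} := by decide
  rw [this, Finset.sum_insert (by decide), Finset.sum_insert (by decide),
    Finset.sum_insert (by decide), Finset.sum_singleton]
  have h01 : (0 : Fin 2) ≠ 1 := by decide
  simp only [Finset.sum_empty, Finset.card_empty, Finset.card_singleton, Finset.sum_singleton,
    Finset.sum_pair h01, Finset.card_pair h01, map_add, pow_zero, pow_one, neg_one_sq, one_smul,
    neg_smul, add_zero]
  abel

/-- The properties that determine the composition. -/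
structure IsPreComposition (op : KS →+ (F1 → KS)) : Prop where
  cls_comp (X Y : SSpace) (hX : X.Var) (hY : Y.Var) (hempty : IsEmpty (Y.obj (Fin 0)).Pt) (b : F1)
    (hb : (b : KS) = cls Y) : op (cls X) b = cls (X.comp Y)
  polynomial (a : KS) (n : ℕ) : IsPolynomialOfDegreeLE n fun b : F1 => op a b n

theorem IsComposition.isPreComposition {op : KS →+ (F1 → KS)} (h : IsComposition op) :
    IsPreComposition op :=
  ⟨fun X Y hX hY he b hb => (h.cls_comp X Y hX.out hY.out he b hb).2, h.polynomial⟩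

/-- A component of `a ∘ b` as a function of `a`. -/
def opEval (op : KS →+ (F1 → KS)) (b : F1) (n : ℕ) : KS →+ K (Equiv.Perm (Fin n)) :=
  ((Pi.evalAddMonoidHom _ n).comp (Pi.evalAddMonoidHom _ b)).comp op

theorem IsPreComposition.unique {op op' : KS →+ (F1 → KS)} (h : IsPreComposition op)
    (h' : IsPreComposition op') : op = op' := by
  have key : ∀ b n, opEval op b n = opEval op' b n := fun b n => hom_ext fun X hX =>
    congrFun (effective_ext (h.polynomial (cls X) n) (h'.polynomial (cls X) n)
      fun c Y hY he hc => by rw [h.cls_comp X Y hX hY he c hc, h'.cls_comp X Y hX hY he c hc]) b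
  ext a b n
  exact DFunLike.congr_fun (key b n) a

/-- The composition exists, and a component of `a ∘ b` depends only on the components of `b` in the
same and in lower degrees. -/
theorem exists_isPreComposition : ∃ op : KS →+ (F1 → KS), IsPreComposition op ∧
    ∀ (a : KS) (b b' : F1) (n : ℕ), (∀ m ≤ n, (b : KS) m = (b' : KS) m) → op a b n = op a b' n := by
  choose ψ hψ hp hl using exists_comp_component
  refine ⟨AddMonoidHom.mk' (fun a b n => ψ n b a) fun a a' => ?_, ⟨?_, ?_⟩, ?_⟩
  · funext b n
    exact map_add (ψ n b) a a'
  · intro X Y hX hY _ b hb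
    funext n
    change ψ n b (cls X) = _
    rw [hb, hψ n X Y hX hY]
  · intro a n
    exact ((hp n).comp_hom F1.subtype).hom_comp (AddMonoidHom.eval a)
  · intro a b b' n h
    exact DFunLike.congr_fun (hl n b b' h) a

namespace IsPreComposition

/-- A component of `a ∘ b` depends only on the components of `b` of the same and of lower
degrees. -/
theorem congr_right {op : KS →+ (F1 → KS)} (h : IsPreComposition op) (a : KS)
    {b b' : F1} {n : ℕ} (hb : ∀ m ≤ n, (b : KS) m = (b' : KS) m) :
    op a b n = op a b' n := by
  obtain ⟨op', h', hl⟩ := exists_isPreComposition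
  rw [h.unique h']
  exact hl a b b' n hb

/-- A component of `a ∘ b` depends only on the components of `a` of the same and of lower degrees,
because a set has at most as many blocks as elements. -/
theorem eq_zero_of_left {op : KS →+ (F1 → KS)} (h : IsPreComposition op) {a : KS}
    {n : ℕ} (ha : ∀ m ≤ n, a m = 0) (b : F1) : op a b n = 0 := by
  refine congrFun (effective_ext (h.polynomial a n) (isPolynomialOfDegreeLE_zero n)
    fun c Y hY he hc => ?_) b
  obtain ⟨θ, hθ, h0⟩ := (isAdditive_comp Y n).exists_hom
  have : opEval op c n = θ := hom_ext fun X hX => by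
    rw [hθ X hX, ← h.cls_comp X Y hX hY he c hc]
    rfl
  exact (DFunLike.congr_fun this a).trans (h0 a ha)

theorem congr_left {op : KS →+ (F1 → KS)} (h : IsPreComposition op) {a a' : KS}
    {n : ℕ} (ha : ∀ m ≤ n, a m = a' m) (b : F1) :
    op a b n = op a' b n := by
  have := h.eq_zero_of_left (a := a - a') (n := n) (fun m hm => sub_eq_zero.2 (ha m hm)) b
  rw [map_sub] at this
  exact sub_eq_zero.1 this

theorem mem_F1 {op : KS →+ (F1 → KS)} (h : IsPreComposition op) (b c : F1) : op b c ∈ F1 :=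
  h.eq_zero_of_left (fun m hm => by rw [Nat.le_zero.1 hm]; exact b.2) c

/-- The composition on `F1`, as a homomorphism in the first argument. -/
def opF1 {op : KS →+ (F1 → KS)} (h : IsPreComposition op) (c : F1) : F1 →+ F1 :=
  AddMonoidHom.mk' (fun b => ⟨op b c, h.mem_F1 b c⟩) fun b b' => Subtype.ext (by
    change op ((b : KS) + b') c = op b c + op b' c
    rw [map_add]
    rfl)

end IsPreComposition

namespace SSpace

/-! ### Associativity of the composition -/

/-- The partition of `A` obtained from a partition `s` by joining its blocks along a partition `t`
of the set of blocks. -/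
abbrev coarse {A : Type} (s : Setoid A) (t : Setoid (Quotient s)) : Setoid A :=
  t.comap (Quotient.mk s)

/-- The partition of a block of `coarse s t` into blocks of `s`. -/
abbrev fine {A : Type} (s : Setoid A) (t : Setoid (Quotient s)) (p : Quotient (coarse s t)) :
    Setoid (Block (coarse s t) p) :=
  s.comap Subtype.val

/-- The blocks of `coarse s t` are the blocks of `t`. -/
def coarseQuot {A : Type} (s : Setoid A) (t : Setoid (Quotient s)) :
    Quotient (coarse s t) ≃ Quotient t :=
  Equiv.ofBijective (Quotient.map' (Quotient.mk s) fun _ _ h => h) (by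
    constructor
    · rintro ⟨a⟩ ⟨b⟩ h
      exact Quotient.sound (s := coarse s t) (Quotient.exact (s := t) (a := Quotient.mk s a)
        (b := Quotient.mk s b) h)
    · rintro ⟨⟨a⟩⟩
      exact ⟨Quotient.mk _ a, rfl⟩)

/-- The blocks of `s` in a block of `coarse s t` are the elements of the block of `t`. -/
def fineQuot {A : Type} (s : Setoid A) (t : Setoid (Quotient s)) (p : Quotient (coarse s t)) :
    Quotient (fine s t p) ≃ Block t (coarseQuot s t p) :=
  Equiv.ofBijective (Quotient.lift (fun a : Block (coarse s t) p =>
      (⟨Quotient.mk s a.1, congrArg (coarseQuot s t) a.2⟩ : Block t (coarseQuot s t p)))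
      fun _ _ h => Subtype.ext (Quotient.sound (s := s) h)) (by
    constructor
    · rintro ⟨a⟩ ⟨b⟩ h
      exact Quotient.sound (s := fine s t p) (Quotient.exact (s := s) (a := a.1) (b := b.1)
        (congrArg Subtype.val h))
    · rintro ⟨⟨a⟩, ha⟩
      exact ⟨Quotient.mk _ ⟨a, (coarseQuot s t).injective ha⟩, rfl⟩)

/-- The blocks of `fine s t p` are blocks of `s`. -/
def fineBlock {A : Type} (s : Setoid A) (t : Setoid (Quotient s)) (p : Quotient (coarse s t))
    (q : Quotient (fine s t p)) : Block (fine s t p) q ≃ Block s (fineQuot s t p q).1 :=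
  Equiv.ofBijective (fun a => ⟨a.1.1, congrArg (fun q => (fineQuot s t p q).1) a.2⟩) (by
    constructor
    · intro a b h
      exact Subtype.ext (Subtype.ext (Subtype.mk.inj h))
    · rintro ⟨a, ha⟩
      have hp : Quotient.mk (coarse s t) a = p := by
        refine (coarseQuot s t).injective ((?_ : _ = Quotient.mk t (fineQuot s t p q).1).trans
          (fineQuot s t p q).2)
        rw [← ha]
        rfl
      exact ⟨⟨⟨a, hp⟩, (fineQuot s t p).injective (Subtype.ext ha)⟩, rfl⟩)

theorem map_symm_comm (X : SSpace) {A B C D : Type} [Finite A] [Finite B] [Finite C] [Finite D]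
    {g : A ≃ B} {f : A ≃ C} {f' : B ≃ D} {g' : C ≃ D} (h : ∀ a, g' (f a) = f' (g a))
    (x : (X.obj B).Pt) : X.map f (X.map g.symm x) = X.map g'.symm (X.map f' x) := by
  refine X.map_map_eq (fun b => ?_) x
  rw [Equiv.eq_symm_apply, h, Equiv.apply_symm_apply]

/-- The canonical map from `(X ∘ Y) ∘ Z` to `X ∘ (Y ∘ Z)`. -/
def assocFun (X Y Z : SSpace) (A : Type) [Finite A] (z : compPt (X.comp Y) Z A) :
    compPt X (Y.comp Z) A :=
  ⟨coarse z.1 z.2.1.1, X.map (coarseQuot z.1 z.2.1.1).symm z.2.1.2.1, fun p =>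
    ⟨fine z.1 z.2.1.1 p, Y.map (fineQuot z.1 z.2.1.1 p).symm (z.2.1.2.2 (coarseQuot z.1 z.2.1.1 p)),
      fun q => Z.map (fineBlock z.1 z.2.1.1 p q).symm (z.2.2 (fineQuot z.1 z.2.1.1 p q).1)⟩⟩

/-- The canonical map from `(X ∘ Y) ∘ Z` to `X ∘ (Y ∘ Z)`. -/
def assocHom (N : ℕ) (X Y Z : SSpace) : Hom N ((X.comp Y).comp Z) (X.comp (Y.comp Z)) where
  app A _ _ := assocFun X Y Z A
  nat {A B} _ _ _ _ e z := by
    obtain ⟨s, ⟨t, x, y⟩, z⟩ := z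
    refine Sigma.ext rfl (heq_of_eq (Prod.ext ?_ (funext ?_)))
    · refine (X.map_symm_comm ?_ x).symm
      rintro ⟨a⟩
      rfl
    · rintro ⟨b⟩
      refine Sigma.ext rfl (heq_of_eq (Prod.ext ?_ (funext ?_)))
      · refine (Y.map_symm_comm ?_ _).symm
        rintro ⟨a⟩
        exact Subtype.ext rfl
      · rintro ⟨b'⟩
        refine (Z.map_symm_comm ?_ _).symm
        rintro a
        exact Subtype.ext rfl

/-- Sections over the target of a bijection may be prescribed over its source. -/
theorem exists_section {I J : Type*} {f : I → J} (hf : Function.Bijective f) {P : J → Type*}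
    {Q : I → Type*} (m : ∀ i, P (f i) → Q i) (hm : ∀ i, Function.Surjective (m i)) (u : ∀ i, Q i) :
    ∃ v : ∀ j, P j, ∀ i, m i (v (f i)) = u i := by
  have : ∀ j, ∃ v : P j, ∀ i (h : f i = j), m i (h ▸ v) = u i := by
    intro j
    obtain ⟨i, rfl⟩ := hf.2 j
    obtain ⟨v, hv⟩ := hm i (u i)
    exact ⟨v, fun i' h => by obtain rfl := hf.1 h; exact hv⟩
  choose v hv using this
  exact ⟨v, fun i => hv _ i rfl⟩

/-- The relation on `A` given by partitions of the blocks of a partition. -/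
def fineRel {A : Type} (r : Setoid A) (σ : ∀ p : Quotient r, Setoid (Block r p)) (a b : A) : Prop :=
  ∃ h : Quotient.mk r b = Quotient.mk r a, σ (Quotient.mk r a) ⟨a, rfl⟩ ⟨b, h⟩

theorem fineRel_iff {A : Type} {r : Setoid A} {σ : ∀ p : Quotient r, Setoid (Block r p)}
    {p : Quotient r} (a b : Block r p) : fineRel r σ a.1 b.1 ↔ σ p a b := by
  obtain ⟨a, rfl⟩ := a
  exact ⟨fun ⟨_, h⟩ => h, fun h => ⟨b.2, h⟩⟩

/-- Partitions of the blocks of a partition `r` form a partition `s` that `r` coarsens. -/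
theorem exists_coarse_fine {A : Type} (r : Setoid A) (σ : ∀ p : Quotient r, Setoid (Block r p)) :
    ∃ (s : Setoid A) (t : Setoid (Quotient s)), coarse s t = r ∧
      ∀ p (a b : Block r p), σ p a b ↔ s a.1 b.1 := by
  let s : Setoid A :=
    { r := fineRel r σ
      iseqv :=
        { refl := fun a => ⟨rfl, (σ _).refl _⟩
          symm := fun {a b} ⟨h, hab⟩ =>
            (fineRel_iff (p := Quotient.mk r a) ⟨b, h⟩ ⟨a, rfl⟩).2 ((σ _).symm hab)
          trans := fun {a b c} ⟨h, hab⟩ ⟨h', hbc⟩ =>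
            (fineRel_iff (p := Quotient.mk r a) ⟨a, rfl⟩ ⟨c, h'.trans h⟩).2
              ((σ _).trans hab ((fineRel_iff (p := Quotient.mk r a) ⟨b, h⟩ ⟨c, h'.trans h⟩).1
                ⟨h', hbc⟩)) } }
  refine ⟨s, Setoid.ker (Quotient.lift (Quotient.mk r) fun a b (h : fineRel r σ a b) => h.1.symm),
    Setoid.ext fun a b => ?_, fun p a b => (fineRel_iff a b).symm⟩
  exact ⟨fun h => Quotient.exact (s := r) h, fun h => Quotient.sound (s := r) h⟩

/-- A partition of a set of blocks is determined by the two-step partition that it defines. -/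
theorem eq_of_coarse_eq_of_fine {A : Type} {s s' : Setoid A} {t : Setoid (Quotient s)}
    {t' : Setoid (Quotient s')} (h : coarse s t = coarse s' t')
    (h' : fineRel (coarse s t) (fine s t) = fineRel (coarse s' t') (fine s' t')) :
    (⟨s, t⟩ : Σ s : Setoid A, Setoid (Quotient s)) = ⟨s', t'⟩ := by
  have key : ∀ (s : Setoid A) (t : Setoid (Quotient s)) (a b : A),
      fineRel (coarse s t) (fine s t) a b ↔ s a b := fun s t a b =>
    ⟨fun ⟨_, h⟩ => h, fun h => ⟨Quotient.sound (s := coarse s t)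
      ((Quotient.sound (s := s) (s.symm h) : Quotient.mk s b = Quotient.mk s a) ▸ t.refl _ :
        t (Quotient.mk s b) (Quotient.mk s a)), h⟩⟩
  obtain rfl : s = s' := Setoid.ext fun a b => by rw [← key s t, h', key]
  obtain rfl : t = t' := Setoid.ext (by
    rintro ⟨a⟩ ⟨b⟩
    exact Setoid.ext_iff.1 h a b)
  rfl

/-- The part of the domain of `assocFun` that belongs to fixed partitions. -/
abbrev assocPart (X Y Z : SSpace) {A : Type} [Finite A] (s : Setoid A) (t : Setoid (Quotient s)) :
    RegSpace :=
  RegSpace.prod (compPart X Y t) (RegSpace.pi fun q : Quotient s => Z.obj (Block s q))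

/-- The part of the codomain of `assocFun` that belongs to fixed partitions. -/
abbrev assocPart' (X Y Z : SSpace) {A : Type} [Finite A] (s : Setoid A) (t : Setoid (Quotient s)) :
    RegSpace :=
  RegSpace.prod (X.obj (Quotient (coarse s t)))
    (RegSpace.pi fun p : Quotient (coarse s t) => compPart Y Z (fine s t p))

/-- The restriction of `assocFun` to the part that belongs to fixed partitions. -/
def assocPartFun (X Y Z : SSpace) {A : Type} [Finite A] (s : Setoid A) (t : Setoid (Quotient s))
    (d : (assocPart X Y Z s t).Pt) : (assocPart' X Y Z s t).Pt :=
  (X.map (coarseQuot s t).symm d.1.1, fun p =>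
    (Y.map (fineQuot s t p).symm (d.1.2 (coarseQuot s t p)),
      fun q => Z.map (fineBlock s t p q).symm (d.2 (fineQuot s t p q).1)))

/-- Each block of `s` is a block of exactly one of the partitions `fine s t p`. -/
theorem bijective_fineQuot {A : Type} (s : Setoid A) (t : Setoid (Quotient s)) :
    Function.Bijective fun i : Σ p, Quotient (fine s t p) => (fineQuot s t i.1 i.2).1 := by
  constructor
  · rintro ⟨p, q⟩ ⟨p', q'⟩ h
    change (fineQuot s t p q).1 = (fineQuot s t p' q').1 at h
    obtain rfl : p = p' := (coarseQuot s t).injective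
      ((fineQuot s t p q).2.symm.trans ((congrArg _ h).trans (fineQuot s t p' q').2))
    rw [(fineQuot s t p).injective (Subtype.ext h)]
  · rintro ⟨a⟩
    exact ⟨⟨Quotient.mk _ a, Quotient.mk _ ⟨a, rfl⟩⟩, rfl⟩

theorem assocPartFun_imm (X Y Z : SSpace) [X.Var] [Y.Var] [Z.Var] {A : Type} [Finite A]
    (s : Setoid A) (t : Setoid (Quotient s)) :
    IsImm (assocPart X Y Z s t) (assocPart' X Y Z s t) (assocPartFun X Y Z s t) := by
  have h1 := isMorphism_fst (compPart X Y t) (RegSpace.pi fun q : Quotient s => Z.obj (Block s q))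
  have h2 := isMorphism_snd (compPart X Y t) (RegSpace.pi fun q : Quotient s => Z.obj (Block s q))
  have h3 := isMorphism_fst (X.obj (Quotient t)) (RegSpace.pi fun p => Y.obj (Block t p))
  have h4 := isMorphism_snd (X.obj (Quotient t)) (RegSpace.pi fun p => Y.obj (Block t p))
  have h5 := isMorphism_fst (X.obj (Quotient (coarse s t)))
    (RegSpace.pi fun p : Quotient (coarse s t) => compPart Y Z (fine s t p))
  have h6 := isMorphism_snd (X.obj (Quotient (coarse s t)))
    (RegSpace.pi fun p : Quotient (coarse s t) => compPart Y Z (fine s t p))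
  have h7 := fun p => (isMorphism_apply
    (X := fun p : Quotient (coarse s t) => compPart Y Z (fine s t p)) p).comp h6
  refine ⟨?_, ?_, ?_⟩
  · rintro ⟨⟨x, y⟩, z⟩ ⟨⟨x', y'⟩, z'⟩ h
    have hx : x = x' := X.map_injective _ (congrArg Prod.fst h)
    have hp := fun p => congrFun (congrArg Prod.snd h) p
    have hy : y = y' := funext fun p => by
      obtain ⟨p, rfl⟩ := (coarseQuot s t).surjective p
      exact Y.map_injective _ (congrArg Prod.fst (hp p))
    have hz : z = z' := funext fun q => by
      obtain ⟨⟨p, q⟩, rfl⟩ := (bijective_fineQuot s t).2 q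
      exact Z.map_injective _ (congrFun (congrArg Prod.snd (hp p)) q)
    rw [hx, hy, hz]
  · exact isMorphism_prod ((X.isMorphism_map (coarseQuot s t).symm).comp (h3.comp h1))
      (isMorphism_pi fun p => isMorphism_prod
        ((Y.isMorphism_map (fineQuot s t p).symm).comp
          ((isMorphism_apply (X := fun p => Y.obj (Block t p)) (coarseQuot s t p)).comp
            (h4.comp h1)))
        (isMorphism_pi fun q => (Z.isMorphism_map (fineBlock s t p q).symm).comp
          ((isMorphism_apply (X := fun q => Z.obj (Block s q)) (fineQuot s t p q).1).comp h2)))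
  · intro W _ χ hχ
    refine isMorphism_prod (isMorphism_prod ?_ (isMorphism_pi fun p => ?_))
      (isMorphism_pi fun q => ?_)
    · exact (X.isImm_map (coarseQuot s t).symm).lift W (fun w => (χ w).1.1) (h5.comp hχ)
    · obtain ⟨p, rfl⟩ := (coarseQuot s t).surjective p
      exact (Y.isImm_map (fineQuot s t p).symm).lift W (fun w => (χ w).1.2 (coarseQuot s t p))
        ((isMorphism_fst (Y.obj (Quotient (fine s t p)))
          (RegSpace.pi fun q => Z.obj (Block (fine s t p) q))).comp ((h7 p).comp hχ))
    · obtain ⟨⟨p, q⟩, rfl⟩ := (bijective_fineQuot s t).2 q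
      exact (Z.isImm_map (fineBlock s t p q).symm).lift W (fun w => (χ w).2 (fineQuot s t p q).1)
        ((isMorphism_apply (X := fun q => Z.obj (Block (fine s t p) q)) q).comp
          ((isMorphism_snd (Y.obj (Quotient (fine s t p)))
            (RegSpace.pi fun q => Z.obj (Block (fine s t p) q))).comp ((h7 p).comp hχ)))

theorem assocPartFun_surjective (X Y Z : SSpace) {A : Type} [Finite A]
    (s : Setoid A) (t : Setoid (Quotient s)) : Function.Surjective (assocPartFun X Y Z s t) := by
  rintro ⟨x, w⟩
  obtain ⟨y, hy⟩ := exists_section (coarseQuot s t).bijective (P := fun p => (Y.obj (Block t p)).Pt)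
    (fun p => Y.map (fineQuot s t p).symm) (fun p => Y.map_surjective _) fun p => (w p).1
  obtain ⟨z, hz⟩ := exists_section (bijective_fineQuot s t) (P := fun q => (Z.obj (Block s q)).Pt)
    (fun i => Z.map (fineBlock s t i.1 i.2).symm) (fun i => Z.map_surjective _)
    fun i => (w i.1).2 i.2
  exact ⟨((X.map (coarseQuot s t) x, y), z), Prod.ext (X.map_symm_map _ _) (funext fun p =>
    Prod.ext (hy p) (funext fun q => hz ⟨p, q⟩))⟩

theorem assocHom_surj (N : ℕ) (X Y Z : SSpace) : (assocHom N X Y Z).Surj := by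
  rintro A _ _ ⟨r, x, w⟩
  obtain ⟨s, t, rfl, h⟩ := exists_coarse_fine r fun p => (w p).1
  have key : ∀ p (v : compPt Y Z (Block (coarse s t) p)), v.1 = fine s t p →
      ∃ w' : (compPart Y Z (fine s t p)).Pt, v = ⟨fine s t p, w'⟩ := by
    rintro p ⟨σ, w'⟩ h
    change σ = fine s t p at h
    subst h
    exact ⟨w', rfl⟩
  choose w' hw using fun p => key p (w p) (Setoid.ext fun a b => h p a b)
  obtain rfl : w = fun p => ⟨fine s t p, w' p⟩ := funext hw
  obtain ⟨d, hd⟩ := assocPartFun_surjective X Y Z s t (x, w')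
  have h1 : (assocPartFun X Y Z s t d).1 = x := congrArg Prod.fst hd
  have h2 : ∀ p, (assocPartFun X Y Z s t d).2 p = w' p := congrFun (congrArg Prod.snd hd)
  exact ⟨⟨s, ⟨t, d.1⟩, d.2⟩, Sigma.ext rfl (heq_of_eq (Prod.ext h1
    (funext fun p => Sigma.ext rfl (heq_of_eq (h2 p)))))⟩

theorem assocHom_imm (N : ℕ) (X Y Z : SSpace) [X.Var] [Y.Var] [Z.Var] :
    (assocHom N X Y Z).Imm := by
  intro A _ _
  let j : ∀ k : Σ s : Setoid A, Setoid (Quotient s), (assocPart X Y Z k.1 k.2).Pt →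
    compPt (X.comp Y) Z A := fun k d => ⟨k.1, ⟨k.2, d.1⟩, d.2⟩
  have hidx : ∀ k k' d d', (assocFun X Y Z A (j k d)).1 = (assocFun X Y Z A (j k' d')).1 →
      fineRel _ (fun p => ((assocFun X Y Z A (j k d)).2.2 p).1) =
        fineRel _ (fun p => ((assocFun X Y Z A (j k' d')).2.2 p).1) → k = k' :=
    fun k k' d d' h h' => eq_of_coarse_eq_of_fine h h'
  have hcov : ∀ z, ∃ k, z ∈ Set.range (j k) := fun z => ⟨⟨z.1, z.2.1.1⟩, (z.2.1.2, z.2.2), rfl⟩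
  have hj' : ∀ k, IsImm (assocPart X Y Z k.1 k.2) ((X.comp (Y.comp Z)).obj A)
      (assocFun X Y Z A ∘ j k) := fun k =>
    (isImm_compPart X (Y.comp Z) (coarse k.1 k.2)).comp
      (((IsImm.id (X.obj (Quotient (coarse k.1 k.2)))).prod
        (IsImm.pi fun p => isImm_compPart Y Z (fine k.1 k.2 p))).comp
          (assocPartFun_imm X Y Z k.1 k.2))
  refine isImm_of_charts (X := ((X.comp Y).comp Z).obj A) ?_
    (D := fun k : Σ s : Setoid A, Setoid (Quotient s) => assocPart X Y Z k.1 k.2) j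
    (fun k => (isImm_compPart (X.comp Y) Z k.1).comp ((isImm_compPart X Y k.2).prod (IsImm.id _)))
    ?_ hcov hj' ?_
  · intro z z' h
    obtain ⟨k, d, rfl⟩ := hcov z
    obtain ⟨k', d', rfl⟩ := hcov z'
    obtain rfl := hidx k k' d d' (congrArg Sigma.fst h)
      (congrArg (fun v : compPt X (Y.comp Z) A => fineRel v.1 fun p => (v.2.2 p).1) h)
    rw [(hj' k).inj h]
  · rintro ⟨s, t⟩
    have h1 : IsOpen {p : (compPart (X.comp Y) Z s).Pt | p.1.1 = t} :=
      (isOpen_sigma_fst_preimage (σ := fun t : Setoid (Quotient s) => (compPart X Y t).Pt)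
        {t}).preimage (isMorphism_fst ((X.comp Y).obj (Quotient s)) _).1
    refine (congrArg (@IsOpen _ (((X.comp Y).comp Z).obj A).top) ?_).mpr
      (isOpenMap_sigmaMk (σ := fun s : Setoid A => (compPart (X.comp Y) Z s).Pt) _ h1)
    ext z
    constructor
    · rintro ⟨d, rfl⟩
      exact ⟨(⟨t, d.1⟩, d.2), rfl, rfl⟩
    · rintro ⟨⟨⟨t', x⟩, z⟩, rfl, rfl⟩
      exact ⟨(x, z), rfl⟩
  · rintro ⟨s, t⟩
    have h1 : IsOpen {p : (compPart X (Y.comp Z) (coarse s t)).Pt |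
        ∀ q, (p.2 q).1 = fine s t q} := by
      have : {p : (compPart X (Y.comp Z) (coarse s t)).Pt | ∀ q, (p.2 q).1 = fine s t q} =
          ⋂ q, {p | (p.2 q).1 = fine s t q} := by
        ext p
        simp only [Set.mem_iInter]
        rfl
      rw [this]
      refine isOpen_iInter_of_finite fun q => ?_
      exact (isOpen_sigma_fst_preimage (σ := fun σ : Setoid (Block (coarse s t) q) =>
        (compPart Y Z σ).Pt) {fine s t q}).preimage
          ((isMorphism_apply (X := fun q => (Y.comp Z).obj (Block (coarse s t) q)) q).comp
            (isMorphism_snd (X.obj (Quotient (coarse s t))) _)).1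
    refine ⟨_, isOpenMap_sigmaMk (σ := fun s : Setoid A => (compPart X (Y.comp Z) s).Pt) _ h1, ?_⟩
    ext v
    constructor
    · rintro ⟨⟨p, hp, hv⟩, z, rfl⟩
      obtain ⟨k, d, rfl⟩ := hcov z
      have h2 : (fun q => (p.2 q).1) = fine s t := funext hp
      obtain rfl : k = ⟨s, t⟩ := by
        refine eq_of_coarse_eq_of_fine (congrArg Sigma.fst hv).symm
          ((congrArg (fun v : compPt X (Y.comp Z) A => fineRel v.1 fun p => (v.2.2 p).1)
            hv).symm.trans ?_)
        exact congrArg (fineRel (coarse s t)) h2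
      exact ⟨d, rfl⟩
    · rintro ⟨d, rfl⟩
      exact ⟨⟨_, fun q => rfl, rfl⟩, _, rfl⟩

theorem cls_comp_assoc (X Y Z : SSpace) [X.Var] [Y.Var] [Z.Var] :
    cls ((X.comp Y).comp Z) = cls (X.comp (Y.comp Z)) :=
  funext fun n => cls_eq_of_hom (assocHom n X Y Z) (assocHom_imm n X Y Z) (assocHom_surj n X Y Z)
    |>.symm

theorem isEmpty_comp {X Y : SSpace} [hX : IsEmpty (X.obj (Fin 0)).Pt] :
    IsEmpty ((X.comp Y).obj (Fin 0)).Pt := by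
  refine ⟨fun z : compPt X Y (Fin 0) => ?_⟩
  have : IsEmpty (Quotient z.1) := ⟨fun q => q.exists_rep.elim fun a _ => a.elim0⟩
  exact hX.false (X.map (Equiv.equivOfIsEmpty _ _) z.2.1)

end SSpace

namespace IsPreComposition

/-- Applying `- ∘ c` to a polynomial map preserves the degree, as it is additive and as its
components depend only on those in the same and in lower degrees. -/
theorem isPolynomial_comp_left {op : KS →+ (F1 → KS)} (h : IsPreComposition op) (a : KS) (c : F1)
    (n : ℕ) : IsPolynomialOfDegreeLE n fun b : F1 => op (op a b) c n := fun b g => by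
  have h1 : ∑ T : Finset (Fin (n + 1)), (-1 : ℤ) ^ T.card •
        opEval op c n (op a (b + ∑ i ∈ T, g i)) =
      opEval op c n (∑ T : Finset (Fin (n + 1)), (-1 : ℤ) ^ T.card • op a (b + ∑ i ∈ T, g i)) := by
    rw [map_sum]
    exact Finset.sum_congr rfl fun T _ => (map_zsmul _ _ _).symm
  refine h1.trans (h.eq_zero_of_left (fun m hm => ?_) c)
  rw [Finset.sum_apply]
  exact (h.polynomial a m).mono hm b g

/-- Associativity if the third argument is the class of an `𝕊`-variety. -/
theorem assoc_effective {op : KS →+ (F1 → KS)} (h : IsPreComposition op) (a : KS) (b c : F1)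
    (hc : c ∈ effective) : op (op a b) c = op a (h.opF1 c b) := by
  obtain ⟨Z, hZ, hZe, hcZ⟩ := hc
  funext n
  have key : (opEval op c n).comp (AddMonoidHom.mk' (fun a => op a b) fun a a' => by
      rw [map_add]; rfl) = opEval op (h.opF1 c b) n := by
    refine hom_ext fun X hX => congrFun (effective_ext (φ := fun b => op (op (cls X) b) c n)
      (ψ := fun b => op (cls X) (h.opF1 c b) n) (h.isPolynomial_comp_left _ _ _)
      ((h.polynomial (cls X) n).comp_hom (h.opF1 c)) fun b Y hY hYe hbY => ?_) b
    have h1 : ((h.opF1 c b : F1) : KS) = cls (Y.comp Z) := by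
      rw [← h.cls_comp Y Z hY hZ hZe c hcZ, ← hbY]
      rfl
    change op (op (cls X) b) c n = op (cls X) (h.opF1 c b) n
    rw [h.cls_comp X Y hX hY hYe b hbY, h.cls_comp (X.comp Y) Z inferInstance hZ hZe c hcZ,
      h.cls_comp X (Y.comp Z) hX inferInstance isEmpty_comp _ h1, cls_comp_assoc]
  exact DFunLike.congr_fun key a

theorem assoc {op : KS →+ (F1 → KS)} (h : IsPreComposition op) (a : KS) (b c : F1) :
    op (op a b) c = op a (h.opF1 c b) := by
  obtain ⟨c, hc, c', hc', rfl⟩ := exists_effective_sub c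
  have hk : ∀ k : ℕ, c - c' + (k + 1) • c' ∈ effective := fun k => by
    induction k with
    | zero => simpa using hc
    | succ k ih =>
      rw [succ_nsmul, ← add_assoc]
      exact effective_add _ ih _ hc'
  funext n
  -- both sides depend polynomially on `k` if `c - c'` is replaced by `c - c' + k • c'`
  let f : ℕ → F1 := fun k => h.opF1 (c - c' + k • c') b
  have hf : ∀ k, ∀ m ≤ n, ((f k : F1) : KS) m =
      ((∑ i ∈ Finset.range (n + 1), k.choose i • (fwdDiff 1)^[i] f 0 : F1) : KS) m := by
    intro k m hm
    let e : F1 →+ K (Equiv.Perm (Fin m)) := (Pi.evalAddMonoidHom _ m).comp F1.subtype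
    change _ = e _
    rw [map_sum]
    refine (((h.polynomial b m).mono hm).apply_add_nsmul (c - c') c' k).trans
      (Finset.sum_congr rfl fun i _ => ?_)
    rw [map_nsmul, fwdDiff_iter_zero, fwdDiff_iter_zero, map_sum]
    refine congrArg _ (Finset.sum_congr rfl fun j _ => ?_)
    rw [map_zsmul]
    rfl
  have h1 := eq_of_eventually_fwdDiff_iter
    (f := fun k : ℕ => op (op a b) (c - c' + k • c') n) (g := fun k => op a (f k) n)
    ((eventually_gt_atTop n).mono fun m hm => (h.polynomial (op a b) n).fwdDiff_iter_eq_zero hm _ _)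
    ?_ fun k hk' => ?_
  · simpa [f] using h1
  · refine ((h.polynomial a n).eventually_fwdDiff_iter (n + 1) fun i => (fwdDiff 1)^[i] f 0).mono
      fun D hD => Eq.trans ?_ hD
    refine congrArg (fun F => (fwdDiff 1)^[D] F 0) (funext fun k => ?_)
    exact h.congr_right a (hf k)
  · obtain ⟨k, rfl⟩ : ∃ j, k = j + 1 := ⟨k - 1, by omega⟩
    exact congrFun (h.assoc_effective a b _ (hk k)) n

theorem isComposition {op : KS →+ (F1 → KS)} (h : IsPreComposition op) : IsComposition op where
  cls_comp X Y hX hY he b hb :=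
    have : X.Var := ⟨hX⟩
    have : Y.Var := ⟨hY⟩
    ⟨(inferInstance : (X.comp Y).Var).out, h.cls_comp X Y ⟨hX⟩ ⟨hY⟩ he b hb⟩
  polynomial := h.polynomial
  assoc a b c := ⟨h.opF1 c b, rfl, h.assoc a b c⟩

end IsPreComposition

theorem existsUnique_isComposition : ∃! op : KS →+ (F1 → KS), IsComposition op := by
  obtain ⟨op, h, -⟩ := exists_isPreComposition
  exact ⟨op, h.isComposition, fun op' h' => h'.isPreComposition.unique h⟩

namespace SSpace

/-! ### The product on the Grothendieck group -/

theorem isAdditive_box (X : SSpace) [X.Var] (n : ℕ) : IsAdditive n fun Y => cls (X.box Y) n :=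
  fun Y Z U _ _ _ h => IsCut.cls_eq (X := X.box Y) (Y := X.box Z) (U := X.box U) (h.box_left X)
    le_rfl

/-- The component of degree `n` of the product. -/
theorem exists_box_component (n : ℕ) : ∃ θ : KS →+ KS →+ K (Equiv.Perm (Fin n)),
    ∀ X Y : SSpace, X.Var → Y.Var → θ (cls X) (cls Y) = cls (X.box Y) n := by
  classical
  choose β hβ _ using fun X : {X : SSpace // X.Var} =>
    have := X.2
    (isAdditive_box X.1 n).exists_hom
  let Φ : SSpace → KS →+ K (Equiv.Perm (Fin n)) := fun X => if h : X.Var then β ⟨X, h⟩ else 0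
  have hΦ : ∀ X Y : SSpace, X.Var → Y.Var → Φ X (cls Y) = cls (X.box Y) n := fun X Y hX hY => by
    have : Φ X = β ⟨X, hX⟩ := dif_pos hX
    rw [this, hβ _ _ hY]
  have hadd : IsAdditive n Φ := fun X Y U hX hY hU h => hom_ext fun Z hZ => by
    rw [AddMonoidHom.add_apply, hΦ _ _ hX hZ, hΦ _ _ hY hZ, hΦ _ _ hU hZ]
    exact (h.box_right Z).cls_eq le_rfl
  obtain ⟨θ, hθ, -⟩ := hadd.exists_hom
  exact ⟨θ, fun X Y hX hY => by rw [hθ X hX, hΦ X Y hX hY]⟩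

end SSpace

theorem existsUnique_isProduct : ∃! mul : KS →+ KS →+ KS, IsProduct mul := by
  choose θ hθ using exists_box_component
  refine ⟨AddMonoidHom.mk' (fun a => AddMonoidHom.mk' (fun b n => θ n a b) fun b b' =>
    funext fun n => map_add (θ n a) b b') fun a a' => ?_, fun X Y hX hY => ?_, fun mul h => ?_⟩
  · ext b n
    change θ n (a + a') b = θ n a b + θ n a' b
    rw [map_add]
    rfl
  · have : X.Var := ⟨hX⟩
    have : Y.Var := ⟨hY⟩
    exact ⟨(inferInstance : (X.box Y).Var).out, funext fun n => hθ n X Y ⟨hX⟩ ⟨hY⟩⟩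
  · refine hom_ext fun X hX => hom_ext fun Y hY => ?_
    rw [(h X Y hX.out hY.out).2]
    exact funext fun n => (hθ n X Y hX hY).symm

namespace SSpace

/-! ### The units of the product and the composition -/

/-- The objectwise product. -/
def times (X Y : SSpace) : SSpace where
  obj A _ := RegSpace.prod (X.obj A) (Y.obj A)
  map e z := (X.map e z.1, Y.map e z.2)
  map_refl A _ z := Prod.ext (X.map_refl A z.1) (Y.map_refl A z.2)
  map_trans e f z := Prod.ext (X.map_trans e f z.1) (Y.map_trans e f z.2)

instance times_var (X Y : SSpace) [X.Var] [Y.Var] : (X.times Y).Var :=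
  .of_qp (fun A _ => inferInstanceAs (QP (RegSpace.prod (X.obj A) (Y.obj A)))) fun A _ _ _ e =>
    have : ((X.times Y).obj A).Nice := inferInstanceAs (RegSpace.prod (X.obj A) (Y.obj A)).Nice
    isMorphism_prod ((X.isMorphism_map e).comp (isMorphism_fst _ _))
      ((Y.isMorphism_map e).comp (isMorphism_snd _ _))

/-- The powers `X^A`. -/
def power (X : RegSpace) : SSpace where
  obj A _ := RegSpace.pi fun _ : A => X
  map e z := fun b => z (e.symm b)
  map_refl _ _ _ := rfl
  map_trans _ _ _ := rfl

instance power_var (X : RegSpace) [QP X] : (power X).Var :=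
  .of_qp (fun A _ => inferInstanceAs (QP (RegSpace.pi fun _ : A => X))) fun A _ _ _ e =>
    have : ((power X).obj A).Nice := inferInstanceAs (RegSpace.pi fun _ : A => X).Nice
    isMorphism_pi fun b => isMorphism_apply (X := fun _ : A => X) (e.symm b)

theorem cls_times_left (X Y : SSpace) [X.Var] [Y.Var] (y : ∀ (A : Type) [Finite A], (Y.obj A).Pt)
    (hY : ∀ (A : Type) [Finite A], Subsingleton (Y.obj A).Pt) : cls (X.times Y) = cls X :=
  funext fun _ => (cls_eq_of_hom (X := X.times Y) (Y := X)
    ⟨fun _ _ _ z => z.1, fun _ _ _ _ => rfl⟩ (fun A _ _ =>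
      have := hY A
      ⟨fun _ _ h => Prod.ext h (Subsingleton.elim _ _), isMorphism_fst _ _, fun _ _ _ h =>
        isMorphism_prod h (isMorphism_of_subsingleton (Y := Y.obj A) _)⟩)
    fun A _ _ x => ⟨(x, y A), rfl⟩).symm

theorem cls_times_right (X Y : SSpace) [X.Var] [Y.Var] (x : ∀ (A : Type) [Finite A], (X.obj A).Pt)
    (hX : ∀ (A : Type) [Finite A], Subsingleton (X.obj A).Pt) : cls (X.times Y) = cls Y :=
  funext fun _ => (cls_eq_of_hom (X := X.times Y) (Y := Y)
    ⟨fun _ _ _ z => z.2, fun _ _ _ _ => rfl⟩ (fun A _ _ =>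
      have := hX A
      ⟨fun _ _ h => Prod.ext (Subsingleton.elim _ _) h, isMorphism_snd _ _, fun _ _ _ h =>
        isMorphism_prod (isMorphism_of_subsingleton (Y := X.obj A) _) h⟩)
    fun A _ _ y => ⟨(x A, y), rfl⟩).symm

/-- The space `X` as an `𝕊`-space in degree `m`, with trivial action. -/
abbrev constIn (m : ℕ) (X : RegSpace) : SSpace := (const X).filter (· = m)

theorem cls_constIn (m : ℕ) (X : RegSpace) [QP X] :
    cls (constIn m X) = Pi.single m (classOf (GSpace.trivial _ X)) := by
  funext n
  rcases eq_or_ne n m with rfl | h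
  · rw [cls_filter (p := (· = n)) rfl, Pi.single_eq_same]
    exact congrArg classOf (congrArg (GSpace.mk X) (MonoidHom.ext fun γ => Equiv.ext fun x => rfl))
  · rw [cls_filter_of_not (p := (· = m)) h, Pi.single_eq_of_ne h]

/-- A set is its only block for the trivial partition. -/
def topBlock (A : Type) (q : Quotient (⊤ : Setoid A)) : A ≃ Block ⊤ q :=
  (Equiv.subtypeUnivEquiv fun _ => q.inductionOn fun _ => Quotient.sound trivial).symm

theorem card_quotient_top (A : Type) [Nonempty A] : Nat.card (Quotient (⊤ : Setoid A)) = 1 := by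
  obtain ⟨a⟩ := ‹Nonempty A›
  refine Nat.card_eq_one_iff_exists.2 ⟨Quotient.mk _ a, ?_⟩
  rintro ⟨b⟩
  exact Quotient.sound (s := ⊤) trivial

theorem nonempty_of_pt {Y : SSpace} (hY : IsEmpty (Y.obj (Fin 0)).Pt) {A : Type} [Finite A]
    (y : (Y.obj A).Pt) : Nonempty A := by
  by_contra h
  have := not_nonempty_iff.1 h
  exact hY.false (Y.map (Equiv.equivOfIsEmpty A (Fin 0)) y)

/-- The isomorphism from `X × Y` to the composition of `X` in degree one with `Y`. -/
def constInOneHom (N : ℕ) (X : RegSpace) {Y : SSpace} (hY : IsEmpty (Y.obj (Fin 0)).Pt) :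
    Hom N ((const X).times Y) ((constIn 1 X).comp Y) where
  app A _ _ z :=
    have := nonempty_of_pt hY z.2
    ⟨⊤, ⟨⟨card_quotient_top A⟩, z.1⟩, fun q => Y.map (topBlock A q) z.2⟩
  nat {A B} _ _ _ _ e z := Sigma.ext rfl (heq_of_eq (Prod.ext rfl (funext fun q =>
    Y.map_map_eq (e := e) (f := topBlock B q) (e' := topBlock A ((moveQuot e ⊤).symm q))
      (f' := moveBlock e ⊤ q) (fun _ => rfl) z.2)))

theorem constInOneHom_imm (N : ℕ) (X : RegSpace) [QP X] {Y : SSpace} [Y.Var]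
    (hY : IsEmpty (Y.obj (Fin 0)).Pt) : (constInOneHom N X hY).Imm := by
  intro A _ h
  rcases isEmpty_or_nonempty A with hA | ⟨⟨a⟩⟩
  · have : IsEmpty (((const X).times Y).obj A).Pt :=
      ⟨fun z => (nonempty_of_pt hY z.2).elim hA.elim⟩
    exact .of_isEmpty _
  · have : Nonempty A := ⟨a⟩
    let P : RegSpace := RegSpace.pi fun q : Quotient (⊤ : Setoid A) => Y.obj (Block ⊤ q)
    have key : IsImm (((const X).times Y).obj A) (compPart (constIn 1 X) Y (⊤ : Setoid A))
        fun z => (⟨⟨card_quotient_top A⟩, z.1⟩, fun q => Y.map (topBlock A q) z.2) := by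
      refine .of_leftInverse (ψ := fun z => (z.1.2, Y.map (topBlock A (Quotient.mk _ a)).symm
        (z.2 (Quotient.mk _ a)))) ?_ ?_ fun z => Prod.ext rfl (Y.map_symm_map _ _)
      · exact isMorphism_prod ((isMorphism_mk (X := fun _ : PLift _ => X) _).comp
          (isMorphism_fst X (Y.obj A)))
          (isMorphism_pi fun q => (Y.isMorphism_map (topBlock A q)).comp
            (isMorphism_snd X (Y.obj A)))
      · exact isMorphism_prod ((isImm_sigma_snd X _).morph.comp
          (isMorphism_fst ((constIn 1 X).obj (Quotient ⊤)) P))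
          ((Y.isMorphism_map _).comp ((isMorphism_apply _).comp
            (isMorphism_snd ((constIn 1 X).obj (Quotient ⊤)) P)))
    exact (isImm_compPart (constIn 1 X) Y (⊤ : Setoid A)).comp key

theorem constInOneHom_surj (N : ℕ) (X : RegSpace) {Y : SSpace} (hY : IsEmpty (Y.obj (Fin 0)).Pt) :
    (constInOneHom N X hY).Surj := by
  rintro A _ _ ⟨s, ⟨⟨h⟩, x⟩, y⟩
  obtain ⟨q₀, hq⟩ := Nat.card_eq_one_iff_exists.1 h
  obtain rfl : s = ⊤ := by
    refine Setoid.ext fun a b => iff_of_true ?_ trivial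
    exact Quotient.exact (s := s) ((hq _).trans (hq _).symm)
  refine ⟨(x, Y.map (topBlock A q₀).symm (y q₀)), ?_⟩
  refine congrArg (Sigma.mk (β := fun s : Setoid A => (compPart (constIn 1 X) Y s).Pt) ⊤)
    (Prod.ext rfl (funext fun q => ?_))
  obtain rfl : q = q₀ := hq q
  exact Y.map_map_symm _ _

theorem cls_constIn_one_comp (X : RegSpace) [QP X] (Y : SSpace) [Y.Var]
    (hY : IsEmpty (Y.obj (Fin 0)).Pt) : cls ((constIn 1 X).comp Y) = cls ((const X).times Y) :=
  funext fun n => cls_eq_of_hom _ (constInOneHom_imm n X hY) (constInOneHom_surj n X hY)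

/-- The isomorphism from `X × Y` to the product of `X` in degree zero with `Y`. -/
def constInZeroHom (N : ℕ) (X : RegSpace) (Y : SSpace) :
    Hom N ((const X).times Y) ((constIn 0 X).box Y) where
  app A _ _ z := ⟨fun _ => false, ⟨⟨by simp⟩, z.1⟩,
    Y.map (Equiv.subtypeUnivEquiv fun _ => rfl).symm z.2⟩
  nat {A B} _ _ _ _ e z := Sigma.ext rfl (heq_of_eq (Prod.ext rfl (Y.map_map_eq (e := e)
    (f := (Equiv.subtypeUnivEquiv (p := fun _ : B => false = false) fun _ => rfl).symm)
    (e' := (Equiv.subtypeUnivEquiv (p := fun _ : A => false = false) fun _ => rfl).symm)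
    (f' := e.subtypeEquiv fun _ => Iff.rfl) (fun _ => rfl) z.2)))

theorem constInZeroHom_imm (N : ℕ) (X : RegSpace) [QP X] (Y : SSpace) [Y.Var] :
    (constInZeroHom N X Y).Imm := by
  intro A _ h
  let c : A → Bool := fun _ => false
  have hc : Nat.card {a // c a = true} = 0 := by simp [c]
  let e : A ≃ {a // c a = false} := (Equiv.subtypeUnivEquiv fun _ => rfl).symm
  have key : IsImm (((const X).times Y).obj A)
      (RegSpace.prod ((constIn 0 X).obj {a // c a = true}) (Y.obj {a // c a = false}))
      fun z => (⟨⟨hc⟩, z.1⟩, Y.map e z.2) := by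
    refine .of_leftInverse (ψ := fun z => (z.1.2, Y.map e.symm z.2)) ?_ ?_
      fun z => Prod.ext rfl (Y.map_symm_map _ _)
    · exact isMorphism_prod ((isMorphism_mk (X := fun _ : PLift _ => X) _).comp
        (isMorphism_fst X (Y.obj A))) ((Y.isMorphism_map e).comp (isMorphism_snd X (Y.obj A)))
    · exact isMorphism_prod ((isImm_sigma_snd X _).morph.comp
        (isMorphism_fst ((constIn 0 X).obj {a // c a = true}) _))
        ((Y.isMorphism_map _).comp (isMorphism_snd ((constIn 0 X).obj {a // c a = true}) _))
  exact (IsImm.sigmaMk (X := fun c : A → Bool =>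
    RegSpace.prod ((constIn 0 X).obj {a // c a = true}) (Y.obj {a // c a = false})) c).comp key

theorem constInZeroHom_surj (N : ℕ) (X : RegSpace) (Y : SSpace) : (constInZeroHom N X Y).Surj := by
  rintro A _ _ ⟨c, ⟨⟨h⟩, x⟩, y⟩
  have h' : IsEmpty {a // c a = true} := by
    rcases Finite.card_eq_zero_iff.1 h with h
    exact h
  obtain rfl : c = fun _ => false := funext fun a => by
    by_contra ha
    exact h'.false ⟨a, by simpa using ha⟩
  refine ⟨(x, Y.map (Equiv.subtypeUnivEquiv fun _ => rfl) y), ?_⟩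
  exact congrArg (Sigma.mk (β := fun c : A → Bool =>
    (RegSpace.prod ((constIn 0 X).obj {a // c a = true}) (Y.obj {a // c a = false})).Pt)
      fun _ => false)
    (Prod.ext rfl (Y.map_symm_map _ _))

theorem cls_constIn_zero_box (X : RegSpace) [QP X] (Y : SSpace) [Y.Var] :
    cls ((constIn 0 X).box Y) = cls ((const X).times Y) :=
  funext fun n => cls_eq_of_hom _ (constInZeroHom_imm n X Y) (constInZeroHom_surj n X Y)

/-- The blocks of a partition into single elements. -/
def botQuot {A : Type} {s : Setoid A} (hs : ∀ a b, s a b → a = b) : A ≃ Quotient s :=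
  Equiv.ofBijective (Quotient.mk s) ⟨fun _ _ h => hs _ _ (Quotient.exact h), Quotient.mk_surjective⟩

theorem card_block_of_eq {A : Type} {s : Setoid A} (hs : ∀ a b, s a b → a = b) (q : Quotient s) :
    Nat.card (Block s q) = 1 := by
  obtain ⟨a, rfl⟩ := Quotient.mk_surjective q
  exact Nat.card_eq_one_iff_exists.2 ⟨⟨a, rfl⟩, fun b => Subtype.ext (hs _ _ (Quotient.exact b.2))⟩

/-- A point of the composition of `G` with `X` in degree one. -/
def compConstPt {G : SSpace} {X : RegSpace} {A : Type} [Finite A] (s : Setoid A)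
    (hs : ∀ a b, s a b → a = b) (g : (G.obj A).Pt) (z : A → X.Pt) : compPt G (constIn 1 X) A :=
  ⟨s, G.map (botQuot hs) g, fun q => ⟨⟨card_block_of_eq hs q⟩, z ((botQuot hs).symm q)⟩⟩

theorem compConstPt_eq {G : SSpace} {X : RegSpace} {A : Type} [Finite A] {s s' : Setoid A}
    (hs : ∀ a b, s a b → a = b) (hs' : ∀ a b, s' a b → a = b) (g : (G.obj A).Pt) (z : A → X.Pt) :
    compConstPt s hs g z = compConstPt s' hs' g z := by
  obtain rfl : s = s' := Setoid.ext fun a b =>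
    ⟨fun h => hs a b h ▸ s'.refl a, fun h => hs' a b h ▸ s.refl a⟩
  rfl

/-- The isomorphism from `G(A) × X^A` to the composition of `G` with `X` in degree one. -/
def compConstHom (N : ℕ) (G : SSpace) (X : RegSpace) :
    Hom N (G.times (power X)) (G.comp (constIn 1 X)) where
  app A _ _ z := compConstPt ⊥ (fun _ _ h => h) z.1 z.2
  nat {A B} _ _ _ _ e z := by
    refine (compConstPt_eq (s' := moveSetoid e ⊥) _ (fun a b h => e.symm.injective h) _ _).trans ?_
    have hb : ∀ a b : A, (⊥ : Setoid A) a b → a = b := fun _ _ h => h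
    have hb' : ∀ a b, moveSetoid e ⊥ a b → a = b := fun a b h => e.symm.injective h
    refine Sigma.ext rfl (heq_of_eq (Prod.ext (G.map_map_eq (e := e) (f := botQuot hb')
      (e' := botQuot hb) (f' := moveQuot e ⊥) (fun a => ?_) z.1) (funext fun q => ?_)))
    · rfl
    · obtain ⟨b, rfl⟩ := (botQuot hb').surjective q
      refine Sigma.ext rfl (heq_of_eq (congrArg z.2 ?_))
      change e.symm ((botQuot hb').symm (botQuot hb' b)) = (botQuot hb).symm (botQuot hb (e.symm b))
      rw [Equiv.symm_apply_apply, Equiv.symm_apply_apply]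

theorem compConstHom_imm (N : ℕ) (G : SSpace) [G.Var] (X : RegSpace) [QP X] :
    (compConstHom N G X).Imm := by
  intro A _ h
  have hs : ∀ a b : A, (⊥ : Setoid A) a b → a = b := fun _ _ h => h
  let P : RegSpace := RegSpace.pi fun q : Quotient (⊥ : Setoid A) => (constIn 1 X).obj (Block ⊥ q)
  have key : IsImm ((G.times (power X)).obj A) (compPart G (constIn 1 X) (⊥ : Setoid A))
      fun z => (G.map (botQuot hs) z.1,
        fun q => ⟨⟨card_block_of_eq hs q⟩, z.2 ((botQuot hs).symm q)⟩) := by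
    refine .of_leftInverse (ψ := fun z => (G.map (botQuot hs).symm z.1,
      fun a => (z.2 (botQuot hs a)).2)) ?_ ?_
      fun z => Prod.ext (G.map_symm_map _ _) (funext fun a => ?_)
    · exact isMorphism_prod ((G.isMorphism_map _).comp (isMorphism_fst (G.obj A) ((power X).obj A)))
        (isMorphism_pi fun q => (isMorphism_mk (X := fun _ : PLift _ => X) _).comp
          ((isMorphism_apply (X := fun _ : A => X) _).comp
            (isMorphism_snd (G.obj A) ((power X).obj A))))
    · exact isMorphism_prod ((G.isMorphism_map _).comp (isMorphism_fst (G.obj (Quotient ⊥)) P))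
        (isMorphism_pi fun a => (isImm_sigma_snd X _).morph.comp ((isMorphism_apply
          (X := fun q : Quotient (⊥ : Setoid A) => (constIn 1 X).obj (Block ⊥ q)) _).comp
            (isMorphism_snd (G.obj (Quotient ⊥)) P)))
    · exact congrArg z.2 ((botQuot hs).symm_apply_apply a)
  exact (isImm_compPart G (constIn 1 X) (⊥ : Setoid A)).comp key

theorem compConstHom_surj (N : ℕ) (G : SSpace) (X : RegSpace) : (compConstHom N G X).Surj := by
  rintro A _ _ ⟨s, g, y⟩
  have hs : ∀ a b, s a b → a = b := fun a b hab => by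
    obtain ⟨c, hc⟩ := Nat.card_eq_one_iff_exists.1 (y (Quotient.mk s b)).1.down
    exact congrArg Subtype.val ((hc ⟨a, Quotient.sound hab⟩).trans (hc ⟨b, rfl⟩).symm)
  refine ⟨(G.map (botQuot hs).symm g, fun a => (y (botQuot hs a)).2),
    (compConstPt_eq (s' := s) _ hs _ _).trans ?_⟩
  refine Sigma.ext rfl (heq_of_eq (Prod.ext (G.map_map_symm _ _) (funext fun q => ?_)))
  obtain ⟨a, rfl⟩ := (botQuot hs).surjective q
  refine Sigma.ext (Subsingleton.elim _ _) (heq_of_eq ?_)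
  change (y (botQuot hs ((botQuot hs).symm (botQuot hs a)))).2 = _
  rw [Equiv.symm_apply_apply]

theorem cls_comp_constIn_one (G : SSpace) [G.Var] (X : RegSpace) [QP X] :
    cls (G.comp (constIn 1 X)) = cls (G.times (power X)) :=
  funext fun n => cls_eq_of_hom _ (compConstHom_imm n G X) (compConstHom_surj n G X)

/-- `s_0 ∘ Y` is `s_0`: only the empty set has a partition without blocks. -/
theorem cls_constIn_zero_comp (Y : SSpace) [Y.Var] :
    cls ((constIn 0 point).comp Y) = cls (constIn 0 point) := by
  have he : ∀ {A : Type} [Finite A] (_ : Nat.card A = 0) (s : Setoid A), IsEmpty (Quotient s) :=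
    fun {A} _ h s =>
      have : IsEmpty A := (Finite.card_eq_zero_iff.1 h)
      ⟨fun q => q.exists_rep.elim fun a _ => this.elim a⟩
  have hcard : ∀ {A : Type} [Finite A] (_ : Nat.card A = 0) (s : Setoid A),
      Nat.card (Quotient s) = 0 := fun h s => have := he h s; Nat.card_of_isEmpty
  have hsub : ∀ (A : Type) [Finite A], Subsingleton ((constIn 0 point).obj A).Pt := fun A _ =>
    ⟨fun x y => Sigma.ext (Subsingleton.elim _ _) (heq_of_eq (Subsingleton.elim (α := Unit) _ _))⟩
  have hsub' : ∀ {A : Type} [Finite A] (_ : Nat.card A = 0),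
      Subsingleton (((constIn 0 point).comp Y).obj A).Pt := by
    intro A _ h
    refine ⟨?_⟩
    rintro ⟨s, x, y⟩ ⟨s', x', y'⟩
    have hA : IsEmpty A := Finite.card_eq_zero_iff.1 h
    obtain rfl : s = s' := Setoid.ext fun a => hA.elim a
    have := he h s
    exact Sigma.ext rfl (heq_of_eq (Prod.ext ((hsub (Quotient s)).elim _ _)
      (funext fun q => isEmptyElim q)))
  funext n
  refine cls_eq_of_hom (X := constIn 0 point) (Y := (constIn 0 point).comp Y) ⟨fun A _ _ z =>
    have := he z.1.down ⊤
    ⟨⊤, ⟨⟨hcard z.1.down ⊤⟩, ()⟩, fun q => isEmptyElim q⟩, fun {A B} _ _ _ _ e z => ?_⟩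
    (fun A _ h => ?_) ?_
  · exact (hsub' ((Nat.card_congr e).symm.trans z.1.down)).elim _ _
  · have := hsub A
    refine ⟨fun _ _ _ => Subsingleton.elim _ _, isMorphism_sigma fun h' => ?_,
      fun _ _ _ _ => isMorphism_of_subsingleton _⟩
    have := hsub' h'.down
    exact isMorphism_of_subsingleton (Y := ((constIn 0 point).comp Y).obj A) _
  · rintro A _ _ ⟨s, ⟨⟨h⟩, x⟩, y⟩
    have hA : Nat.card A = 0 := by
      have := Finite.card_eq_zero_iff.1 h
      exact Finite.card_eq_zero_iff.2 ⟨fun a => this.elim (Quotient.mk s a)⟩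
    exact ⟨⟨⟨hA⟩, ()⟩, (hsub' hA).elim _ _⟩

/-! ### Configurations and powers -/

theorem isClosed_apply_eq {X : RegSpace} [QP X] {A : Type} [Finite A] (a b : A) :
    @IsClosed _ (RegSpace.pi fun _ : A => X).top {z : A → X.Pt | z a = z b} :=
  isClosed_eq_of_isMorphism (Z := RegSpace.pi fun _ : A => X) (isMorphism_apply (X := fun _ => X) a)
    (isMorphism_apply (X := fun _ => X) b)

/-- The injective maps form an open subset, because varieties are separated. -/
theorem isOpen_injective {X : RegSpace} [QP X] {A : Type} [Finite A] :
    @IsOpen _ (RegSpace.pi fun _ : A => X).top {z : A → X.Pt | Function.Injective z} := by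
  have : {z : A → X.Pt | Function.Injective z} =
      ⋂ (a : A) (b : A) (_ : a ≠ b), {z : A → X.Pt | z a = z b}ᶜ := by
    ext z
    simp only [Set.mem_iInter]
    exact ⟨fun h a b hab hz => hab (h hz), fun h a b hz => by_contra fun hab => h a b hab hz⟩
  refine (congrArg (@IsOpen _ (RegSpace.pi fun _ : A => X).top) this).mpr ?_
  exact isOpen_iInter_of_finite fun a => isOpen_iInter_of_finite fun b =>
    isOpen_iInter_of_finite fun _ => (isClosed_apply_eq (X := X) a b).isOpen_compl

instance config_var (X : RegSpace) [QP X] : (config X).Var :=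
  .of_qp (fun A _ => QP.restrict (X := RegSpace.pi fun _ : A => X)
    (isOpen_injective (X := X)).isLocallyClosed) fun A _ _ _ e =>
    have : ((config X).obj A).Nice := inferInstanceAs
      ((RegSpace.pi fun _ : A => X).restrict {z : A → X.Pt | Function.Injective z}).Nice
    isMorphism_restrict (isMorphism_pi fun b => (isMorphism_apply (X := fun _ : A => X)
      (e.symm b)).comp isMorphism_val)

/-- A point in each positive degree. -/
abbrev points : SSpace := (const point).filter (1 ≤ ·)

theorem one_le_card_block {A : Type} [Finite A] (s : Setoid A) (q : Quotient s) :
    1 ≤ Nat.card (Block s q) := by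
  obtain ⟨a, rfl⟩ := Quotient.mk_surjective q
  have : Nonempty (Block s (Quotient.mk s a)) := ⟨⟨a, rfl⟩⟩
  exact Nat.card_pos

instance subsingleton_points (A : Type) [Finite A] : Subsingleton (points.obj A).Pt :=
  ⟨fun _ _ => Sigma.ext (Subsingleton.elim _ _) (heq_of_eq (Subsingleton.elim (α := Unit) _ _))⟩

/-- A partition of `A` and distinct points indexed by its blocks define a map from `A` to `X`. -/
def configFun (X : RegSpace) (A : Type) [Finite A] (v : compPt (config X) points A) : A → X.Pt :=
  fun a => v.2.1.1 (Quotient.mk v.1 a)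

theorem configFun_eq_iff {X : RegSpace} {A : Type} [Finite A] (v : compPt (config X) points A)
    {a b : A} : configFun X A v a = configFun X A v b ↔ v.1 a b :=
  v.2.1.2.eq_iff.trans Quotient.eq

theorem configFun_bijective (X : RegSpace) (A : Type) [Finite A] :
    Function.Bijective (configFun X A) := by
  constructor
  · rintro ⟨s, c, y⟩ ⟨s', c', y'⟩ h
    obtain rfl : s = s' := Setoid.ext fun a b => by
      rw [← configFun_eq_iff ⟨s, c, y⟩, h, configFun_eq_iff]
    obtain rfl : c = c' := Subtype.ext (funext fun q => by
      obtain ⟨a, rfl⟩ := Quotient.mk_surjective q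
      exact congrFun h a)
    exact Sigma.ext rfl (heq_of_eq (Prod.ext rfl (funext fun q => Subsingleton.elim _ _)))
  · intro z
    refine ⟨⟨Setoid.ker z, ⟨Quotient.lift z fun _ _ h => h, ?_⟩,
      fun q => ⟨⟨one_le_card_block _ q⟩, ()⟩⟩, rfl⟩
    rintro ⟨a⟩ ⟨b⟩ h
    exact Quotient.sound (s := Setoid.ker z) h

theorem isImm_configFun (X : RegSpace) [QP X] {A : Type} [Finite A] (s : Setoid A) :
    IsImm (compPart (config X) points s) ((power X).obj A)
      fun p => configFun X A ⟨s, p⟩ := by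
  refine ⟨fun p p' h => eq_of_heq (Sigma.mk.inj ((configFun_bijective X A).1 h)).2, ?_, ?_⟩
  · exact isMorphism_pi fun a => (isMorphism_apply (X := fun _ : Quotient s => X)
      (Quotient.mk s a)).comp (isMorphism_val.comp (isMorphism_fst ((config X).obj (Quotient s)) _))
  · intro Z _ χ hχ
    refine isMorphism_prod (isMorphism_restrict (isMorphism_pi fun q => ?_))
      (isMorphism_pi fun q => isMorphism_of_subsingleton _)
    refine ((isMorphism_apply (X := fun _ : A => X) q.out).comp hχ).congr fun z => ?_
    exact congrArg (χ z).1.1 q.out_eq.symm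

/-- A map from `A` to `X` is a partition of `A` together with distinct points for its blocks.  The
bijection is an isomorphism on each of the strata given by the number of coincidences. -/
theorem cls_config_comp (X : RegSpace) [QP X] : cls ((config X).comp points) = cls (power X) := by
  funext n
  let A := Fin n
  let C : A × A → Set (A → X.Pt) := fun p => {z | z p.1 = z p.2}
  symm
  refine GSpace.classOf_eq_of_strata (X := (power X).level n)
    (X' := ((config X).comp points).level n) (Equiv.ofBijective _ (configFun_bijective X A))
    (isMorphism_sigma fun s => (isImm_configFun X s).morph) (fun γ v => rfl)
    (fun z => Nat.card {p // z ∈ C p}) ?_ ?_ (Nat.card (A × A) + 1) ?_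
    (fun s : Setoid A => compPart (config X) points s) (fun s => Nat.card {p : A × A // s p.1 p.2})
    (fun s => Sigma.mk (β := fun s : Setoid A => (compPart (config X) points s).Pt) s)
    (fun s => isImm_compPart (config X) points s) (fun s => isImm_configFun X s)
    (fun s => {z | ∀ p, z ∈ C p → s p.1 p.2}) ?_ ?_ ?_
  · intro γ z
    exact Nat.card_congr ((γ.symm.prodCongr γ.symm).subtypeEquiv fun p => Iff.rfl)
  · exact GSpace.isClosed_le_card (P := (RegSpace.pi fun _ : A => X).Pt) C
      fun p => isClosed_apply_eq (X := X) p.1 p.2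
  · exact fun z => Nat.lt_succ_of_le (Nat.card_le_card_of_injective _ Subtype.val_injective)
  · intro s
    have : {z : A → X.Pt | ∀ p, z ∈ C p → s p.1 p.2} = ⋂ (p : A × A) (_ : ¬ s p.1 p.2), (C p)ᶜ := by
      ext z
      simp only [Set.mem_iInter]
      exact forall_congr' fun p => not_imp_not.symm
    refine (congrArg (@IsOpen _ ((power X).level n).space.top) this).mpr ?_
    exact isOpen_iInter_of_finite fun p => isOpen_iInter_of_finite fun _ =>
      (isClosed_apply_eq (X := X) p.1 p.2).isOpen_compl
  · intro s
    ext z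
    constructor
    · rintro ⟨p, rfl⟩
      exact ⟨fun q hq => (configFun_eq_iff ⟨s, p⟩).1 hq,
        Nat.card_congr (Equiv.subtypeEquivRight fun q => configFun_eq_iff ⟨s, p⟩)⟩
    · rintro ⟨h1, h2⟩
      obtain ⟨⟨s', p⟩, rfl⟩ := (configFun_bijective X A).2 z
      have h3 : {q : A × A | configFun X A ⟨s', p⟩ ∈ C q} = {q : A × A | s q.1 q.2} :=
        Set.eq_of_subset_of_ncard_le h1 (le_of_eq h2.symm)
      obtain rfl : s' = s := Setoid.ext fun a b =>
        (configFun_eq_iff ⟨s', p⟩).symm.trans (Set.ext_iff.1 h3 (a, b))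
      exact ⟨p, rfl⟩
  · rintro ⟨s, p⟩
    exact ⟨s, p, rfl⟩

end SSpace

/-! ### The exponential -/

theorem isPolynomialOfDegreeLE_const {G H : Type*} [AddCommGroup G] [AddCommGroup H] (c : H) :
    IsPolynomialOfDegreeLE 0 fun _ : G => c := fun b h => by
  have : (Finset.univ : Finset (Finset (Fin 1))) = {∅, {0}} := by decide
  change ∑ T : Finset (Fin 1), (-1 : ℤ) ^ T.card • c = 0
  rw [this, Finset.sum_pair (by decide)]
  simp

theorem s_eq_cls (m : ℕ) : s m = cls (constIn m point) := (cls_constIn m point).symm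

theorem cls_const_point : cls (const point) = s 0 + cls points := by
  funext n
  rw [s_eq_cls, Pi.add_apply]
  rcases Nat.eq_zero_or_pos n with rfl | hn
  · rw [cls_filter (p := (· = 0)) rfl, cls_filter_of_not (p := (1 ≤ ·)) (by simp), add_zero]
  · rw [cls_filter_of_not (p := (· = 0)) hn.ne', cls_filter (p := (1 ≤ ·)) hn, zero_add]

/-- The truncation of the elements of `F1` to the degrees below `m`. -/
def trunc (m : ℕ) : F1 →+ F1 :=
  AddMonoidHom.mk' (fun b => ⟨fun k => if k < m then (b : KS) k else 0, by
    change ite _ ((b : KS) 0) 0 = 0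
    rw [show (b : KS) 0 = 0 from b.2, ite_self]⟩) fun b c => Subtype.ext (funext fun k => by
      change ite _ ((b : KS) k + (c : KS) k) 0 = ite _ ((b : KS) k) 0 + ite _ ((c : KS) k) 0
      split <;> simp)

theorem trunc_apply (m : ℕ) (b : F1) (k : ℕ) :
    (trunc m b : KS) k = if k < m then (b : KS) k else 0 := rfl

/-- If `X` lives in degrees at least two, the part of degree `m` of `X ∘ Y` depends only on the
parts of degrees below `m` of `Y`, because the blocks of a partition into at least two blocks are
proper subsets. -/
theorem cls_comp_filter_lt (X Y : SSpace) [X.Var] [Y.Var] (m : ℕ) :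
    cls ((X.filter (2 ≤ ·)).comp Y) m = cls ((X.filter (2 ≤ ·)).comp (Y.filter (· < m))) m := by
  refine cls_eq_of_hom (compHom (idHom m _) (filterHom m Y (· < m)))
    (compHom_imm (idHom_imm m _) (filterHom_imm m Y _)) fun A _ hA => ?_
  rw [← Set.range_eq_univ, range_compHom]
  refine Set.eq_univ_of_forall ?_
  rintro ⟨s, ⟨⟨h⟩, x⟩, y⟩
  refine ⟨⟨_, rfl⟩, fun q => ⟨⟨⟨lt_of_lt_of_le ?_ hA⟩, y q⟩, rfl⟩⟩
  have : Nontrivial (Quotient s) := Finite.one_lt_card_iff_nontrivial.1 h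
  obtain ⟨q', hq'⟩ := exists_ne q
  obtain ⟨a, rfl⟩ := Quotient.mk_surjective q'
  exact Finite.card_subtype_lt (x := a) hq'

namespace IsPreComposition

variable {op : KS →+ (F1 → KS)}

/-- `s_1` is a left unit. -/
theorem s_one_op (h : IsPreComposition op) (b : F1) : op (s 1) b = b := by
  funext n
  refine congrFun (effective_ext (φ := fun b : F1 => op (s 1) b n) (ψ := fun b : F1 => (b : KS) n)
    ((h.polynomial (s 1) n).mono (le_max_left n 1))
    ((isPolynomialOfDegreeLE_hom ((Pi.evalAddMonoidHom _ n).comp F1.subtype)).mono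
      (le_max_right n 1)) fun c Y hY he hc => ?_) b
  rw [s_eq_cls, h.cls_comp _ Y inferInstance hY he c hc, cls_constIn_one_comp point Y he,
    cls_times_right _ _ (fun _ _ => ()) fun _ _ => inferInstanceAs (Subsingleton Unit), hc]

theorem s_zero_op (h : IsPreComposition op) (b : F1) : op (s 0) b = s 0 := by
  funext n
  refine congrFun (effective_ext (φ := fun b : F1 => op (s 0) b n) (ψ := fun _ => s 0 n)
    (h.polynomial (s 0) n) ((isPolynomialOfDegreeLE_const (s 0 n)).mono n.zero_le)
    fun c Y hY he hc => ?_) b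
  rw [s_eq_cls, h.cls_comp _ Y inferInstance hY he c hc, cls_constIn_zero_comp]

/-- `s_1` is a right unit. -/
theorem op_s_one (h : IsPreComposition op) (a : KS) : op a s₁ = a := by
  funext n
  have key : opEval op s₁ n = Pi.evalAddMonoidHom _ n := hom_ext fun X hX => by
    change op (cls X) s₁ n = cls X n
    rw [h.cls_comp X (constIn 1 point) hX inferInstance (isEmpty_filter (by simp)) s₁ (s_eq_cls 1),
      cls_comp_constIn_one, cls_times_left _ _ (fun _ _ _ => ()) fun _ _ =>
        inferInstanceAs (Subsingleton (_ → Unit))]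
  exact DFunLike.congr_fun key a

/-- Multiplication with a class of degree zero is composition with the class in degree one. -/
theorem mul_cls₀ (h : IsPreComposition op) {mul : KS →+ KS →+ KS} (hm : IsProduct mul)
    (X : RegSpace) [QP X] (b : F1) : mul (cls₀ X) b = op (cls (constIn 1 X)) b := by
  funext n
  refine congrFun (effective_ext (φ := fun b : F1 => mul (cls₀ X) b n)
    (ψ := fun b : F1 => op (cls (constIn 1 X)) b n)
    ((isPolynomialOfDegreeLE_hom (((Pi.evalAddMonoidHom _ n).comp (mul (cls₀ X))).comp
      F1.subtype)).mono (le_max_right n 1))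
    ((h.polynomial _ n).mono (le_max_left n 1)) fun c Y hY he hc => ?_) b
  have h0 : cls₀ X = cls (constIn 0 X) := (cls_constIn 0 X).symm
  rw [h0, hc, (hm _ _ (filter_var (const X) _).out hY.out).2, cls_constIn_zero_box,
    h.cls_comp _ Y inferInstance hY he c hc, cls_constIn_one_comp X Y he]

/-- The sum that defines `Exp` is the composition with the class of a point in each positive
degree. -/
theorem Exp_eq (h : IsPreComposition op) (b : F1) : (Exp op b : KS) = op (cls points) b := by
  funext m
  change ∑ n ∈ Finset.Icc 1 m, opEval op b m (s n) = _
  rw [← map_sum]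
  refine h.congr_left (fun k hk => ?_) b
  rw [Finset.sum_apply]
  rcases Nat.eq_zero_or_pos k with rfl | hk'
  · rw [cls_filter_of_not (p := (1 ≤ ·)) (by simp)]
    refine Finset.sum_eq_zero fun n hn => Pi.single_eq_of_ne ?_ _
    have := (Finset.mem_Icc.1 hn).1
    omega
  · rw [cls_filter (p := (1 ≤ ·)) hk', Finset.sum_eq_single_of_mem k (Finset.mem_Icc.2 ⟨hk', hk⟩)
      fun n _ hn => Pi.single_eq_of_ne hn.symm _, s_eq_cls, cls_filter (p := (· = k)) rfl]

/-- The part of degree `m` of `X ∘ b` depends only on the parts of degrees below `m` of `b`. -/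
theorem op_trunc (h : IsPreComposition op) (X : SSpace) [X.Var] (b : F1) (m : ℕ) :
    op (cls (X.filter (2 ≤ ·))) b m = op (cls (X.filter (2 ≤ ·))) (trunc m b) m := by
  refine congrFun (effective_ext (φ := fun b : F1 => op (cls (X.filter (2 ≤ ·))) b m)
    (ψ := fun b : F1 => op (cls (X.filter (2 ≤ ·))) (trunc m b) m) (h.polynomial _ m)
    ((h.polynomial _ m).comp_hom (trunc m)) fun c Y hY he hc => ?_) b
  have he' : IsEmpty ((Y.filter (· < m)).obj (Fin 0)).Pt := ⟨fun z => he.false z.2⟩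
  have hc' : (trunc m c : KS) = cls (Y.filter (· < m)) := funext fun k => by
    rw [trunc_apply]
    split
    · rw [cls_filter (p := (· < m)) ‹k < m›, hc]
    · rw [cls_filter_of_not (p := (· < m)) ‹¬ k < m›]
  change op _ c m = op _ (trunc m c) m
  rw [h.cls_comp _ Y inferInstance hY he c hc,
    h.cls_comp _ (Y.filter (· < m)) inferInstance inferInstance he' _ hc', cls_comp_filter_lt]

end IsPreComposition

/-- A map of the form `b ↦ b + R b` is bijective if the part of degree `m` of `R b` depends only on
the parts of degrees below `m` of `b`: the equation `b + R b = c` is solved degree by degree. -/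
theorem bijective_of_strict {f R : F1 → F1} (hf : ∀ b, f b = b + R b)
    (hR : ∀ (b b' : F1) (m : ℕ), (∀ k < m, (b : KS) k = (b' : KS) k) →
      (R b : KS) m = (R b' : KS) m) :
    Function.Bijective f := by
  constructor
  · intro b b' hbb
    rw [hf, hf] at hbb
    refine Subtype.ext (funext fun m => ?_)
    induction m using Nat.strong_induction_on with
    | _ m ih =>
      have h1 : (b : KS) m + (R b : KS) m = (b' : KS) m + (R b' : KS) m :=
        congrFun (congrArg Subtype.val hbb) m
      rw [hR b b' m ih] at h1
      exact add_right_cancel h1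
  · intro c
    -- the iteration of `b ↦ c - R b` becomes stationary in each degree
    let B : ℕ → F1 := fun n => (fun b => c - R b)^[n] 0
    have hB : ∀ n k, (B (n + 1) : KS) k = (c : KS) k - (R (B n) : KS) k := fun n k =>
      congrFun (congrArg Subtype.val (Function.iterate_succ_apply' (fun b => c - R b) n 0)) k
    have hst : ∀ n, ∀ k < n, (B (n + 1) : KS) k = (B n : KS) k := by
      intro n
      induction n with
      | zero => exact fun k hk => absurd hk (Nat.not_lt_zero k)
      | succ n ih =>
        intro k hk
        rw [hB (n + 1), hB n, hR _ _ k fun j hj => ih j (by omega)]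
    have hst' : ∀ k n, k < n → (B n : KS) k = (B (k + 1) : KS) k := by
      intro k n hn
      induction n, hn using Nat.le_induction with
      | base => rfl
      | succ n hn ih => rw [hst n k hn, ih]
    refine ⟨⟨fun k => (B (k + 1) : KS) k, (B 1).2⟩, ?_⟩
    rw [hf]
    refine Subtype.ext (funext fun m => ?_)
    change (B (m + 1) : KS) m + (R _ : KS) m = (c : KS) m
    rw [hB m m]
    exact (congrArg _ (hR _ (B m) m fun k hk => (hst' k m hk).symm)).trans
      (sub_add_cancel ((c : KS) m) _)

theorem IsPreComposition.bijective_Exp {op : KS →+ (F1 → KS)} (h : IsPreComposition op) :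
    Function.Bijective (Exp op) := by
  have hg : cls ((const point).filter (2 ≤ ·)) ∈ F1 := cls_filter_of_not (by simp)
  have hpts : cls points = s 1 + cls ((const point).filter (2 ≤ ·)) := by
    rw [s_eq_cls]
    exact funext fun n => (isCut_filter n (const point) (p := (· = 1)) (q := (2 ≤ ·)) (r := (1 ≤ ·))
      (fun k _ => by omega) fun k _ => by omega).cls_eq le_rfl
  refine bijective_of_strict (R := fun b => h.opF1 b ⟨_, hg⟩) (fun b => Subtype.ext ?_)
    fun (b b' : F1) m hb => ?_
  · rw [h.Exp_eq, hpts, map_add]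
    change op (s 1) b + _ = _
    rw [h.s_one_op]
    rfl
  · change op _ b m = op _ b' m
    rw [h.op_trunc, h.op_trunc _ b']
    refine congrArg (fun c => op _ c m) (Subtype.ext (funext fun k => ?_))
    rw [trunc_apply, trunc_apply]
    split
    · exact hb k ‹k < m›
    · rfl

/-! ### The formula for configurations -/

/-- The classes of the powers of `X` are both `[F(X)] ∘ h` and
`(1 + h) ∘ p` for `h = ∑ s_n` and `p` the class of `X` in degree one. -/
theorem IsPreComposition.cls_config {op : KS →+ (F1 → KS)} (h : IsPreComposition op) (X : RegSpace)
    [QP X] {L : F1} (hL : Exp op L = s₁) (p : F1) (hp : (p : KS) = cls (constIn 1 X)) :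
    cls (config X) = s 0 + Exp op (h.opF1 L p) := by
  have he : IsEmpty (points.obj (Fin 0)).Pt := isEmpty_filter (by simp)
  have hpts : cls points ∈ F1 := cls_filter_of_not (by simp)
  have h1 : op (cls (config X)) ⟨_, hpts⟩ = op (cls (const point)) p := by
    rw [h.cls_comp (config X) points inferInstance inferInstance he _ rfl, cls_config_comp,
      h.cls_comp (const point) (constIn 1 X) inferInstance inferInstance
        (isEmpty_filter (by simp)) p hp, cls_comp_constIn_one,
      cls_times_right _ _ (fun _ _ => ()) fun _ _ => inferInstanceAs (Subsingleton Unit)]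
  have h2 : h.opF1 L ⟨_, hpts⟩ = s₁ := by
    rw [← hL]
    exact Subtype.ext (h.Exp_eq L).symm
  rw [← h.op_s_one (cls (config X)), ← h2, ← h.assoc, h1, h.assoc, cls_const_point, map_add,
    Pi.add_apply, h.s_zero_op, h.Exp_eq]

end SVar

end

open SVar
/-- The product and the composition operation of `K(V, 𝕊)` exist and are unique, `Exp` has an
inverse `Log` on `F_1`, and `[F(X)] = 1 + Exp([X] Log(s_1))` for each quasi-projective `X`. -/
theorem mainTheorem6 :
    (∃! mul : KS →+ KS →+ KS, IsProduct mul) ∧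
    (∃! op : KS →+ (F1 → KS), IsComposition op) ∧
    ∀ (mul : KS →+ KS →+ KS) (op : KS →+ (F1 → KS)), IsProduct mul → IsComposition op →
      ∃ Log : F1 → F1,
        Function.LeftInverse Log (Exp op) ∧ Function.RightInverse Log (Exp op) ∧
        ∀ X : RegSpace, X.IsQuasiProjective →
          (∀ n : ℕ, ((SSpace.config X).level n).IsVariety) ∧
          ∃ b : F1, (b : KS) = mul (cls₀ X) (Log s₁) ∧
            cls (SSpace.config X) = s 0 + Exp op b := by
  refine ⟨existsUnique_isProduct, existsUnique_isComposition, fun mul op hmul hop => ?_⟩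
  have h := hop.isPreComposition
  obtain ⟨Log, hl, hr⟩ := Function.bijective_iff_has_inverse.1 h.bijective_Exp
  refine ⟨Log, hl, hr, fun X hX => ?_⟩
  have : RegSpace.QP X := ⟨hX⟩
  have hp : cls (SSpace.constIn 1 X) ∈ F1 := SSpace.cls_filter_of_not (by simp)
  refine ⟨fun n => (inferInstance : ((SSpace.config X).level n).Var).out, h.opF1 (Log s₁) ⟨_, hp⟩,
    (h.mul_cls₀ hmul X (Log s₁)).symm, h.cls_config X (hr s₁) ⟨_, hp⟩ rfl⟩
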